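/- **Setting and definitions.** Let $d\ge 1$ and let $\mathcal S_d$ be the set of all $\phi:\mathbb Z^d\to\mathbb C$ with $\sum_{x}|x^\beta\phi(x)|<\infty$ for every multi-index $\beta\in\mathbb N^d$. Put $\phi^{(1)}=\phi$ and $\phi^{(n)}(x)=\sum_{y\in\mathbb Z^d}\phi^{(n-1)}(x-y)\phi(y)$ for $n\ge2$; let $\widehat\phi(\xi)=\sum_{x}\phi(x)e^{ix\cdot\xi}$ for $\xi\in\mathbb R^d$, $\|\phi^{(n)}\|_\infty=\sup_{x\in\mathbb Z^d}|\phi^{(n)}(x)|$, and $\Omega(\phi)=\{\xi\in(-\pi,\pi]^d:|\widehat\phi(\xi)|=1\}$. For $E\in\mathrm{End}(\mathbb R^d)$ and $t>0$ let $t^E=\exp((\log t)E)$; $\{t^E\}$ is contracting if $\|t^E\|\to0$ as $t\to0^+$. For $P:\mathbb R^d\to\mathbb R$ let $\mathrm{Exp}(P)$ be the set of all $E$ with $P(t^E\xi)=tP(\xi)$ for all $t>0$, $\xi\in\mathbb R^d$ ($P$ is then called homogeneous with respect to $E$). $P$ is positive homogeneous if it is continuous, $P\ge0$ with $P(\xi)=0$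 only for $\xi=0$, $\mathrm{Exp}(P)\ne\emptyset$, and $\{P=1\}$ is compact; its homogeneous order $\mu_P$ is the common value of $\operatorname{tr}E$, $E\in\mathrm{Exp}(P)$. Let $\{t^E\}$ be contracting. A continuous function $\widetilde P$ on an open neighborhood of $0$ is subhomogeneous with respect to $E$ if for all $\epsilon>0$ and compact $K\subseteq\mathbb R^d$ there is $\tau>0$ with $|\widetilde P(t^E\xi)|\le\epsilon t$ for $0<t<\tau$, $\xi\in K$; it is strongly subhomogeneous of order $l$ if it is $C^l$ and, likewise, $|t^k\partial_t^k\widetilde P(t^E\xi)|\le\epsilon t$ for all $0\le k\le l$, $0<t<\tau$, $\xi\in K$. Assume $\sup_\xi|\widehat\phi(\xi)|=1$. For $\xi_0\in\Omega(\phi)$ consider expansions, for $\xi$ in an open convex neighborhood of $0$ on which the principal logarithm below is continuous, $$\Gamma_{\xi_0}(\xi)=\log\frac{\widehat\phi(\xi+\xi_0)}{\widehat\phi(\xi_0)}=i\alpha_{\xi_0}\cdot\xi-i\bigl(Q(\xi)+\widetilde Q(\xi)\bigr)-\bigl(R(\xi)+\widetilde R(\xi)\bigr)$$ with $\alpha_{\xi_0}\in\mathbb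 R^d$, real polynomials $Q,R$ without constant and linear terms, and real-valued smooth functions $\widetilde Q,\widetilde R$ vanishing at $0$. The point $\xi_0$ is of *positive homogeneous type* if, for some such expansion, $R$ is positive homogeneous and there is $E\in\mathrm{Exp}(R)$ such that $Q$ is homogeneous and $\widetilde Q,\widetilde R$ are subhomogeneous with respect to $E$; then $\mu_{\xi_0}=\mu_R$. It is of *imaginary homogeneous type* if, for some such expansion, $|Q|$ and $R$ are positive homogeneous and there are $E\in\mathrm{Exp}(|Q|)$ and $k>1$ such that $R$ is homogeneous with respect to $E/k$, $\widetilde Q$ is strongly subhomogeneous with respect to $E$ of order $2$, and $\widetilde R$ is strongly subhomogeneous with respect to $E/k$ of order $1$; then $\mu_{\xi_0}=\mu_{|Q|}$. In both cases $\alpha_{\xi_0}$ is the drift and $\mu_{\xi_0}$ the homogeneous order of $\xi_0$. Let $\Omega_i(\phi)$ be the set of points of $\Omega(\phi)$ of imaginary homogeneous type, and $\mu_\phi=\min_{\xi\in\Omega(\phi)}\mu_\xi$. **Theorem.** Let $\phi\in\mathcal S_d$ with $\sup_\xi|\widehat\phi(\xi)|=1$. Suppose that every point of $\Omega(\phi)$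 is of positive homogeneous or of imaginary homogeneous type for $\widehat\phi$, that $\Omega_i(\phi)\ne\emptyset$, that $\mu_\xi<1$ for every $\xi\in\Omega_i(\phi)$, that $\mu_\xi=\mu_\phi$ for some $\xi\in\Omega_i(\phi)$, and that there is $\alpha\in\mathbb R^d$ with $\alpha_\xi=\alpha$ for all $\xi\in\Omega_i(\phi)$. Then for each compact $K\subseteq\mathbb R^d$ there are a constant $C'>0$ and a nested increasing sequence of compact sets $K_n$, all containing $K$ and with union $\mathbb R^d$, such that $$|\phi^{(n)}(x)|\le C'n^{-\mu_\phi}\qquad\text{for all } n\ge1 \text{ and } x\in(n\alpha+K_n)\cap\mathbb Z^d.$$ Furthermore, there is a constant $C>0$ such that $Cn^{-\mu_\phi}\le\|\phi^{(n)}\|_\infty$ for all $n\ge1$. -/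

import Mathlib

open scoped ContDiff

/-- Euclidean space `ℝ^d`. -/
abbrev Rd (d : ℕ) : Type := EuclideanSpace ℝ (Fin d)

/-- The integer lattice `ℤ^d`. -/
abbrev Zd (d : ℕ) : Type := Fin d → ℤ

/-- The inclusion of `ℤ^d` in `ℝ^d`. -/
noncomputable def latticePt {d : ℕ} (x : Zd d) : Rd d :=
  WithLp.toLp 2 (fun i => (x i : ℝ))

/-- The space `𝒮_d` of all `φ : ℤ^d → ℂ` such that `x ↦ x^β φ(x)` is absolutely summable for
every multi-index `β`. -/
def MemSd {d : ℕ} (φ : Zd d → ℂ) : Prop :=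
  ∀ β : Fin d → ℕ, Summable fun x : Zd d => ‖(∏ i, (x i : ℂ) ^ β i) * φ x‖

/-- The convolution powers: `φ^{(n+1)}(x) = ∑_y φ^{(n)}(x - y) φ(y)`, where `φ^{(0)}` is the unit
mass at the origin, so that `φ^{(1)} = φ` (see `convPow_one`). -/
noncomputable def convPow {d : ℕ} (φ : Zd d → ℂ) : ℕ → Zd d → ℂ
  | 0 => fun x => if x = 0 then 1 else 0
  | n + 1 => fun x => ∑' y : Zd d, convPow φ n (x - y) * φ y

theorem convPow_one {d : ℕ} (φ : Zd d → ℂ) : convPow φ 1 = φ := by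
  funext x
  have h : ∀ y : Zd d, y ≠ x → convPow φ 0 (x - y) * φ y = 0 := by
    intro y hy
    have hxy : x - y ≠ 0 := fun h0 => hy (sub_eq_zero.mp h0).symm
    simp [convPow, hxy]
  change ∑' y : Zd d, convPow φ 0 (x - y) * φ y = φ x
  rw [tsum_eq_single x h]
  simp [convPow]

/-- The Fourier transform `φ̂(ξ) = ∑_x φ(x) e^{i x·ξ}`. -/
noncomputable def hatFn {d : ℕ} (φ : Zd d → ℂ) (ξ : Rd d) : ℂ :=
  ∑' x : Zd d, φ x * Complex.exp (Complex.I * ((∑ i, (x i : ℝ) * ξ i : ℝ) : ℂ))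

/-- `Ω(φ)`: the points `ξ` of `𝕋^d = (-π, π]^d` at which `|φ̂(ξ)| = 1`. -/
def OmegaSet {d : ℕ} (φ : Zd d → ℂ) : Set (Rd d) :=
  {ξ | (∀ i, ξ i ∈ Set.Ioc (-Real.pi) Real.pi) ∧ ‖hatFn φ ξ‖ = 1}

/-- `Γ_{ξ₀}(ξ) = log (φ̂(ξ + ξ₀) / φ̂(ξ₀))`, with the principal branch of the logarithm. -/
noncomputable def GammaFn {d : ℕ} (φ : Zd d → ℂ) (ξ₀ ξ : Rd d) : ℂ :=
  Complex.log (hatFn φ (ξ + ξ₀) / hatFn φ ξ₀)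

/-- `t^E = exp((log t) E)`; only used for `t > 0`. -/
noncomputable def tpow {d : ℕ} (t : ℝ) (E : Rd d →L[ℝ] Rd d) : Rd d →L[ℝ] Rd d :=
  NormedSpace.exp (Real.log t • E)

/-- The one-parameter group `{t^E}` is contracting: `‖t^E‖ → 0` as `t → 0⁺`. -/
def IsContracting {d : ℕ} (E : Rd d →L[ℝ] Rd d) : Prop :=
  Filter.Tendsto (fun t : ℝ => ‖tpow t E‖) (nhdsWithin 0 (Set.Ioi 0)) (nhds 0)

/-- The exponent set of `P`: all `E` such that `P` is homogeneous with respect to `E`, that is,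
`P(t^E ξ) = t P(ξ)` for all `t > 0` and all `ξ`. -/
def ExpSet {d : ℕ} (P : Rd d → ℝ) : Set (Rd d →L[ℝ] Rd d) :=
  {E | ∀ t : ℝ, 0 < t → ∀ ξ : Rd d, P (tpow t E ξ) = t * P ξ}

/-- Positive homogeneous functions: continuous, positive definite, with nonempty exponent set and
compact unital level set. -/
structure IsPosHomFn {d : ℕ} (P : Rd d → ℝ) : Prop where
  continuous : Continuous P
  nonneg : ∀ ξ, 0 ≤ P ξ
  eq_zero : ∀ ξ, P ξ = 0 → ξ = 0
  expSet_nonempty : (ExpSet P).Nonempty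
  isCompact_level : IsCompact {η : Rd d | P η = 1}

/-- The trace of an endomorphism of `ℝ^d`. -/
noncomputable def endTrace {d : ℕ} (E : Rd d →L[ℝ] Rd d) : ℝ :=
  LinearMap.trace ℝ (Rd d) (E : Rd d →ₗ[ℝ] Rd d)

open Classical in
/-- The homogeneous order `μ_P` of a positive homogeneous function: the common value of the trace
of all members of the exponent set (it is the same for all of them). -/
noncomputable def homOrder {d : ℕ} (P : Rd d → ℝ) : ℝ :=
  if h : (ExpSet P).Nonempty then endTrace h.choose else 0

/-- Subhomogeneity with respect to `E` of a function that is continuous on the open neighborhood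
`U` of `0`. As `{t^E}` is contracting, `t^E ξ` lies in `U` for all `ξ ∈ K` and all small `t`, so
the values outside `U` do not matter. -/
def IsSubhom {d : ℕ} (U : Set (Rd d)) (P : Rd d → ℝ) (E : Rd d →L[ℝ] Rd d) : Prop :=
  IsOpen U ∧ (0 : Rd d) ∈ U ∧ ContinuousOn P U ∧ IsContracting E ∧
  ∀ ε : ℝ, 0 < ε → ∀ K : Set (Rd d), IsCompact K → ∃ τ : ℝ, 0 < τ ∧
    ∀ t : ℝ, 0 < t → t < τ → ∀ ξ ∈ K, |P (tpow t E ξ)| ≤ ε * t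

/-- Strong subhomogeneity of order `l` with respect to `E`: `P` is `C^l` on the open neighborhood
`U` of `0`, and `|t^k ∂_t^k (P(t^E ξ))| ≤ ε t` for `k = 0, …, l`, small `t` and `ξ` in a compact
set. -/
def IsStronglySubhom {d : ℕ} (U : Set (Rd d)) (P : Rd d → ℝ) (E : Rd d →L[ℝ] Rd d) (l : ℕ) :
    Prop :=
  IsOpen U ∧ (0 : Rd d) ∈ U ∧ ContDiffOn ℝ l P U ∧ IsContracting E ∧
  ∀ ε : ℝ, 0 < ε → ∀ K : Set (Rd d), IsCompact K → ∃ τ : ℝ, 0 < τ ∧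
    ∀ k : ℕ, k ≤ l → ∀ t : ℝ, 0 < t → t < τ → ∀ ξ ∈ K,
      |t ^ k * iteratedDeriv k (fun s : ℝ => P (tpow s E ξ)) t| ≤ ε * t

/-- The function on `ℝ^d` given by a real polynomial in `d` variables. -/
noncomputable def polyFn {d : ℕ} (p : MvPolynomial (Fin d) ℝ) (ξ : Rd d) : ℝ :=
  MvPolynomial.eval (fun i => ξ i) p

/-- The polynomial vanishes at `0` and contains no linear term. -/
def NoConstNoLinear {d : ℕ} (p : MvPolynomial (Fin d) ℝ) : Prop :=
  MvPolynomial.coeff 0 p = 0 ∧ ∀ i, MvPolynomial.coeff (Finsupp.single i 1) p = 0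

/-- An expansion
`Γ_{ξ₀}(ξ) = i α·ξ - i (Q(ξ) + Q̃(ξ)) - (R(ξ) + R̃(ξ))`, `ξ ∈ U`,
where `U` is an open convex neighborhood of `0` on which the logarithm in `Γ_{ξ₀}` is continuous,
`Q`, `R` are real polynomials which vanish at `0` and contain no linear terms, and `Q̃`, `R̃` are
real-valued smooth functions on `U` which vanish at `0`. -/
structure GammaExpansion {d : ℕ} (φ : Zd d → ℂ) (ξ₀ : Rd d) where
  U : Set (Rd d)
  α : Rd d
  Q : MvPolynomial (Fin d) ℝ
  R : MvPolynomial (Fin d) ℝ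
  Qt : Rd d → ℝ
  Rt : Rd d → ℝ
  isOpen_U : IsOpen U
  convex_U : Convex ℝ U
  zero_mem : (0 : Rd d) ∈ U
  mem_slitPlane : ∀ ξ ∈ U, hatFn φ (ξ + ξ₀) / hatFn φ ξ₀ ∈ Complex.slitPlane
  Q_low : NoConstNoLinear Q
  R_low : NoConstNoLinear R
  Qt_smooth : ContDiffOn ℝ ∞ Qt U
  Rt_smooth : ContDiffOn ℝ ∞ Rt U
  Qt_zero : Qt 0 = 0
  Rt_zero : Rt 0 = 0
  expansion : ∀ ξ ∈ U, GammaFn φ ξ₀ ξ =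
    Complex.I * ((∑ i, α i * ξ i : ℝ) : ℂ)
      - Complex.I * ((polyFn Q ξ + Qt ξ : ℝ) : ℂ) - ((polyFn R ξ + Rt ξ : ℝ) : ℂ)

namespace GammaExpansion

variable {d : ℕ} {φ : Zd d → ℂ} {ξ₀ : Rd d}

/-- The absolute value `|Q|` of the polynomial `Q`. -/
noncomputable def absQ (X : GammaExpansion φ ξ₀) (ξ : Rd d) : ℝ := |polyFn X.Q ξ|

/-- The expansion shows that `ξ₀` is of positive homogeneous type. -/
def IsPositive (X : GammaExpansion φ ξ₀) : Prop :=
  IsPosHomFn (polyFn X.R) ∧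
  ∃ E ∈ ExpSet (polyFn X.R), E ∈ ExpSet (polyFn X.Q) ∧
    IsSubhom X.U X.Rt E ∧ IsSubhom X.U X.Qt E

/-- The expansion shows that `ξ₀` is of imaginary homogeneous type. -/
def IsImaginary (X : GammaExpansion φ ξ₀) : Prop :=
  IsPosHomFn X.absQ ∧ IsPosHomFn (polyFn X.R) ∧
  ∃ E ∈ ExpSet X.absQ, ∃ k : ℝ, 1 < k ∧ k⁻¹ • E ∈ ExpSet (polyFn X.R) ∧
    IsStronglySubhom X.U X.Qt E 2 ∧ IsStronglySubhom X.U X.Rt (k⁻¹ • E) 1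

end GammaExpansion

/-- `ξ₀` is of positive homogeneous type for `φ̂`. -/
def IsPosHomType {d : ℕ} (φ : Zd d → ℂ) (ξ₀ : Rd d) : Prop :=
  ∃ X : GammaExpansion φ ξ₀, X.IsPositive

/-- `ξ₀` is of imaginary homogeneous type for `φ̂`. -/
def IsImagHomType {d : ℕ} (φ : Zd d → ℂ) (ξ₀ : Rd d) : Prop :=
  ∃ X : GammaExpansion φ ξ₀, X.IsImaginary

open Classical in
/-- The drift `α_{ξ₀}` associated to a point of imaginary or positive homogeneous type. The two
types exclude each other for `d ≥ 1`, and `α_{ξ₀}` does not depend on the expansion, since it is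
the gradient of `Im Γ_{ξ₀}` at `0`. -/
noncomputable def drift {d : ℕ} (φ : Zd d → ℂ) (ξ₀ : Rd d) : Rd d :=
  if h : IsImagHomType φ ξ₀ then h.choose.α
  else if h : IsPosHomType φ ξ₀ then h.choose.α
  else 0

open Classical in
/-- The homogeneous order `μ_{ξ₀}`: it is `μ_{|Q|}` for a point of imaginary homogeneous type and
`μ_R` for a point of positive homogeneous type. It does not depend on the expansion, since the
leading parts `|Q|` (respectively `R`) of two such expansions are asymptotic to each other at
`0`, and a positive homogeneous `P` has `vol {P < t} = t^{μ_P} vol {P < 1}`. -/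
noncomputable def pointOrder {d : ℕ} (φ : Zd d → ℂ) (ξ₀ : Rd d) : ℝ :=
  if h : IsImagHomType φ ξ₀ then homOrder h.choose.absQ
  else if h : IsPosHomType φ ξ₀ then homOrder (polyFn h.choose.R)
  else 0

/-- `Ω_i(φ)`: the points of `Ω(φ)` of imaginary homogeneous type for `φ̂`. -/
def OmegaImag {d : ℕ} (φ : Zd d → ℂ) : Set (Rd d) :=
  {ξ ∈ OmegaSet φ | IsImagHomType φ ξ}

/-- The homogeneous order `μ_φ = min {μ_ξ : ξ ∈ Ω(φ)}` (the set `Ω(φ)` is finite and nonempty when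
it consists of points of the two types and `sup |φ̂| = 1`). -/
noncomputable def phiOrder {d : ℕ} (φ : Zd d → ℂ) : ℝ :=
  sInf (pointOrder φ '' OmegaSet φ)

/-! Upper bound. Fourier inversion writes `(2π)^d φ^{(n)}(x)` as the integral of `φ̂^n e^{-ix·ξ}`
over a period box. Away from the points with `|φ̂| = 1` the integrand is exponentially small, so
only neighborhoods of these points matter. There, polar coordinates adapted to `t^E`
(`integral_polar`) reduce the estimate to integrals of `t^(μ-1) φ̂^n e^{-ix·ξ}` along the curves `t
↦ t^E ξ`, uniformly for `ξ` in a compact annulus.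

At a point of positive type, absolute values suffice: `|φ̂| ≤ e^{-t/2}` gives a Gamma integral of
size `n^{-μ}`. At a point of imaginary type the modulus decays only like `e^{-c n t^k}` with `k >
1`, and absolute values would give the larger `n^{-μ/k}`. The gain comes from oscillation: along
each curve the phase is `t Q(ξ)` up to small terms, so its derivative stays away from zero.
Integration by parts on `[1/n, T]` and the trivial bound on `(0, 1/n]` both give `n^{-μ}`, since `0
< μ < 1` (`norm_integral_Ioc_oscillatory_le`). Writing `x = nα + y`, the term `y·ξ` perturbs the
phase derivative by `O(‖t^E‖/(nt))`, which tends to zero uniformly on `t ≥ 1/n` for bounded `y`. The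
constant does not depend on the bound for `y`, only the threshold for `n` does; hence the bound
persists on slowly growing compact sets.

Lower bound. Take `D = n^{-E}(ball)`. On `ξ₀ + (D - D)`, once the drift and the factor `φ̂(ξ₀)^n`
are removed, `φ̂^n` has real part at least `1/2`, so its integral over `D × D` is at least
`vol(D)²/2`. Expanded in characters this integral is a sum of `φ^{(n)}(x)` against squared Fourier
coefficients, which Bessel's inequality bounds by `‖φ^{(n)}‖_∞ (2π)^d vol D`
(`norm_integral_hatFn_sub_le`). Finally `vol D` is a constant times `n^{-tr E}`. -/

theorem exp_add_smul {𝔸 : Type*} [NormedRing 𝔸] [NormedAlgebra ℝ 𝔸] [CompleteSpace 𝔸]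
    (u v : ℝ) (x : 𝔸) :
    NormedSpace.exp ((u + v) • x) = NormedSpace.exp (u • x) * NormedSpace.exp (v • x) := by
  let _ := NormedAlgebra.restrictScalars ℚ ℝ 𝔸
  rw [add_smul]
  exact NormedSpace.exp_add_of_commute (((Commute.refl x).smul_left _).smul_right _)

/-! ### The one-parameter groups `t^E` and their determinants. -/

section OneParameterGroup

variable {d : ℕ}

theorem tpow_mul {s t : ℝ} (hs : 0 < s) (ht : 0 < t) (E : Rd d →L[ℝ] Rd d) :
    tpow (s * t) E = tpow s E * tpow t E := by
  unfold tpow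
  rw [Real.log_mul hs.ne' ht.ne']
  exact exp_add_smul _ _ E

theorem tpow_mul_apply {s t : ℝ} (hs : 0 < s) (ht : 0 < t) (E : Rd d →L[ℝ] Rd d) (ξ : Rd d) :
    tpow (s * t) E ξ = tpow s E (tpow t E ξ) := by
  rw [tpow_mul hs ht]; rfl

@[simp] theorem tpow_one (E : Rd d →L[ℝ] Rd d) : tpow 1 E = 1 := by
  rw [tpow, Real.log_one, zero_smul ℝ E, NormedSpace.exp_zero]

theorem tpow_tpow_inv {t : ℝ} (ht : 0 < t) (E : Rd d →L[ℝ] Rd d) (ξ : Rd d) :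
    tpow t E (tpow t⁻¹ E ξ) = ξ := by
  rw [← tpow_mul_apply ht (inv_pos.2 ht), mul_inv_cancel₀ ht.ne', tpow_one]; rfl

theorem tpow_inv_tpow {t : ℝ} (ht : 0 < t) (E : Rd d →L[ℝ] Rd d) (ξ : Rd d) :
    tpow t⁻¹ E (tpow t E ξ) = ξ := by
  rw [← tpow_mul_apply (inv_pos.2 ht) ht, inv_mul_cancel₀ ht.ne', tpow_one]; rfl

/-- Lets a function homogeneous with respect to `E/k` be read along the curves of `E`, where it
scales like `t^k`. -/
theorem tpow_rpow_inv_smul {t k : ℝ} (ht : 0 < t) (hk : k ≠ 0) (E : Rd d →L[ℝ] Rd d) :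
    tpow (t ^ k) (k⁻¹ • E) = tpow t E := by
  unfold tpow
  rw [Real.log_rpow ht, smul_smul]
  congr 2
  field_simp

theorem hasDerivAt_tpow {t : ℝ} (ht : 0 < t) (E : Rd d →L[ℝ] Rd d) :
    HasDerivAt (fun s => tpow s E) (t⁻¹ • (E * tpow t E)) t :=
  (hasDerivAt_exp_smul_const' (𝕂 := ℝ) E (Real.log t)).scomp t (Real.hasDerivAt_log ht.ne')

theorem hasDerivAt_tpow_apply {t : ℝ} (ht : 0 < t) (E : Rd d →L[ℝ] Rd d) (ξ : Rd d) :
    HasDerivAt (fun s => tpow s E ξ) (t⁻¹ • E (tpow t E ξ)) t := by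
  simpa using (hasDerivAt_tpow ht E).clm_apply (hasDerivAt_const t ξ)

theorem contDiffAt_tpow_apply {t : ℝ} (ht : 0 < t) (E : Rd d →L[ℝ] Rd d) (ξ : Rd d)
    (n : WithTop ℕ∞) : ContDiffAt ℝ n (fun s => tpow s E ξ) t := by
  have h1 : ContDiffAt ℝ n (fun s => Real.log s • E) t :=
    (Real.contDiffAt_log.2 ht.ne').smul contDiffAt_const
  have h2 : ContDiffAt ℝ n (NormedSpace.exp : (Rd d →L[ℝ] Rd d) → _) (Real.log t • E) :=
    (NormedSpace.exp_analytic (𝕂 := ℝ) (Real.log t • E)).contDiffAt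
  exact (h2.comp t h1).clm_apply contDiffAt_const

theorem continuousOn_tpow (E : Rd d →L[ℝ] Rd d) :
    ContinuousOn (fun t => tpow t E) (Set.Ioi 0) := fun _ ht =>
  (hasDerivAt_tpow ht E).continuousAt.continuousWithinAt

theorem continuousOn_tpow_apply (E : Rd d →L[ℝ] Rd d) :
    ContinuousOn (fun p : ℝ × Rd d => tpow p.1 E p.2) (Set.Ioi 0 ×ˢ Set.univ) :=
  ContinuousOn.clm_apply ((continuousOn_tpow E).comp continuousOn_fst fun _ h => h.1)
    continuousOn_snd

/-- The determinant is differentiable on the space of endomorphisms of `ℝ^d`. -/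
theorem differentiable_det :
    Differentiable ℝ fun A : Rd d →L[ℝ] Rd d => LinearMap.det (A : Rd d →ₗ[ℝ] Rd d) := by
  let b := (EuclideanSpace.basisFun (Fin d) ℝ).toBasis
  have h : (fun A : Rd d →L[ℝ] Rd d => LinearMap.det (A : Rd d →ₗ[ℝ] Rd d)) =
      fun A => ∑ σ : Equiv.Perm (Fin d), ((Equiv.Perm.sign σ : ℤ) : ℝ) *
        ∏ i, (A (b i)) (σ i) := by
    funext A
    rw [← LinearMap.det_toMatrix b, Matrix.det_apply']
    simp only [LinearMap.toMatrix_apply]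
    rfl
  rw [h]
  have h' : ∀ i j, ContDiff ℝ 1 fun A : Rd d →L[ℝ] Rd d => (A (b i)) j := fun i j => by
    have : ContDiff ℝ 1 fun A : Rd d →L[ℝ] Rd d => A (b i) := by fun_prop
    fun_prop
  have h'' : ∀ σ : Equiv.Perm (Fin d),
      Differentiable ℝ fun A : Rd d →L[ℝ] Rd d => ∏ i, (A (b i)) (σ i) := fun σ =>
    (contDiff_prod (t := Finset.univ) fun i _ => h' i (σ i)).differentiable one_ne_zero
  exact Differentiable.fun_sum fun σ _ => (h'' σ).const_mul _

/-- The curves `exp(uE)` and `1 + uE` have the same tangent at `u = 0`, so `det` has the same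
derivative along both; along the second it is a polynomial in `u` with linear coefficient `tr E`. -/
theorem hasDerivAt_det_exp_smul_zero (E : Rd d →L[ℝ] Rd d) :
    HasDerivAt (fun u : ℝ => LinearMap.det
      ((NormedSpace.exp (u • E) : Rd d →L[ℝ] Rd d) : Rd d →ₗ[ℝ] Rd d)) (endTrace E) 0 := by
  let f : (Rd d →L[ℝ] Rd d) → ℝ := fun A => LinearMap.det (A : Rd d →ₗ[ℝ] Rd d)
  obtain ⟨f', hf⟩ : ∃ f', HasFDerivAt f f' (1 : Rd d →L[ℝ] Rd d) :=
    ⟨_, (differentiable_det (d := d) 1).hasFDerivAt⟩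
  have e1 : HasDerivAt (fun u : ℝ => (NormedSpace.exp (u • E) : Rd d →L[ℝ] Rd d)) E 0 := by
    simpa [zero_smul ℝ E, NormedSpace.exp_zero] using hasDerivAt_exp_smul_const' (𝕂 := ℝ) E 0
  have e2 : HasDerivAt (fun u : ℝ => (1 + u • E : Rd d →L[ℝ] Rd d)) E 0 := by
    simpa using ((hasDerivAt_id (0 : ℝ)).smul_const E).const_add 1
  have g1 : HasDerivAt (fun u : ℝ => f (NormedSpace.exp (u • E))) (f' E) 0 :=
    HasFDerivAt.comp_hasDerivAt (l := f) 0 (by simpa [zero_smul ℝ E, NormedSpace.exp_zero] using hf) e1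
  have g2 : HasDerivAt (fun u : ℝ => f (1 + u • E)) (f' E) 0 :=
    HasFDerivAt.comp_hasDerivAt (l := f) 0 (by simpa [zero_smul ℝ E] using hf) e2
  have g3 : HasDerivAt (fun u : ℝ => f (1 + u • E)) (endTrace E) 0 := by
    let b := (EuclideanSpace.basisFun (Fin d) ℝ).toBasis
    let M := LinearMap.toMatrix b b (E : Rd d →ₗ[ℝ] Rd d)
    have hM : ∀ u : ℝ, f (1 + u • E) = 1 + Matrix.trace M * u +
        (Polynomial.eval u (Matrix.det (1 + (Polynomial.X : Polynomial ℝ) •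
          M.map Polynomial.C)).divX.divX) * u ^ 2 := fun u => by
      rw [← Matrix.det_one_add_smul]
      change LinearMap.det _ = _
      rw [← LinearMap.det_toMatrix b]
      congr 1
      simp [M, LinearMap.toMatrix_one]
    have hp := (Polynomial.hasDerivAt (Matrix.det (1 + (Polynomial.X : Polynomial ℝ) •
          M.map Polynomial.C)).divX.divX (0 : ℝ)).mul (hasDerivAt_pow 2 (0 : ℝ))
    have hl := ((hasDerivAt_id (0 : ℝ)).const_mul (Matrix.trace M)).const_add 1
    have ht : endTrace E = Matrix.trace M := LinearMap.trace_eq_matrix_trace ℝ b _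
    have := hl.add hp
    simp only [id, mul_one, ne_eq, OfNat.ofNat_ne_zero, not_false_eq_true, zero_pow, mul_zero,
      Nat.cast_ofNat, Nat.add_one_sub_one, pow_one, add_zero] at this
    rw [ht]
    refine this.congr_of_eventuallyEq (Filter.Eventually.of_forall fun u => ?_)
    exact hM u
  rw [← g2.unique g3]
  exact g1

/-- Multiplicativity in `u` carries the derivative at `0` to every `u`: the determinant solves `D' =
(tr E) D`, so `D(u) e^{-u tr E}` is constant. -/
theorem det_exp_smul (E : Rd d →L[ℝ] Rd d) (u : ℝ) : LinearMap.det
      ((NormedSpace.exp (u • E) : Rd d →L[ℝ] Rd d) : Rd d →ₗ[ℝ] Rd d) =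
      Real.exp (u * endTrace E) := by
  set D : ℝ → ℝ := fun u => LinearMap.det
      ((NormedSpace.exp (u • E) : Rd d →L[ℝ] Rd d) : Rd d →ₗ[ℝ] Rd d) with hD
  have hadd : ∀ u v, D (u + v) = D u * D v := fun u v => by
    simp only [hD]
    rw [exp_add_smul _ _ E, ← LinearMap.det_comp]
    rfl
  have hder : ∀ u, HasDerivAt D (D u * endTrace E) u := fun u => by
    have h0 : HasDerivAt D (endTrace E) (u - u) := by
      rw [sub_self]; exact hasDerivAt_det_exp_smul_zero E
    have h1 := (h0.comp_sub_const u u).const_mul (D u)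
    refine h1.congr_of_eventuallyEq (Filter.Eventually.of_forall fun v => ?_)
    change D v = D u * D (v - u)
    rw [← hadd]; congr 1; ring
  have hc : ∀ u v, D u * Real.exp (-(u * endTrace E)) = D v * Real.exp (-(v * endTrace E)) := by
    apply is_const_of_deriv_eq_zero
    · intro u
      exact ((hder u).mul ((((hasDerivAt_id u).mul_const (endTrace E)).neg).exp)).differentiableAt
    · intro u
      have := ((hder u).mul ((((hasDerivAt_id u).mul_const (endTrace E)).neg).exp)).deriv
      simp only [id] at this
      refine Eq.trans this ?_
      simp; ring
  have h0 : D 0 = 1 := by simp [hD, zero_smul ℝ E, NormedSpace.exp_zero]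
  have := hc u 0
  rw [h0, zero_mul, neg_zero, Real.exp_zero, mul_one, Real.exp_neg] at this
  field_simp at this
  exact this

theorem det_tpow {t : ℝ} (ht : 0 < t) (E : Rd d →L[ℝ] Rd d) :
    LinearMap.det (tpow t E : Rd d →ₗ[ℝ] Rd d) = t ^ endTrace E := by
  rw [Real.rpow_def_of_pos ht]; exact det_exp_smul E _

/-- Since `d ≥ 1`, `det 0 = 0`, so `t^{tr E} = det t^E → 0` as `t → 0⁺`, which is impossible for a
nonpositive exponent. -/
theorem IsContracting.endTrace_pos (hd : 1 ≤ d) {E : Rd d →L[ℝ] Rd d} (hE : IsContracting E) :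
    0 < endTrace E := by
  have h1 : Filter.Tendsto (fun t : ℝ => tpow t E) (nhdsWithin 0 (Set.Ioi 0)) (nhds 0) :=
    tendsto_zero_iff_norm_tendsto_zero.2 hE
  have h2 := ((differentiable_det (d := d)).continuous.tendsto 0).comp h1
  have h0 : LinearMap.det ((0 : Rd d →L[ℝ] Rd d) : Rd d →ₗ[ℝ] Rd d) = 0 := by
    rw [ContinuousLinearMap.toLinearMap_zero, LinearMap.det_zero]
    simp; omega
  rw [h0] at h2
  by_contra hneg
  push Not at hneg
  have h3 : ∀ᶠ t in nhdsWithin (0 : ℝ) (Set.Ioi 0), t < 1 ∧ 0 < t :=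
    ((eventually_lt_nhds one_pos).filter_mono nhdsWithin_le_nhds).and self_mem_nhdsWithin
  obtain ⟨t, ⟨ht1, ht0⟩, ht⟩ := (h3.and (h2.eventually (gt_mem_nhds one_pos))).exists
  simp only [Function.comp_apply, det_tpow ht0] at ht
  exact absurd ht (not_lt.2 (Real.one_le_rpow_of_pos_of_le_one_of_nonpos ht0 ht1.le hneg))

theorem IsContracting.exists_norm_tpow_lt {E : Rd d →L[ℝ] Rd d} (hE : IsContracting E) {ε : ℝ}
    (hε : 0 < ε) : ∃ τ : ℝ, 0 < τ ∧ ∀ t, 0 < t → t < τ → ‖tpow t E‖ < ε := by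
  have h := hE.eventually (gt_mem_nhds hε)
  rw [eventually_nhdsWithin_iff, Metric.eventually_nhds_iff] at h
  obtain ⟨τ, hτ, h⟩ := h
  exact ⟨τ, hτ, fun t ht0 ht => h (by simpa [abs_of_pos ht0] using ht) ht0⟩

theorem IsContracting.exists_norm_tpow_le {E : Rd d →L[ℝ] Rd d} (hE : IsContracting E) (c : ℝ) :
    ∃ B : ℝ, 0 < B ∧ ∀ t, 0 < t → t ≤ c → ‖tpow t E‖ ≤ B := by
  obtain ⟨τ, hτ, h⟩ := hE.exists_norm_tpow_lt one_pos
  have hc : ContinuousOn (fun t => ‖tpow t E‖) (Set.Icc τ c) :=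
    ((continuousOn_tpow E).mono fun t ht => lt_of_lt_of_le hτ ht.1).norm
  obtain ⟨B, hB⟩ := isCompact_Icc.bddAbove_image hc
  refine ⟨max B 1, by positivity, fun t ht0 htc => ?_⟩
  rcases lt_or_ge t τ with h1 | h1
  · exact (h t ht0 h1).le.trans (le_max_right _ _)
  · exact (hB ⟨t, ⟨h1, htc⟩, rfl⟩).trans (le_max_left _ _)

end OneParameterGroup

/-! ### Positive homogeneous functions: sublevel sets and homogeneous order. -/

section PositiveHomogeneous

variable {d : ℕ} {P : Rd d → ℝ} {E : Rd d →L[ℝ] Rd d}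

theorem ExpSet.apply_zero (hE : E ∈ ExpSet P) : P 0 = 0 := by
  have := hE 2 two_pos 0
  rw [map_zero] at this
  linarith

theorem IsPosHomFn.pos (hP : IsPosHomFn P) {ξ : Rd d} (hξ : ξ ≠ 0) : 0 < P ξ :=
  lt_of_le_of_ne (hP.nonneg ξ) fun h => hξ (hP.eq_zero ξ h.symm)

/-- A nonzero vector is `t^E σ` with `P σ = 1` and `t = P ξ`. -/
theorem IsPosHomFn.level_tpow_inv (hP : IsPosHomFn P) (hE : E ∈ ExpSet P) {ξ : Rd d} (hξ : ξ ≠ 0) :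
    P (tpow (P ξ)⁻¹ E ξ) = 1 := by
  rw [hE _ (inv_pos.2 (hP.pos hξ)), inv_mul_cancel₀ (hP.pos hξ).ne']

theorem IsPosHomFn.exists_norm_level_le (hP : IsPosHomFn P) :
    ∃ M : ℝ, 0 < M ∧ ∀ σ, P σ = 1 → ‖σ‖ ≤ M := by
  obtain ⟨M, hM⟩ := hP.isCompact_level.isBounded.exists_norm_le
  exact ⟨max M 1, by positivity, fun σ hσ => (hM σ hσ).trans (le_max_left _ _)⟩

/-- Every nonzero point of the sublevel set is `t^E σ` with `t = P ξ ≤ c` and `σ` on the compact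
unit level, and `‖t^E‖` is bounded on `(0, c]`. -/
theorem IsPosHomFn.isCompact_le (hP : IsPosHomFn P) (hE : E ∈ ExpSet P) (hc : IsContracting E)
    (c : ℝ) : IsCompact {ξ | P ξ ≤ c} := by
  obtain ⟨M, hM, hM'⟩ := hP.exists_norm_level_le
  obtain ⟨B, hB, hB'⟩ := hc.exists_norm_tpow_le c
  refine Metric.isCompact_of_isClosed_isBounded (isClosed_le hP.continuous continuous_const) ?_
  refine isBounded_iff_forall_norm_le.2 ⟨B * M, fun ξ hξ => ?_⟩
  by_cases h0 : ξ = 0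
  · rw [h0, norm_zero]; positivity
  · rw [← tpow_tpow_inv (hP.pos h0) E ξ]
    exact (ContinuousLinearMap.le_opNorm _ _).trans
      (mul_le_mul (hB' _ (hP.pos h0) hξ) (hM' _ (hP.level_tpow_inv hE h0)) (norm_nonneg _) hB.le)

theorem IsPosHomFn.exists_forall_lt_norm_lt (hP : IsPosHomFn P) (hE : E ∈ ExpSet P)
    (hc : IsContracting E) {r : ℝ} (hr : 0 < r) : ∃ τ : ℝ, 0 < τ ∧ ∀ ξ, P ξ < τ → ‖ξ‖ < r := by
  obtain ⟨M, hM, hM'⟩ := hP.exists_norm_level_le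
  obtain ⟨τ, hτ, h⟩ := hc.exists_norm_tpow_lt (div_pos hr hM)
  refine ⟨τ, hτ, fun ξ hξ => ?_⟩
  by_cases h0 : ξ = 0
  · rwa [h0, norm_zero]
  · rw [← tpow_tpow_inv (hP.pos h0) E ξ]
    calc _ ≤ ‖tpow (P ξ) E‖ * M := (ContinuousLinearMap.le_opNorm _ _).trans
          (mul_le_mul_of_nonneg_left (hM' _ (hP.level_tpow_inv hE h0)) (norm_nonneg _))
      _ < r / M * M := mul_lt_mul_of_pos_right (h _ (hP.pos h0) hξ) hM
      _ = r := by field_simp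

open MeasureTheory

theorem measure_image_tpow {t : ℝ} (ht : 0 < t) (E : Rd d →L[ℝ] Rd d) (s : Set (Rd d)) :
    volume (tpow t E '' s) = ENNReal.ofReal (t ^ endTrace E) * volume s := by
  have := Measure.addHaar_image_continuousLinearMap volume (tpow t E) s
  rw [this, ← abs_of_pos (Real.rpow_pos_of_pos ht (endTrace E)), ← det_tpow ht]

theorem ExpSet.image_tpow (hE : E ∈ ExpSet P) {t : ℝ} (ht : 0 < t) :
    tpow t E '' {ξ | P ξ < 1} = {ξ | P ξ < t} := by
  ext ξ
  constructor
  · rintro ⟨η, hη, rfl⟩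
    rw [Set.mem_ofPred_eq, hE t ht]
    exact mul_lt_of_lt_one_right ht hη
  · intro hξ
    refine ⟨tpow t⁻¹ E ξ, ?_, tpow_tpow_inv ht E ξ⟩
    rw [Set.mem_ofPred_eq, hE _ (inv_pos.2 ht), inv_mul_lt_iff₀ ht, mul_one]
    exact hξ

theorem IsPosHomFn.measure_lt_top (hP : IsPosHomFn P) (hE : E ∈ ExpSet P) (hc : IsContracting E)
    (c : ℝ) : volume {ξ | P ξ < c} < ⊤ :=
  (measure_mono fun ξ (h : P ξ < c) => h.le).trans_lt (hP.isCompact_le hE hc c).measure_lt_top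

theorem IsPosHomFn.measure_pos (hP : IsPosHomFn P) (hE : E ∈ ExpSet P) {c : ℝ} (h0 : 0 < c) :
    0 < volume {ξ | P ξ < c} :=
  (isOpen_lt hP.continuous continuous_const).measure_pos volume
    ⟨0, by rw [Set.mem_ofPred_eq, ExpSet.apply_zero hE]; exact h0⟩

/-- Both exponents carry `{P < 1}` onto `{P < e}`, and the volume ratio of these sets, finite and
positive, determines the trace. -/
theorem IsPosHomFn.endTrace_eq (hP : IsPosHomFn P) (hE : E ∈ ExpSet P) (hc : IsContracting E)
    {E' : Rd d →L[ℝ] Rd d} (hE' : E' ∈ ExpSet P) : endTrace E' = endTrace E := by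
  have h2 : (0 : ℝ) < Real.exp 1 := Real.exp_pos 1
  have h : ENNReal.ofReal (Real.exp 1 ^ endTrace E') * volume {ξ | P ξ < 1} =
      ENNReal.ofReal (Real.exp 1 ^ endTrace E) * volume {ξ | P ξ < 1} := by
    rw [← measure_image_tpow h2, ← measure_image_tpow h2, ExpSet.image_tpow hE h2,
      ExpSet.image_tpow hE' h2]
  rw [ENNReal.mul_left_inj (hP.measure_pos hE one_pos).ne' (hP.measure_lt_top hE hc 1).ne,
    ENNReal.ofReal_eq_ofReal_iff (by positivity) (by positivity)] at h
  rw [← Real.exp_mul, ← Real.exp_mul, Real.exp_eq_exp] at h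
  linarith

theorem IsPosHomFn.homOrder_eq (hP : IsPosHomFn P) (hE : E ∈ ExpSet P) (hc : IsContracting E) :
    homOrder P = endTrace E := by
  unfold homOrder
  rw [dif_pos hP.expSet_nonempty]
  exact hP.endTrace_eq hE hc hP.expSet_nonempty.choose_spec

end PositiveHomogeneous

/-! ### Polar coordinates for `t^E`. -/

section PolarCoordinates

open MeasureTheory Set

variable {d : ℕ} {P : Rd d → ℝ} {E : Rd d →L[ℝ] Rd d}

theorem image_tpow_univ {t : ℝ} (ht : 0 < t) (E : Rd d →L[ℝ] Rd d) :
    tpow t E '' univ = univ :=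
  image_univ_of_surjective fun ξ => ⟨_, tpow_tpow_inv ht E ξ⟩

theorem injective_tpow {t : ℝ} (ht : 0 < t) (E : Rd d →L[ℝ] Rd d) :
    Function.Injective (tpow t E) :=
  Function.LeftInverse.injective (g := tpow t⁻¹ E) fun ξ => tpow_inv_tpow ht E ξ

theorem abs_det_tpow {t : ℝ} (ht : 0 < t) (E : Rd d →L[ℝ] Rd d) :
    |(tpow t E).det| = t ^ endTrace E := by
  rw [← abs_of_pos (Real.rpow_pos_of_pos ht (endTrace E)), ← det_tpow ht]

theorem integral_comp_tpow {F : Type*} [NormedAddCommGroup F] [NormedSpace ℝ F] {t : ℝ}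
    (ht : 0 < t) (E : Rd d →L[ℝ] Rd d) (g : Rd d → F) :
    ∫ ξ, t ^ endTrace E • g (tpow t E ξ) = ∫ ξ, g ξ := by
  have := integral_image_eq_integral_abs_det_fderiv_smul volume MeasurableSet.univ
    (fun x _ => (tpow t E).hasFDerivAt.hasFDerivWithinAt (x := x) (s := univ))
    (injective_tpow ht E).injOn g
  rw [image_tpow_univ ht, setIntegral_univ, setIntegral_univ, abs_det_tpow ht] at this
  exact this.symm

theorem integrable_comp_tpow {F : Type*} [NormedAddCommGroup F] [NormedSpace ℝ F] {t : ℝ}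
    (ht : 0 < t) (E : Rd d →L[ℝ] Rd d) {g : Rd d → F} (hg : Integrable g) :
    Integrable fun ξ => t ^ endTrace E • g (tpow t E ξ) := by
  have := integrableOn_image_iff_integrableOn_abs_det_fderiv_smul volume MeasurableSet.univ
    (fun x _ => (tpow t E).hasFDerivAt.hasFDerivWithinAt (x := x) (s := univ))
    (injective_tpow ht E).injOn g
  rw [image_tpow_univ ht, integrableOn_univ, integrableOn_univ, abs_det_tpow ht] at this
  exact this.1 hg

/-- The annulus `{1 ≤ P < e}`. -/
def annulus (P : Rd d → ℝ) : Set (Rd d) := {ξ | 1 ≤ P ξ ∧ P ξ < Real.exp 1}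

theorem measurableSet_annulus (hP : Continuous P) : MeasurableSet (annulus P) :=
  (measurableSet_le measurable_const hP.measurable).inter
    (measurableSet_lt hP.measurable measurable_const)

theorem integral_exp_mul_comp_exp {F : Type*} [NormedAddCommGroup F] [NormedSpace ℝ F] (μ : ℝ)
    (g : ℝ → F) :
    ∫ u, Real.exp u ^ μ • g (Real.exp u) = ∫ t in Ioi (0 : ℝ), t ^ (μ - 1) • g t := by
  have := integral_image_eq_integral_abs_deriv_smul MeasurableSet.univ
    (fun x _ => (Real.hasDerivAt_exp x).hasDerivWithinAt (s := univ)) Real.exp_injective.injOn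
    (fun t => t ^ (μ - 1) • g t)
  rw [image_univ, Real.range_exp, setIntegral_univ] at this
  rw [this]
  congr 1
  funext u
  rw [abs_of_pos (Real.exp_pos u), smul_smul, Real.rpow_sub_one (Real.exp_pos u).ne']
  congr 1
  field_simp

/-- A solid annulus replaces a surface measure on `{P = 1}`. For `η ≠ 0` the parameters `u` with `1
≤ e^{-u} P(η) < e` form an interval of length one, so the integral of `f` is unchanged when it is
averaged over them. After Fubini, the substitution `η = (e^u)^E ξ` for fixed `u` turns the
constraint into `ξ ∈ annulus P`, and a second Fubini leaves the integral over `t = e^u`. -/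
theorem integral_polar (hd : 1 ≤ d) (hP : IsPosHomFn P) (hE : E ∈ ExpSet P) {f : Rd d → ℂ}
    (hfm : StronglyMeasurable f) (hf : Integrable f) :
    ∫ ξ, f ξ = ∫ ξ in annulus P, ∫ t in Ioi (0 : ℝ), t ^ (endTrace E - 1) • f (tpow t E ξ) := by
  have : Nonempty (Fin d) := ⟨⟨0, hd⟩⟩
  set S : Set (ℝ × Rd d) := {p | 1 ≤ Real.exp (-p.1) * P p.2 ∧
    Real.exp (-p.1) * P p.2 < Real.exp 1} with hS
  have hcont : Continuous fun p : ℝ × Rd d => Real.exp (-p.1) * P p.2 :=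
    (Real.continuous_exp.comp continuous_fst.neg).mul (hP.continuous.comp continuous_snd)
  have hSm : MeasurableSet S := (measurableSet_le measurable_const hcont.measurable).inter
    (measurableSet_lt hcont.measurable measurable_const)
  set Φ : ℝ × Rd d → ℂ := S.indicator (fun p => f p.2) with hΦ
  have hΦm : StronglyMeasurable Φ := (hfm.comp_measurable measurable_snd).indicator hSm
  have hsec : ∀ η : Rd d, η ≠ 0 → (fun u => Φ (u, η)) =
      (Ioc (Real.log (P η) - 1) (Real.log (P η))).indicator fun _ => f η := by
    intro η hη
    funext u
    have hp := hP.pos hη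
    have : (u, η) ∈ S ↔ u ∈ Ioc (Real.log (P η) - 1) (Real.log (P η)) := by
      rw [hS, Set.mem_ofPred_eq, ← Real.exp_log hp, Real.log_exp, ← Real.exp_add,
        Real.one_le_exp_iff, Real.exp_lt_exp, mem_Ioc]
      constructor <;> rintro ⟨h1, h2⟩ <;> constructor <;> linarith
    by_cases h : (u, η) ∈ S
    · rw [hΦ, indicator_of_mem h, indicator_of_mem (this.1 h)]
    · rw [hΦ, indicator_of_notMem h, indicator_of_notMem (fun h' => h (this.2 h'))]
  have hae : ∀ᵐ η : Rd d, η ≠ 0 := by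
    rw [ae_iff]; simp
  have hvol : ∀ a : ℝ, volume.real (Ioc (a - 1) a) = 1 := fun a => by simp
  have hΦi : Integrable Φ ((volume : Measure ℝ).prod volume) := by
    rw [integrable_prod_iff' hΦm.aestronglyMeasurable]
    constructor
    · filter_upwards [hae] with η hη
      rw [hsec η hη]
      exact continuous_const.integrableOn_Ioc.integrable_indicator measurableSet_Ioc
    · refine hf.norm.congr ?_
      filter_upwards [hae] with η hη
      have : (fun u => ‖Φ (u, η)‖) =
          (Ioc (Real.log (P η) - 1) (Real.log (P η))).indicator fun _ => ‖f η‖ := by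
        funext u
        rw [show Φ (u, η) = (fun u => Φ (u, η)) u from rfl, hsec η hη, norm_indicator_eq_indicator_norm]
      rw [this, integral_indicator measurableSet_Ioc, setIntegral_const, hvol, one_smul]
  have h1 : ∫ ξ, f ξ = ∫ u, ∫ η, Φ (u, η) := by
    rw [integral_integral_swap (f := fun u η => Φ (u, η)) hΦi]
    refine integral_congr_ae ?_
    filter_upwards [hae] with η hη
    rw [hsec η hη, integral_indicator measurableSet_Ioc, setIntegral_const, hvol, one_smul]
  -- `Φ` after the substitution `η = (e^u)^E ξ`, with its Jacobian `(e^u)^{tr E}`.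
  set Ψ : ℝ × Rd d → ℂ := fun p => Real.exp p.1 ^ endTrace E • Φ (p.1, tpow (Real.exp p.1) E p.2)
    with hΨ
  have hTc : Continuous fun p : ℝ × Rd d => tpow (Real.exp p.1) E p.2 := by
    refine (continuousOn_tpow_apply E).comp_continuous
      (f := fun p : ℝ × Rd d => (Real.exp p.1, p.2)) ?_ fun p => ⟨Real.exp_pos _, mem_univ _⟩
    exact (Real.continuous_exp.comp continuous_fst).prodMk continuous_snd
  have hΨm : StronglyMeasurable Ψ := by
    refine StronglyMeasurable.smul (f := fun p : ℝ × Rd d => Real.exp p.1 ^ endTrace E)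
      (g := fun p : ℝ × Rd d => Φ (p.1, tpow (Real.exp p.1) E p.2)) ?_
      (hΦm.comp_measurable (continuous_fst.prodMk hTc).measurable)
    exact (((Real.continuous_exp.comp continuous_fst).rpow_const
      fun p => Or.inl (Real.exp_pos _).ne').stronglyMeasurable)
  have hΨi : Integrable Ψ ((volume : Measure ℝ).prod volume) := by
    rw [integrable_prod_iff hΨm.aestronglyMeasurable]
    rw [integrable_prod_iff hΦm.aestronglyMeasurable] at hΦi
    constructor
    · filter_upwards [hΦi.1] with u hu
      exact integrable_comp_tpow (Real.exp_pos u) E hu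
    · refine hΦi.2.congr (Filter.Eventually.of_forall fun u => ?_)
      simp only [hΨ, norm_smul, Real.norm_of_nonneg (Real.rpow_nonneg (Real.exp_pos u).le _)]
      exact (integral_comp_tpow (Real.exp_pos u) E fun η => ‖Φ (u, η)‖).symm
  have h2 : ∫ u, ∫ η, Φ (u, η) = ∫ u, ∫ ξ, Ψ (u, ξ) := by
    congr 1
    funext u
    exact (integral_comp_tpow (Real.exp_pos u) E fun η => Φ (u, η)).symm
  rw [h1, h2, integral_integral_swap (f := fun u η => Ψ (u, η)) hΨi,
    ← integral_indicator (measurableSet_annulus hP.continuous)]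
  congr 1
  funext ξ
  have hmem : ∀ u, (u, tpow (Real.exp u) E ξ) ∈ S ↔ ξ ∈ annulus P := fun u => by
    rw [hS, Set.mem_ofPred_eq, hE _ (Real.exp_pos u), ← mul_assoc, ← Real.exp_add, neg_add_cancel,
      Real.exp_zero, one_mul]
    rfl
  by_cases h : ξ ∈ annulus P
  · rw [indicator_of_mem h, ← integral_exp_mul_comp_exp]
    congr 1
    funext u
    simp only [hΨ, hΦ]
    rw [indicator_of_mem ((hmem u).2 h)]
  · rw [indicator_of_notMem h]
    refine integral_eq_zero_of_ae (Filter.Eventually.of_forall fun u => ?_)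
    simp only [hΨ, hΦ]
    rw [indicator_of_notMem (fun h' => h ((hmem u).1 h')), smul_zero]
    rfl

theorem IsPosHomFn.isCompact_closed_annulus (hP : IsPosHomFn P) (hE : E ∈ ExpSet P)
    (hc : IsContracting E) : IsCompact {ξ | 1 ≤ P ξ ∧ P ξ ≤ Real.exp 1} :=
  (hP.isCompact_le hE hc (Real.exp 1)).of_isClosed_subset
    ((isClosed_le continuous_const hP.continuous).inter
      (isClosed_le hP.continuous continuous_const)) fun _ h => h.2

theorem norm_integral_le_of_norm_radial_le (hd : 1 ≤ d) (hP : IsPosHomFn P) (hE : E ∈ ExpSet P)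
    (hc : IsContracting E) {f : Rd d → ℂ} (hfm : StronglyMeasurable f) (hf : Integrable f) {C : ℝ}
    (h : ∀ ξ ∈ annulus P, ‖∫ t in Ioi (0 : ℝ), t ^ (endTrace E - 1) • f (tpow t E ξ)‖ ≤ C) :
    ‖∫ ξ, f ξ‖ ≤ C * volume.real (annulus P) := by
  rw [integral_polar hd hP hE hfm hf]
  refine norm_setIntegral_le_of_norm_le_const ?_ h
  exact (measure_mono fun ξ (h : ξ ∈ annulus P) => (⟨h.1, h.2.le⟩ :
    ξ ∈ {ξ | 1 ≤ P ξ ∧ P ξ ≤ Real.exp 1})).trans_lt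
    (hP.isCompact_closed_annulus hE hc).measure_lt_top

end PolarCoordinates

/-! ### One-dimensional oscillatory integrals. -/

section OscillatoryIntegral

open Set

theorem norm_exp_neg_mul_I_add (N x y : ℝ) :
    ‖Complex.exp (-(N * (Complex.I * x + y)))‖ = Real.exp (-(N * y)) := by
  rw [Complex.norm_exp]; congr 1; simp

/-- An integration by parts estimate for `∫ t^(μ-1) exp(-(i F + G)/a)` over `[a, T]`. -/
theorem norm_intervalIntegral_oscillatory_le {μ k c M c' M' a T T' : ℝ} (hμ1 : μ < 1) (hk : 0 < k)
    (hc : 0 < c) (hc' : 0 < c') (hM : 0 ≤ M) (hM' : 0 ≤ M') (ha : 0 < a) (haT : a ≤ T) (hTT : T < T')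
    {F F1 F2 G G1 : ℝ → ℝ}
    (hF : ∀ t ∈ Ioo 0 T', HasDerivAt F (F1 t) t) (hF1 : ∀ t ∈ Ioo 0 T', HasDerivAt F1 (F2 t) t)
    (hG : ∀ t ∈ Ioo 0 T', HasDerivAt G (G1 t) t)
    (bF1 : ∀ t, a ≤ t → t < T' → c ≤ |F1 t|) (bF2 : ∀ t, a ≤ t → t < T' → |F2 t| ≤ M / t)
    (bG : ∀ t ∈ Ioo 0 T', c' * t ^ k ≤ G t) (bG1 : ∀ t ∈ Ioo 0 T', |G1 t| ≤ M' * t ^ (k - 1)) :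
    ‖∫ t in a..T, t ^ (μ - 1) • Complex.exp (-((a⁻¹ : ℝ) * (Complex.I * F t + G t)))‖ ≤
      (M' / (c * (c' * k)) + (1 / c + M / (c ^ 2 * (1 - μ))) + 2 / c) * a ^ μ := by
  have h1μ : 0 < 1 - μ := by linarith
  set w : ℝ → ℂ := fun t => Complex.exp (-((a⁻¹ : ℝ) * (Complex.I * F t + G t))) with hw
  set v : ℝ → ℂ := fun t => t ^ (μ - 1) • w t with hv
  have hIoo : ∀ t ∈ Icc a T, t ∈ Ioo 0 T' := fun t ht => ⟨ha.trans_le ht.1, ht.2.trans_lt hTT⟩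
  have hw' : ∀ t ∈ Ioo 0 T', HasDerivAt w
      (w t * -((a⁻¹ : ℝ) * (Complex.I * F1 t + G1 t))) t := fun t ht =>
    ((((hF t ht).ofReal_comp.const_mul Complex.I).add (hG t ht).ofReal_comp).const_mul
      ((a⁻¹ : ℝ) : ℂ)).neg.cexp
  have hp' : ∀ t ∈ Ioo 0 T', HasDerivAt (fun t : ℝ => t ^ (μ - 1)) ((μ - 1) * t ^ (μ - 1 - 1)) t :=
    fun t ht => Real.hasDerivAt_rpow_const (Or.inl ht.1.ne')
  have hv' : ∀ t ∈ Ioo 0 T', HasDerivAt v (t ^ (μ - 1) • (w t * -((a⁻¹ : ℝ) *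
      (Complex.I * F1 t + G1 t))) + ((μ - 1) * t ^ (μ - 1 - 1)) • w t) t := fun t ht =>
    (hp' t ht).smul (hw' t ht)
  have hvc : ContinuousOn v (Ioo 0 T') := fun t ht => (hv' t ht).continuousAt.continuousWithinAt
  have hF1ne : ∀ t ∈ Icc a T, F1 t ≠ 0 := fun t ht => by
    have := bF1 t ht.1 (hIoo t ht).2
    exact fun h => by rw [h, abs_zero] at this; linarith
  have hden : ∀ t ∈ Icc a T, (Complex.I * (F1 t : ℂ)) ≠ 0 := fun t ht =>
    mul_ne_zero Complex.I_ne_zero (by exact_mod_cast hF1ne t ht)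
  -- Approximate antiderivative of `v`: differentiating the phase in `Φ` reproduces `v`, and the
  -- remaining derivatives, those of `t^(μ-1)`, of `F1` and of `G`, make up the error `e`.
  set Φ : ℝ → ℂ := fun t => -(a : ℂ) * (v t / (Complex.I * F1 t)) with hΦ
  set e : ℝ → ℂ := fun t => -(a : ℂ) * ((((μ - 1) * t ^ (μ - 1 - 1)) • w t) / (Complex.I * F1 t)
    - (t ^ (μ - 1) • w t) * (Complex.I * F2 t) / (Complex.I * F1 t) ^ 2) +
      t ^ (μ - 1) • (w t * (G1 t / (Complex.I * F1 t))) with he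
  have ha0 : (a : ℂ) ≠ 0 := by exact_mod_cast ha.ne'
  have hΦ' : ∀ t ∈ Icc a T, HasDerivAt Φ (v t + e t) t := fun t ht => by
    have h := (((hv' t (hIoo t ht)).div ((hF1 t (hIoo t ht)).ofReal_comp.const_mul Complex.I)
      (hden t ht))).const_mul (-(a : ℂ))
    refine h.congr_deriv ?_
    have h1 := hden t ht
    have h2 : (F1 t : ℂ) ≠ 0 := by exact_mod_cast hF1ne t ht
    simp only [he, hv, Complex.real_smul, Complex.ofReal_inv]
    field_simp
    ring
  have hwn : ∀ t ∈ Ioo 0 T', ‖w t‖ ≤ Real.exp (-(a⁻¹ * (c' * t ^ k))) := fun t ht => by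
    rw [hw, norm_exp_neg_mul_I_add, Real.exp_le_exp, neg_le_neg_iff]
    exact mul_le_mul_of_nonneg_left (bG t ht) (inv_nonneg.2 ha.le)
  have hwn1 : ∀ t ∈ Ioo 0 T', ‖w t‖ ≤ 1 := fun t ht => (hwn t ht).trans (by
    rw [Real.exp_le_one_iff, neg_nonpos]
    have := ht.1
    positivity)
  have hpow : ∀ t ∈ Icc a T, t ^ (μ - 1) ≤ a ^ (μ - 1) := fun t ht =>
    Real.rpow_le_rpow_of_nonpos ha ht.1 (by linarith)
  have haμ : a * a ^ (μ - 1) = a ^ μ := by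
    rw [Real.rpow_sub_one ha.ne']; field_simp
  have hΦn : ∀ t ∈ Icc a T, ‖Φ t‖ ≤ 1 / c * a ^ μ := fun t ht => by
    have ht0 := (hIoo t ht).1
    rw [hΦ]
    simp only [norm_mul, norm_neg, norm_div, Complex.norm_real, Complex.norm_I, one_mul, hv,
      norm_smul, Real.norm_eq_abs, abs_of_pos ha, abs_of_pos (Real.rpow_pos_of_pos ht0 _)]
    calc a * (t ^ (μ - 1) * ‖w t‖ / |F1 t|) ≤ a * (a ^ (μ - 1) * 1 / c) := by
          exact mul_le_mul_of_nonneg_left (div_le_div₀ (by positivity) (mul_le_mul (hpow t ht)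
            (hwn1 t (hIoo t ht)) (norm_nonneg _) (by positivity)) hc
            (bF1 t ht.1 (hIoo t ht).2)) ha.le
      _ = 1 / c * a ^ μ := by rw [← haμ]; ring
  -- Majorant of `‖e‖` with the explicit antiderivative `B`. The factor `t^(k-1) exp(-c' t^k / a)`
  -- is an exact derivative up to a constant, which gains a power of `a`; `t^(μ-2)` integrates to at
  -- most `a^(μ-1)/(1-μ)` because `μ < 1`.
  set B' : ℝ → ℝ := fun t => M' / c * a ^ (μ - 1) * (t ^ (k - 1) * Real.exp (-(a⁻¹ * (c' * t ^ k))))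
    + a * ((1 - μ) / c + M / c ^ 2) * t ^ (μ - 1 - 1) with hB'
  set B : ℝ → ℝ := fun t => M' / c * a ^ (μ - 1) * (a / (c' * k) *
    (1 - Real.exp (-(a⁻¹ * (c' * t ^ k))))) + a * (1 / c + M / (c ^ 2 * (1 - μ))) *
      (a ^ (μ - 1) - t ^ (μ - 1)) with hB
  have hBd : ∀ t ∈ Icc a T, HasDerivAt B (B' t) t := fun t ht => by
    have ht0 := (hIoo t ht).1
    have h1 := ((((((Real.hasDerivAt_rpow_const (p := k) (Or.inl ht0.ne')).const_mul
      c').const_mul a⁻¹).neg.exp.const_sub 1).const_mul (a / (c' * k))).const_mul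
        (M' / c * a ^ (μ - 1))).add (((hp' t (hIoo t ht)).const_sub (a ^ (μ - 1))).const_mul
          (a * (1 / c + M / (c ^ 2 * (1 - μ)))))
    refine h1.congr_deriv ?_
    simp only [hB', Pi.neg_apply]
    field_simp
    ring
  have hen : ∀ t ∈ Icc a T, ‖e t‖ ≤ B' t := fun t ht => by
    have ht0 := (hIoo t ht).1
    have b1 := bF1 t ht.1 (hIoo t ht).2
    have b2 := bF2 t ht.1 (hIoo t ht).2
    have b3 := bG1 t (hIoo t ht)
    have p0 : 0 < t ^ (μ - 1) := Real.rpow_pos_of_pos ht0 _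
    have p1 : 0 < t ^ (μ - 1 - 1) := Real.rpow_pos_of_pos ht0 _
    have hts : t ^ (μ - 1 - 1) = t ^ (μ - 1) / t := Real.rpow_sub_one ht0.ne' _
    refine (norm_add_le _ _).trans ?_
    have e1 : ‖t ^ (μ - 1) • (w t * (G1 t / (Complex.I * F1 t)))‖ ≤
        M' / c * a ^ (μ - 1) * (t ^ (k - 1) * Real.exp (-(a⁻¹ * (c' * t ^ k)))) := by
      simp only [norm_mul, norm_div, Complex.norm_real, Complex.norm_I, one_mul,
        norm_smul, Real.norm_eq_abs, abs_of_pos p0]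
      calc t ^ (μ - 1) * (‖w t‖ * (|G1 t| / |F1 t|)) ≤ a ^ (μ - 1) *
            (Real.exp (-(a⁻¹ * (c' * t ^ k))) * (M' * t ^ (k - 1) / c)) := by
            refine mul_le_mul (hpow t ht) ?_ (by positivity) (by positivity)
            gcongr
            exact hwn t (hIoo t ht)
        _ = _ := by ring
    have e2 : ‖-(a : ℂ) * ((((μ - 1) * t ^ (μ - 1 - 1)) • w t) / (Complex.I * F1 t)
        - (t ^ (μ - 1) • w t) * (Complex.I * F2 t) / (Complex.I * F1 t) ^ 2)‖ ≤
        a * ((1 - μ) / c + M / c ^ 2) * t ^ (μ - 1 - 1) := by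
      rw [norm_mul, norm_neg, Complex.norm_real, Real.norm_eq_abs, abs_of_pos ha, mul_assoc]
      refine mul_le_mul_of_nonneg_left ((norm_sub_le _ _).trans ?_) ha.le
      simp only [norm_mul, norm_div, Complex.norm_real, Complex.norm_I, one_mul, norm_pow,
        norm_smul, Real.norm_eq_abs, abs_of_pos p0, abs_of_pos p1,
        abs_of_neg (show μ - 1 < 0 by linarith)]
      calc -(μ - 1) * t ^ (μ - 1 - 1) * ‖w t‖ / |F1 t| + t ^ (μ - 1) * ‖w t‖ * |F2 t| / |F1 t| ^ 2
          ≤ -(μ - 1) * t ^ (μ - 1 - 1) * 1 / c + t ^ (μ - 1) * 1 * (M / t) / c ^ 2 := by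
            have := hwn1 t (hIoo t ht)
            have h0 : 0 ≤ -(μ - 1) := by linarith
            gcongr
        _ = _ := by rw [hts]; field_simp; ring
    simp only [hB']
    linarith
  -- `J` has derivative `-e` and vanishes at `a`. Comparing it with `B` by a mean value inequality
  -- avoids any integrability requirement on `e`, in which `F2` and `G1` are arbitrary derivatives.
  set J : ℝ → ℂ := fun t => (∫ s in a..t, v s) - (Φ t - Φ a) with hJ
  have hvi : ∀ t ∈ Icc a T, IntervalIntegrable v MeasureTheory.volume a t := fun t ht =>
    (hvc.mono (by
      rw [uIcc_of_le ht.1]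
      exact fun s hs => hIoo s ⟨hs.1, hs.2.trans ht.2⟩)).intervalIntegrable
  have hJd : ∀ t ∈ Icc a T, HasDerivAt J (-e t) t := fun t ht => by
    have h1 : HasDerivAt (fun u => ∫ s in a..u, v s) (v t) t :=
      intervalIntegral.integral_hasDerivAt_right (hvi t ht)
        (hvc.stronglyMeasurableAtFilter isOpen_Ioo t (hIoo t ht)) (hv' t (hIoo t ht)).continuousAt
    refine (h1.sub ((hΦ' t ht).sub_const (Φ a))).congr_deriv ?_
    ring
  have hB0 : ∀ t ∈ Icc a T, ‖J t‖ ≤ B t := by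
    refine image_norm_le_of_norm_deriv_right_le_deriv_boundary' (f' := fun t => -e t) (B' := B')
      (fun t ht => (hJd t ht).continuousAt.continuousWithinAt)
      (fun t ht => (hJd t (Ico_subset_Icc_self ht)).hasDerivWithinAt) ?_
      (fun t ht => (hBd t ht).continuousAt.continuousWithinAt)
      (fun t ht => (hBd t (Ico_subset_Icc_self ht)).hasDerivWithinAt)
      (fun t ht => by rw [norm_neg]; exact hen t (Ico_subset_Icc_self ht))
    simp only [hJ, hB, intervalIntegral.integral_same, sub_self, norm_zero, mul_zero, add_zero]
    have : Real.exp (-(a⁻¹ * (c' * a ^ k))) ≤ 1 := by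
      rw [Real.exp_le_one_iff, neg_nonpos]; positivity
    have : 0 ≤ 1 - Real.exp (-(a⁻¹ * (c' * a ^ k))) := by linarith
    positivity
  have hTm : T ∈ Icc a T := ⟨haT, le_rfl⟩
  have hBT : B T ≤ (M' / (c * (c' * k)) + (1 / c + M / (c ^ 2 * (1 - μ)))) * a ^ μ := by
    have hT0 : 0 < T := ha.trans_le haT
    have q1 : M' / c * a ^ (μ - 1) * (a / (c' * k) * (1 - Real.exp (-(a⁻¹ * (c' * T ^ k))))) ≤
        M' / c * a ^ (μ - 1) * (a / (c' * k) * 1) := by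
      gcongr
      linarith [Real.exp_pos (-(a⁻¹ * (c' * T ^ k)))]
    have q2 : a * (1 / c + M / (c ^ 2 * (1 - μ))) * (a ^ (μ - 1) - T ^ (μ - 1)) ≤
        a * (1 / c + M / (c ^ 2 * (1 - μ))) * a ^ (μ - 1) := by
      gcongr
      linarith [Real.rpow_pos_of_pos hT0 (μ - 1)]
    refine (add_le_add q1 q2).trans_eq ?_
    rw [← haμ]
    field_simp
  have hfin : (∫ s in a..T, v s) = J T + (Φ T - Φ a) := by simp [hJ]
  rw [hfin]
  calc ‖J T + (Φ T - Φ a)‖ ≤ ‖J T‖ + (‖Φ T‖ + ‖Φ a‖) :=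
        (norm_add_le _ _).trans (by gcongr; exact norm_sub_le _ _)
    _ ≤ (M' / (c * (c' * k)) + (1 / c + M / (c ^ 2 * (1 - μ)))) * a ^ μ +
        (1 / c * a ^ μ + 1 / c * a ^ μ) :=
        add_le_add ((hB0 T hTm).trans hBT) (add_le_add (hΦn T hTm) (hΦn a ⟨le_rfl, haT⟩))
    _ = _ := by ring

/-- On `(0, a]` there is no oscillation to exploit, but `∫ t^(μ-1)` already equals `a^μ/μ`. The
phase bounds are therefore required only for `t ≥ a`, which is where the shift from the drift can be
controlled. -/
theorem norm_integral_Ioc_oscillatory_le {μ k c M c' M' a T T' : ℝ} (hμ : 0 < μ) (hμ1 : μ < 1)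
    (hk : 0 < k)
    (hc : 0 < c) (hc' : 0 < c') (hM : 0 ≤ M) (hM' : 0 ≤ M') (ha : 0 < a) (hTT : T < T')
    {F F1 F2 G G1 : ℝ → ℝ}
    (hF : ∀ t ∈ Ioo 0 T', HasDerivAt F (F1 t) t) (hF1 : ∀ t ∈ Ioo 0 T', HasDerivAt F1 (F2 t) t)
    (hG : ∀ t ∈ Ioo 0 T', HasDerivAt G (G1 t) t)
    (bF1 : ∀ t, a ≤ t → t < T' → c ≤ |F1 t|) (bF2 : ∀ t, a ≤ t → t < T' → |F2 t| ≤ M / t)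
    (bG : ∀ t ∈ Ioo 0 T', c' * t ^ k ≤ G t) (bG1 : ∀ t ∈ Ioo 0 T', |G1 t| ≤ M' * t ^ (k - 1)) :
    ‖∫ t in Ioc 0 T, t ^ (μ - 1) • Complex.exp (-((a⁻¹ : ℝ) * (Complex.I * F t + G t)))‖ ≤
      (M' / (c * (c' * k)) + (1 / c + M / (c ^ 2 * (1 - μ))) + 2 / c + 1 / μ) * a ^ μ := by
  set v : ℝ → ℂ := fun t => t ^ (μ - 1) •
    Complex.exp (-((a⁻¹ : ℝ) * (Complex.I * F t + G t))) with hv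
  have h1μ : 0 < 1 - μ := by linarith
  have hvc : ContinuousOn v (Ioo 0 T') := fun t ht => by
    refine (ContinuousAt.smul (Real.continuousAt_rpow_const _ _ (Or.inl ht.1.ne'))
      ?_).continuousWithinAt
    exact (((((hF t ht).ofReal_comp.const_mul Complex.I).add (hG t ht).ofReal_comp).const_mul
      ((a⁻¹ : ℝ) : ℂ)).neg.cexp).continuousAt
  have hvn : ∀ t ∈ Ioo 0 T', ‖v t‖ ≤ t ^ (μ - 1) := fun t ht => by
    have ht0 := ht.1
    rw [hv, norm_smul, norm_exp_neg_mul_I_add, Real.norm_of_nonneg (by positivity)]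
    refine mul_le_of_le_one_right (by positivity) ?_
    rw [Real.exp_le_one_iff, neg_nonpos]
    exact mul_nonneg (inv_nonneg.2 ha.le) ((by positivity : (0 : ℝ) ≤ c' * t ^ k).trans (bG t ht))
  have hpi : ∀ b, MeasureTheory.IntegrableOn (fun t : ℝ => t ^ (μ - 1)) (Ioc 0 b) := fun b => by
    rcases le_total 0 b with hb | hb
    · rw [← intervalIntegrable_iff_integrableOn_Ioc_of_le hb]
      exact intervalIntegral.intervalIntegrable_rpow' (by linarith)
    · rw [Ioc_eq_empty (not_lt.2 hb)]; exact MeasureTheory.integrableOn_empty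
  have hvi : ∀ b ≤ T, MeasureTheory.IntegrableOn v (Ioc 0 b) := fun b hb => by
    refine (hpi b).mono' ((hvc.mono fun t ht => ⟨ht.1, (ht.2.trans hb).trans_lt hTT⟩
      ).aestronglyMeasurable measurableSet_Ioc) ?_
    filter_upwards [MeasureTheory.ae_restrict_mem measurableSet_Ioc] with t ht
    exact hvn t ⟨ht.1, (ht.2.trans hb).trans_lt hTT⟩
  have hsmall : ∀ b ≤ T, b ≤ a → ‖∫ t in Ioc 0 b, v t‖ ≤ 1 / μ * a ^ μ := fun b hb hba => by
    calc ‖∫ t in Ioc 0 b, v t‖ ≤ ∫ t in Ioc 0 b, t ^ (μ - 1) := by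
          refine MeasureTheory.norm_integral_le_of_norm_le (hpi b) ?_
          filter_upwards [MeasureTheory.ae_restrict_mem measurableSet_Ioc] with t ht
          exact hvn t ⟨ht.1, (ht.2.trans hb).trans_lt hTT⟩
      _ ≤ ∫ t in Ioc 0 a, t ^ (μ - 1) := by
          refine MeasureTheory.setIntegral_mono_set (hpi a) ?_
            (Ioc_subset_Ioc_right hba).eventuallyLE
          filter_upwards [MeasureTheory.ae_restrict_mem measurableSet_Ioc] with t ht
          exact Real.rpow_nonneg ht.1.le _
      _ = 1 / μ * a ^ μ := by
          rw [← intervalIntegral.integral_of_le ha.le, integral_rpow (Or.inl (by linarith))]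
          rw [sub_add_cancel, Real.zero_rpow hμ.ne']
          ring
  have hpos : 0 ≤ (M' / (c * (c' * k)) + (1 / c + M / (c ^ 2 * (1 - μ))) + 2 / c) * a ^ μ := by
    positivity
  rcases le_total T a with h | h
  · refine (hsmall T le_rfl h).trans ?_
    linarith [add_mul (M' / (c * (c' * k)) + (1 / c + M / (c ^ 2 * (1 - μ))) + 2 / c) (1 / μ) (a ^ μ)]
  · have hsplit : ∫ t in Ioc 0 T, v t = (∫ t in Ioc 0 a, v t) + ∫ t in a..T, v t := by
      rw [intervalIntegral.integral_of_le h, ← Ioc_union_Ioc_eq_Ioc ha.le h]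
      refine MeasureTheory.setIntegral_union ?_ measurableSet_Ioc (hvi a h)
        ((hvi T le_rfl).mono_set (Ioc_subset_Ioc_left ha.le))
      exact Ioc_disjoint_Ioc_of_le le_rfl
    rw [hsplit]
    have := norm_intervalIntegral_oscillatory_le hμ1 hk hc hc' hM hM' ha h hTT hF hF1 hG bF1 bF2 bG bG1
    refine (norm_add_le _ _).trans ((add_le_add (hsmall a h le_rfl) this).trans_eq ?_)
    ring

end OscillatoryIntegral

/-! ### Fourier analysis on `ℤ^d`: convolution, inversion, Bessel's inequality. -/

section Fourier

open MeasureTheory Set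

variable {d : ℕ}

/-- The character `ξ ↦ e^{i x·ξ}`. -/
noncomputable def latChar (x : Zd d) (ξ : Rd d) : ℂ :=
  Complex.exp (Complex.I * ((∑ i, (x i : ℝ) * ξ i : ℝ) : ℂ))

theorem hatFn_eq (φ : Zd d → ℂ) (ξ : Rd d) : hatFn φ ξ = ∑' x, φ x * latChar x ξ := rfl

@[simp] theorem norm_latChar (x : Zd d) (ξ : Rd d) : ‖latChar x ξ‖ = 1 := by
  rw [latChar, mul_comm, Complex.norm_exp_ofReal_mul_I]

theorem latChar_add (x y : Zd d) (ξ : Rd d) :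
    latChar (x + y) ξ = latChar x ξ * latChar y ξ := by
  rw [latChar, latChar, latChar, ← Complex.exp_add, ← mul_add, ← Complex.ofReal_add,
    ← Finset.sum_add_distrib]
  congr 3
  simp [add_mul]

theorem latChar_add_right (x : Zd d) (ξ η : Rd d) :
    latChar x (ξ + η) = latChar x ξ * latChar x η := by
  rw [latChar, latChar, latChar, ← Complex.exp_add, ← mul_add, ← Complex.ofReal_add,
    ← Finset.sum_add_distrib]
  congr 3
  simp [mul_add]

@[simp] theorem latChar_zero (ξ : Rd d) : latChar (0 : Zd d) ξ = 1 := by simp [latChar]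

theorem conj_latChar (x : Zd d) (ξ : Rd d) :
    (starRingEnd ℂ) (latChar x ξ) = latChar (-x) ξ := by
  rw [latChar, latChar, ← Complex.exp_conj]
  simp

theorem latChar_neg_right (x : Zd d) (ξ : Rd d) :
    latChar x (-ξ) = (starRingEnd ℂ) (latChar x ξ) := by
  rw [latChar, latChar, ← Complex.exp_conj]
  simp

theorem continuous_latChar (x : Zd d) : Continuous (latChar x : Rd d → ℂ) := by
  unfold latChar; fun_prop

theorem MemSd.summable_norm {φ : Zd d → ℂ} (hφ : MemSd φ) : Summable fun x => ‖φ x‖ := by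
  simpa using hφ 0

theorem summable_norm_mul_latChar {φ : Zd d → ℂ} (hφ : Summable fun x => ‖φ x‖) (ξ : Rd d) :
    Summable fun x => ‖φ x * latChar x ξ‖ := by simpa using hφ

theorem continuous_hatFn {φ : Zd d → ℂ} (hφ : Summable fun x => ‖φ x‖) : Continuous (hatFn φ) :=
  continuous_tsum (fun x => continuous_const.mul (continuous_latChar x)) hφ fun x ξ => by
    change ‖φ x * latChar x ξ‖ ≤ _
    simp

theorem norm_hatFn_le_tsum {φ : Zd d → ℂ} (hφ : Summable fun x => ‖φ x‖) (ξ : Rd d) :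
    ‖hatFn φ ξ‖ ≤ ∑' x, ‖φ x‖ := by
  refine (norm_tsum_le_tsum_norm (summable_norm_mul_latChar hφ ξ)).trans_eq ?_
  simp

theorem bddAbove_norm_hatFn {φ : Zd d → ℂ} (hφ : Summable fun x => ‖φ x‖) :
    BddAbove (range fun ξ : Rd d => ‖hatFn φ ξ‖) :=
  ⟨_, by rintro _ ⟨ξ, rfl⟩; exact norm_hatFn_le_tsum hφ ξ⟩

theorem norm_le_tsum_norm {φ : Zd d → ℂ} (hφ : Summable fun x => ‖φ x‖) (x : Zd d) :
    ‖φ x‖ ≤ ∑' y, ‖φ y‖ :=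
  hφ.le_tsum x fun _ _ => norm_nonneg _

theorem bddAbove_norm {φ : Zd d → ℂ} (hφ : Summable fun x => ‖φ x‖) :
    BddAbove (range fun x => ‖φ x‖) :=
  ⟨_, by rintro _ ⟨x, rfl⟩; exact norm_le_tsum_norm hφ x⟩

/-- The shear `(x, y) ↦ (x - y, y)`. -/
def shearEquiv (d : ℕ) : Zd d × Zd d ≃ Zd d × Zd d where
  toFun p := (p.1 - p.2, p.2)
  invFun p := (p.1 + p.2, p.2)
  left_inv p := by simp
  right_inv p := by simp

theorem summable_norm_convolution {a b : Zd d → ℂ} (ha : Summable fun x => ‖a x‖)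
    (hb : Summable fun x => ‖b x‖) : Summable fun x => ‖∑' y, a (x - y) * b y‖ := by
  have h := (shearEquiv d).summable_iff.2 (ha.mul_norm hb)
  refine Summable.of_nonneg_of_le (fun _ => norm_nonneg _) (fun x => ?_) h.prod
  exact norm_tsum_le_tsum_norm (h.prod_factor x)

theorem hatFn_convolution {a b : Zd d → ℂ} (ha : Summable fun x => ‖a x‖)
    (hb : Summable fun x => ‖b x‖) (ξ : Rd d) :
    hatFn (fun x => ∑' y, a (x - y) * b y) ξ = hatFn a ξ * hatFn b ξ := by
  have h1 := summable_norm_mul_latChar ha ξ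
  have h2 := summable_norm_mul_latChar hb ξ
  have h3 := (shearEquiv d).summable_iff.2 (summable_mul_of_summable_norm h1 h2)
  simp only [hatFn_eq]
  rw [tsum_mul_tsum_of_summable_norm h1 h2, ← (shearEquiv d).tsum_eq]
  refine Eq.trans ?_ h3.tsum_prod.symm
  congr 1
  funext x
  rw [← tsum_mul_right]
  congr 1
  funext y
  simp only [Function.comp_apply, shearEquiv, Equiv.coe_fn_mk]
  have : latChar x ξ = latChar (x - y) ξ * latChar y ξ := by rw [← latChar_add, sub_add_cancel]
  rw [this]; ring

theorem summable_norm_convPow {φ : Zd d → ℂ} (hφ : Summable fun x => ‖φ x‖) (n : ℕ) :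
    Summable fun x => ‖convPow φ n x‖ := by
  induction n with
  | zero =>
    refine summable_of_ne_finset_zero (s := {0}) fun x hx => ?_
    simp only [Finset.mem_singleton] at hx
    simp [convPow, hx]
  | succ n ih => exact summable_norm_convolution ih hφ

theorem hatFn_convPow {φ : Zd d → ℂ} (hφ : Summable fun x => ‖φ x‖) (n : ℕ) (ξ : Rd d) :
    hatFn (convPow φ n) ξ = hatFn φ ξ ^ n := by
  induction n with
  | zero =>
    rw [hatFn_eq, tsum_eq_single 0]
    · simp [convPow]
    · intro x hx; simp [convPow, hx]
  | succ n ih =>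
    rw [pow_succ, ← ih]
    exact hatFn_convolution (summable_norm_convPow hφ n) hφ ξ

/-- A fundamental domain of `ℝ^d` modulo `2πℤ^d`. -/
def torusBox (a : Rd d) : Set (Rd d) :=
  {ξ | ∀ i, ξ i ∈ Ioc (a i - Real.pi) (a i + Real.pi)}

theorem isCompact_closedBox (a : Rd d) :
    IsCompact {ξ : Rd d | ∀ i, ξ i ∈ Icc (a i - Real.pi) (a i + Real.pi)} := by
  have h := (isCompact_univ_pi fun i => isCompact_Icc (a := a i - Real.pi)
    (b := a i + Real.pi)).image (PiLp.continuous_toLp 2 (fun _ : Fin d => ℝ))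
  convert h using 1
  ext ξ
  simp only [mem_ofPred_eq, mem_image, mem_pi, mem_univ, true_implies]
  constructor
  · intro h; exact ⟨fun i => ξ i, h, rfl⟩
  · rintro ⟨η, h, rfl⟩; exact h

theorem measure_torusBox_lt_top (a : Rd d) : volume (torusBox a) < ⊤ :=
  (measure_mono fun ξ (h : ξ ∈ torusBox a) => (fun i => ⟨(h i).1.le, (h i).2⟩ :
    ξ ∈ {ξ : Rd d | ∀ i, ξ i ∈ Icc (a i - Real.pi) (a i + Real.pi)})).trans_lt
    (isCompact_closedBox a).measure_lt_top

theorem integral_Ioc_exp_int_mul (a : ℝ) (m : ℤ) :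
    ∫ t in Ioc (a - Real.pi) (a + Real.pi), Complex.exp (Complex.I * ((m : ℝ) * t : ℝ)) =
      if m = 0 then (2 * Real.pi : ℂ) else 0 := by
  have hle : a - Real.pi ≤ a + Real.pi := by linarith [Real.pi_pos]
  rw [← intervalIntegral.integral_of_le hle]
  split_ifs with h
  · subst h
    simp
    ring
  · have hc : Complex.I * (m : ℂ) ≠ 0 := mul_ne_zero Complex.I_ne_zero (by exact_mod_cast h)
    have : ∀ t : ℝ, Complex.exp (Complex.I * ((m : ℝ) * t : ℝ)) =
        Complex.exp ((Complex.I * m) * t) := fun t => by push_cast; ring_nf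
    simp only [this]
    rw [integral_exp_mul_complex hc]
    have h2 : Complex.exp (Complex.I * m * ((a + Real.pi : ℝ) : ℂ)) =
        Complex.exp (Complex.I * m * ((a - Real.pi : ℝ) : ℂ)) := by
      rw [Complex.exp_eq_exp_iff_exists_int]
      exact ⟨m, by push_cast; ring⟩
    rw [h2, sub_self, zero_div]

theorem integral_latChar_torusBox (a : Rd d) (x : Zd d) :
    ∫ ξ in torusBox a, latChar x ξ = if x = 0 then ((2 * Real.pi) ^ d : ℂ) else 0 := by
  have h1 : ∫ ξ in torusBox a, latChar x ξ =
      ∫ η in univ.pi fun i => Ioc (a i - Real.pi) (a i + Real.pi),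
        latChar x (WithLp.toLp 2 η) := by
    rw [← (PiLp.volume_preserving_toLp (Fin d)).setIntegral_preimage_emb
      (MeasurableEquiv.toLp 2 (Fin d → ℝ)).measurableEmbedding]
    congr 2
    ext η
    simp [torusBox]
  have h2 : ∀ η : Fin d → ℝ, latChar x (WithLp.toLp 2 η) =
      ∏ i, Complex.exp (Complex.I * ((x i : ℝ) * η i : ℝ)) := fun η => by
    rw [latChar, ← Complex.exp_sum, ← Finset.mul_sum]
    push_cast; rfl
  rw [h1]
  simp only [h2]
  rw [volume_pi, Measure.restrict_pi_pi, integral_fintype_prod_eq_prod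
    (f := fun i t => Complex.exp (Complex.I * ((x i : ℝ) * t : ℝ)))]
  simp only [integral_Ioc_exp_int_mul]
  split_ifs with h
  · subst h; simp
  · obtain ⟨i, hi⟩ := Function.ne_iff.1 h
    exact Finset.prod_eq_zero (Finset.mem_univ i) (if_neg hi)

/-- Termwise integration and orthogonality of characters. The centre `a` is left free so that the
box can later be moved until its boundary avoids the points with `|φ̂| = 1`. -/
theorem integral_hatFn_mul_latChar {ψ : Zd d → ℂ} (hψ : Summable fun x => ‖ψ x‖) (a : Rd d)
    (x : Zd d) :
    ∫ ξ in torusBox a, hatFn ψ ξ * latChar (-x) ξ = (2 * Real.pi) ^ d * ψ x := by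
  have hfin : IsFiniteMeasure (volume.restrict (torusBox a)) :=
    isFiniteMeasure_restrict.2 (measure_torusBox_lt_top a).ne
  have hterm : ∀ y, Integrable (fun ξ => ψ y * latChar y ξ * latChar (-x) ξ)
      (volume.restrict (torusBox a)) := fun y =>
    Integrable.of_bound (((continuous_const.mul (continuous_latChar y)).mul
      (continuous_latChar (-x))).aestronglyMeasurable) ‖ψ y‖
      (Filter.Eventually.of_forall fun ξ => by simp)
  have h := hasSum_integral_of_summable_integral_norm hterm (by
    simp only [norm_mul, norm_latChar, mul_one, integral_const, smul_eq_mul]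
    exact hψ.mul_left _)
  have h1 : ∫ ξ in torusBox a, hatFn ψ ξ * latChar (-x) ξ =
      ∫ ξ in torusBox a, ∑' y, ψ y * latChar y ξ * latChar (-x) ξ := by
    congr 1
    funext ξ
    rw [hatFn_eq, tsum_mul_right]
  rw [h1, ← h.tsum_eq, tsum_eq_single x]
  · have : ∀ ξ : Rd d, ψ x * latChar x ξ * latChar (-x) ξ = ψ x := fun ξ => by
      rw [mul_assoc, ← latChar_add, add_neg_cancel, latChar_zero, mul_one]
    simp only [this]
    have h2 := integral_latChar_torusBox a (0 : Zd d)
    simp only [latChar_zero, if_true] at h2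
    rw [← h2, ← integral_mul_const]
    simp
  · intro y hy
    have : ∀ ξ : Rd d, ψ y * latChar y ξ * latChar (-x) ξ = ψ y * latChar (y - x) ξ := fun ξ => by
      rw [mul_assoc, ← latChar_add, ← sub_eq_add_neg]
    simp only [this]
    rw [integral_const_mul, integral_latChar_torusBox, if_neg (sub_ne_zero.2 hy), mul_zero]

/-- Bessel's inequality for the characters of the torus. -/
theorem sum_norm_sq_integral_mul_latChar_le {D : Set (Rd d)} (hD : MeasurableSet D)
    (hD0 : D ⊆ torusBox 0) {g : Rd d → ℂ} (hg : Continuous g) (hg1 : ∀ ξ, ‖g ξ‖ = 1)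
    (s : Finset (Zd d)) :
    ∑ x ∈ s, ‖∫ ξ in D, g ξ * latChar x ξ‖ ^ 2 ≤ (2 * Real.pi) ^ d * volume.real D := by
  set ν := volume.restrict (torusBox (0 : Rd d)) with hν
  have hfin : IsFiniteMeasure ν :=
    isFiniteMeasure_restrict.2 (measure_torusBox_lt_top 0).ne
  have hνD : ν.restrict D = volume.restrict D := by
    rw [hν, Measure.restrict_restrict hD, inter_eq_left.2 hD0]
  have hpi : (0 : ℝ) < (2 * Real.pi) ^ d := by positivity
  set c : ℝ := √((2 * Real.pi) ^ d) with hc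
  have hc0 : 0 < c := Real.sqrt_pos.2 hpi
  have hcc : c * c = (2 * Real.pi) ^ d := Real.mul_self_sqrt hpi.le
  have hcc' : (c : ℂ) * c = (2 * Real.pi) ^ d := by exact_mod_cast hcc
  -- Characters of index `-x`, because the inner product conjugates its first argument; `c =
  -- (2π)^{d/2}` normalizes them.
  have hvm : ∀ x : Zd d, MemLp (fun ξ => (c⁻¹ : ℂ) * latChar (-x) ξ) 2 ν := fun x =>
    MemLp.of_bound (continuous_const.mul (continuous_latChar (-x))).aestronglyMeasurable c⁻¹
      (Filter.Eventually.of_forall fun ξ => by simp [abs_of_pos hc0])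
  have hfm : MemLp (D.indicator g) 2 ν :=
    MemLp.of_bound (hg.aestronglyMeasurable.indicator hD) 1
      (Filter.Eventually.of_forall fun ξ => by
        rw [norm_indicator_eq_indicator_norm]
        exact (indicator_le_self' (fun _ _ => norm_nonneg _) ξ).trans (hg1 ξ).le)
  have hinner : ∀ {f₁ f₂ : Rd d → ℂ} (h₁ : MemLp f₁ 2 ν) (h₂ : MemLp f₂ 2 ν),
      inner ℂ (h₁.toLp f₁) (h₂.toLp f₂) = ∫ ξ, f₂ ξ * (starRingEnd ℂ) (f₁ ξ) ∂ν := by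
    intro f₁ f₂ h₁ h₂
    rw [L2.inner_def]
    refine integral_congr_ae ?_
    filter_upwards [h₁.coeFn_toLp, h₂.coeFn_toLp] with ξ e1 e2
    rw [e1, e2]; rfl
  have hortho : Orthonormal ℂ fun x => (hvm x).toLp _ := by
    rw [orthonormal_iff_ite]
    intro x y
    rw [hinner]
    have : ∀ ξ : Rd d, (c⁻¹ : ℂ) * latChar (-y) ξ * (starRingEnd ℂ) ((c⁻¹ : ℂ) * latChar (-x) ξ) =
        ((c : ℂ) * c)⁻¹ * latChar (x - y) ξ := fun ξ => by
      rw [map_mul, conj_latChar, neg_neg, sub_eq_add_neg, latChar_add]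
      simp only [map_inv₀, Complex.conj_ofReal, mul_inv]
      ring
    simp only [this]
    rw [integral_const_mul, integral_latChar_torusBox, hcc']
    have hne : ((2 * Real.pi) ^ d : ℂ) ≠ 0 := by exact_mod_cast hpi.ne'
    by_cases h : x = y
    · rw [if_pos h, if_pos (sub_eq_zero.2 h), inv_mul_cancel₀ hne]
    · rw [if_neg h, if_neg (sub_ne_zero.2 h), mul_zero]
  have hb := hortho.sum_inner_products_le (hfm.toLp _) (s := s)
  have hnorm : ‖hfm.toLp (D.indicator g)‖ ^ 2 = volume.real D := by
    have h := inner_self_eq_norm_sq_to_K (𝕜 := ℂ) (hfm.toLp (D.indicator g))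
    rw [hinner] at h
    have h' : ∀ ξ, D.indicator g ξ * (starRingEnd ℂ) (D.indicator g ξ) =
        D.indicator (fun _ => (1 : ℂ)) ξ := fun ξ => by
      by_cases hξ : ξ ∈ D
      · rw [indicator_of_mem hξ, indicator_of_mem hξ, Complex.mul_conj, Complex.normSq_eq_norm_sq,
          hg1]; simp
      · rw [indicator_of_notMem hξ, indicator_of_notMem hξ, zero_mul]
    simp only [h'] at h
    rw [integral_indicator hD, hνD] at h
    simp only [integral_const, measureReal_restrict_apply_univ] at h
    have h2 : ((volume.real D : ℝ) : ℂ) = ((‖hfm.toLp (D.indicator g)‖ ^ 2 : ℝ) : ℂ) := by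
      simpa using h
    exact_mod_cast h2.symm
  have hterm : ∀ x, ‖inner ℂ ((hvm x).toLp _) (hfm.toLp (D.indicator g))‖ ^ 2 =
      ((2 * Real.pi) ^ d)⁻¹ * ‖∫ ξ in D, g ξ * latChar x ξ‖ ^ 2 := fun x => by
    rw [hinner]
    have h' : ∀ ξ, D.indicator g ξ * (starRingEnd ℂ) ((c⁻¹ : ℂ) * latChar (-x) ξ) =
        (c⁻¹ : ℂ) * D.indicator (fun ξ => g ξ * latChar x ξ) ξ := fun ξ => by
      rw [map_mul, conj_latChar, neg_neg]
      by_cases hξ : ξ ∈ D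
      · rw [indicator_of_mem hξ, indicator_of_mem hξ]
        simp only [map_inv₀, Complex.conj_ofReal]; ring
      · rw [indicator_of_notMem hξ, indicator_of_notMem hξ, zero_mul, mul_zero]
    simp only [h']
    rw [integral_const_mul, integral_indicator hD, hνD, norm_mul, mul_pow, ← hcc]
    simp [abs_of_pos hc0, pow_two]
  rw [hnorm] at hb
  simp only [hterm] at hb
  rw [← Finset.mul_sum, inv_mul_le_iff₀ hpi] at hb
  exact hb

/-- A Fejér-type lower bound for the sup-norm of a summable function by its Fourier transform. -/
theorem norm_integral_hatFn_sub_le {ψ : Zd d → ℂ} (hψ : Summable fun x => ‖ψ x‖) {M : ℝ}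
    (hM : ∀ x, ‖ψ x‖ ≤ M) {D : Set (Rd d)} (hD : MeasurableSet D)
    (hD0 : D ⊆ torusBox 0) {g : Rd d → ℂ} (hg : Continuous g) (hg1 : ∀ ξ, ‖g ξ‖ = 1) (ξ₀ : Rd d) :
    ‖∫ p : Rd d × Rd d, hatFn ψ (ξ₀ + (p.1 - p.2)) * (g p.1 * (starRingEnd ℂ) (g p.2))
      ∂((volume.restrict D).prod (volume.restrict D))‖ ≤ M * ((2 * Real.pi) ^ d * volume.real D) := by
  have hfin : IsFiniteMeasure (volume.restrict D) :=
    isFiniteMeasure_restrict.2 ((measure_mono hD0).trans_lt (measure_torusBox_lt_top 0)).ne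
  set c : Zd d → ℂ := fun x => ∫ ξ in D, g ξ * latChar x ξ with hc
  -- Evaluating at the difference `p.1 - p.2` splits each character into a product with a conjugate,
  -- so that the integral of `T x` is `ψ(x)` times a unimodular factor times `|c x|²`. Absolute
  -- values then lose nothing beyond `|ψ| ≤ M`.
  set T : Zd d → Rd d × Rd d → ℂ := fun x p => (ψ x * latChar x ξ₀) *
    ((g p.1 * latChar x p.1) * (starRingEnd ℂ) (g p.2 * latChar x p.2)) with hT
  have hTc : ∀ x, Continuous (T x) := fun x => by
    have h1 : Continuous fun p : Rd d × Rd d => g p.1 * latChar x p.1 :=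
      (hg.comp continuous_fst).mul ((continuous_latChar x).comp continuous_fst)
    have h2 : Continuous fun p : Rd d × Rd d => g p.2 * latChar x p.2 :=
      (hg.comp continuous_snd).mul ((continuous_latChar x).comp continuous_snd)
    exact continuous_const.mul (h1.mul (Complex.continuous_conj.comp h2))
  have hTn : ∀ x p, ‖T x p‖ = ‖ψ x‖ := fun x p => by
    simp [hT, hg1]
  have hterm : ∀ x, Integrable (T x) ((volume.restrict D).prod (volume.restrict D)) := fun x =>
    Integrable.of_bound (hTc x).aestronglyMeasurable ‖ψ x‖
      (Filter.Eventually.of_forall fun p => (hTn x p).le)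
  have h := hasSum_integral_of_summable_integral_norm hterm (by
    simp only [hTn, integral_const, smul_eq_mul]
    exact hψ.mul_left _)
  have hI : ∀ x, ∫ p, T x p ∂((volume.restrict D).prod (volume.restrict D)) =
      (ψ x * latChar x ξ₀) * (c x * (starRingEnd ℂ) (c x)) := fun x => by
    simp only [hT]
    rw [integral_const_mul, integral_prod_mul (fun u => g u * latChar x u)
      (fun v => (starRingEnd ℂ) (g v * latChar x v)), integral_conj]
  have hsum : ∀ p : Rd d × Rd d, hatFn ψ (ξ₀ + (p.1 - p.2)) * (g p.1 * (starRingEnd ℂ) (g p.2)) =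
      ∑' x, T x p := fun p => by
    rw [hatFn_eq, ← tsum_mul_right]
    congr 1
    funext x
    rw [latChar_add_right, sub_eq_add_neg, latChar_add_right, latChar_neg_right]
    simp only [hT, map_mul]
    ring
  simp only [hsum]
  rw [← h.tsum_eq]
  have hM0 : 0 ≤ M := (norm_nonneg _).trans (hM 0)
  have hn : ∀ x, ‖∫ p, T x p ∂((volume.restrict D).prod (volume.restrict D))‖ ≤
      M * ‖c x‖ ^ 2 := fun x => by
    rw [hI, norm_mul, norm_mul, norm_latChar, mul_one, norm_mul, RCLike.norm_conj, ← pow_two]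
    exact mul_le_mul_of_nonneg_right (hM x) (by positivity)
  have hs : ∀ s : Finset (Zd d),
      ∑ x ∈ s, ‖∫ p, T x p ∂((volume.restrict D).prod (volume.restrict D))‖ ≤
        M * ((2 * Real.pi) ^ d * volume.real D) := fun s => by
    refine (Finset.sum_le_sum fun x _ => hn x).trans ?_
    rw [← Finset.mul_sum]
    exact mul_le_mul_of_nonneg_left (sum_norm_sq_integral_mul_latChar_le hD hD0 hg hg1 s) hM0
  have hsummable := summable_of_sum_le (fun _ => norm_nonneg _) hs
  exact (norm_tsum_le_tsum_norm hsummable).trans (hsummable.tsum_le_of_sum_le hs)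

end Fourier

/-! ### The expansion at an imaginary point and the lower bound. -/

section Expansion

open MeasureTheory Set

variable {d : ℕ}

/-- The linear form `ξ ↦ α·ξ` in coordinates. -/
noncomputable def linForm (α ξ : Rd d) : ℝ := ∑ i, α i * ξ i

theorem linForm_sub (α ξ η : Rd d) : linForm α (ξ - η) = linForm α ξ - linForm α η := by
  simp [linForm, mul_sub]

theorem continuous_linForm (α : Rd d) : Continuous (linForm α) := by
  unfold linForm; fun_prop

theorem continuous_polyFn (p : MvPolynomial (Fin d) ℝ) : Continuous (polyFn p) := by
  unfold polyFn
  exact (MvPolynomial.continuous_eval p).comp (by fun_prop)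

theorem polyFn_zero {p : MvPolynomial (Fin d) ℝ} (hp : NoConstNoLinear p) :
    polyFn p (0 : Rd d) = 0 := by
  have : (fun i => (0 : Rd d) i) = (0 : Fin d → ℝ) := rfl
  rw [polyFn, this, MvPolynomial.eval_zero]
  exact hp.1

/-- A continuous function whose absolute value is homogeneous is homogeneous. -/
theorem mem_expSet_of_abs {f : Rd d → ℝ} (hf : Continuous f) {E : Rd d →L[ℝ] Rd d}
    (hE : E ∈ ExpSet fun ξ => |f ξ|) : E ∈ ExpSet f := by
  intro t ht ξ
  have hE' : ∀ s : ℝ, 0 < s → |f (tpow s E ξ)| = s * |f ξ| := fun s hs => hE s hs ξ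
  by_cases h0 : f ξ = 0
  · have := hE' t ht
    rw [h0, abs_zero, mul_zero, abs_eq_zero] at this
    rw [this, h0, mul_zero]
  have hc : ContinuousOn (fun s => f (tpow s E ξ)) (Ioi 0) :=
    hf.comp_continuousOn ((continuousOn_tpow E).clm_apply continuousOn_const)
  have hsq : EqOn ((fun s => f (tpow s E ξ)) ^ 2) ((fun s => s * f ξ) ^ 2) (Ioi 0) := by
    intro s hs
    have hs' : (0 : ℝ) < s := hs
    change f (tpow s E ξ) ^ 2 = (s * f ξ) ^ 2
    rw [← sq_abs, hE' s hs, ← sq_abs (s * f ξ), abs_mul, abs_of_pos hs']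
  have h1 : (1 : ℝ) ∈ Ioi (0 : ℝ) := mem_Ioi.2 one_pos
  -- On the connected half-line, continuous functions with equal squares, one of them nonvanishing,
  -- agree up to one global sign; `s = 1` excludes the minus sign.
  rcases isPreconnected_Ioi.eq_or_eq_neg_of_sq_eq hc (by fun_prop) hsq
    (fun {s} hs => mul_ne_zero (ne_of_gt hs) h0) with h | h
  · exact h ht
  · have := h h1
    simp only [tpow_one, one_mul, Pi.neg_apply] at this
    change f ξ = - f ξ at this
    exact absurd (by linarith) h0

theorem GammaExpansion.hatFn_eq_exp {φ : Zd d → ℂ} {ξ₀ : Rd d} (X : GammaExpansion φ ξ₀)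
    (h0 : ‖hatFn φ ξ₀‖ = 1) {ξ : Rd d} (hξ : ξ ∈ X.U) :
    hatFn φ (ξ + ξ₀) = hatFn φ ξ₀ * Complex.exp (Complex.I * (linForm X.α ξ : ℝ) -
      (Complex.I * ((polyFn X.Q ξ + X.Qt ξ : ℝ) : ℂ) + ((polyFn X.R ξ + X.Rt ξ : ℝ) : ℂ))) := by
  have hne : hatFn φ ξ₀ ≠ 0 := fun h => by rw [h, norm_zero] at h0; exact zero_ne_one h0
  have h := X.expansion ξ hξ
  rw [sub_sub] at h
  change GammaFn φ ξ₀ ξ = Complex.I * (linForm X.α ξ : ℝ) - _ at h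
  rw [← h, GammaFn, Complex.exp_log (Complex.slitPlane_ne_zero (X.mem_slitPlane ξ hξ)),
    mul_div_cancel₀ _ hne]

theorem half_le_re_exp {x y : ℝ} (hx : |x| ≤ 1 / 4) (hy : |y| ≤ 1 / 4) :
    1 / 2 ≤ (Complex.exp (-(Complex.I * x + y))).re := by
  rw [Complex.exp_re]
  have h1 : (-(Complex.I * (x : ℂ) + y)).re = -y := by simp
  have h2 : (-(Complex.I * (x : ℂ) + y)).im = -x := by simp
  rw [h1, h2, Real.cos_neg]
  have hx2 : x ^ 2 ≤ 1 / 16 := by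
    rw [← sq_abs]; nlinarith [abs_nonneg x]
  have e1 : 3 / 4 ≤ Real.exp (-y) := by
    have := Real.add_one_le_exp (-y)
    have := le_abs_self y
    linarith
  have e2 : 3 / 4 ≤ Real.cos x := by
    have := Real.one_sub_sq_div_two_le_cos (x := x)
    linarith
  nlinarith

theorem exists_ball_subset_of_open {U : Set (Rd d)} (hU : IsOpen U) (h0 : (0 : Rd d) ∈ U) :
    ∃ r : ℝ, 0 < r ∧ ∀ ξ : Rd d, ‖ξ‖ < r → ξ ∈ U := by
  obtain ⟨r, hr, h⟩ := Metric.isOpen_iff.1 hU 0 h0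
  exact ⟨r, hr, fun ξ hξ => h (by simpa using hξ)⟩

theorem mem_torusBox_zero_of_norm_lt {ξ : Rd d} (h : ‖ξ‖ < Real.pi) : ξ ∈ torusBox 0 := fun i => by
  have h1 : |ξ i| ≤ ‖ξ‖ := PiLp.norm_apply_le ξ i
  have := abs_lt.1 (h1.trans_lt h)
  simp only [PiLp.zero_apply, zero_sub, zero_add]
  exact ⟨this.1, this.2.le⟩

/-- Near a point of imaginary homogeneous type the exponent `n (i (Q + Q̃) + R + R̃)` is small at
the scale `n^{-E}`. -/
theorem GammaExpansion.exists_scale_small {φ : Zd d → ℂ} {ξ₀ : Rd d} (X : GammaExpansion φ ξ₀)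
    {E : Rd d →L[ℝ] Rd d} {k : ℝ} (hk : 1 < k) (hE : E ∈ ExpSet X.absQ)
    (hR : k⁻¹ • E ∈ ExpSet (polyFn X.R)) (hQt : IsStronglySubhom X.U X.Qt E 2)
    (hRt : IsStronglySubhom X.U X.Rt (k⁻¹ • E) 1) :
    ∃ ρ : ℝ, 0 < ρ ∧ ∃ τ : ℝ, 0 < τ ∧ ∀ t : ℝ, 0 < t → t < τ →
      (∀ w : Rd d, ‖w‖ < ρ → tpow t E w ∈ torusBox 0) ∧
      ∀ w : Rd d, ‖w‖ < 2 * ρ → tpow t E w ∈ X.U ∧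
        |t⁻¹ * (polyFn X.Q (tpow t E w) + X.Qt (tpow t E w))| ≤ 1 / 4 ∧
        |t⁻¹ * (polyFn X.R (tpow t E w) + X.Rt (tpow t E w))| ≤ 1 / 4 := by
  have hk0 : 0 < k := by linarith
  have hQ : E ∈ ExpSet (polyFn X.Q) := mem_expSet_of_abs (continuous_polyFn _) hE
  obtain ⟨-, -, -, hcE, hQt⟩ := hQt
  obtain ⟨-, -, -, -, hRt⟩ := hRt
  obtain ⟨ρ, hρ, hρ'⟩ : ∃ ρ : ℝ, 0 < ρ ∧ ∀ w : Rd d, ‖w‖ < 2 * ρ → |polyFn X.Q w| < 1 / 8 := by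
    -- The bound `1/8` leaves another `1/8` for `Q̃`. It is arranged on the ball of radius `2ρ`
    -- since it will be applied to differences of points of the `ρ`-ball.
    have : ∀ᶠ w in nhds (0 : Rd d), |polyFn X.Q w| < 1 / 8 := by
      have hc : Continuous fun w => |polyFn X.Q w| := (continuous_polyFn _).abs
      refine (hc.tendsto 0).eventually (gt_mem_nhds ?_)
      rw [polyFn_zero X.Q_low]; norm_num
    obtain ⟨r, hr, h⟩ := Metric.eventually_nhds_iff.1 this
    exact ⟨r / 2, by linarith, fun w hw => h (by simpa using hw.trans_eq (by ring))⟩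
  obtain ⟨r, hr, hrU⟩ := exists_ball_subset_of_open X.isOpen_U X.zero_mem
  have hK : IsCompact (Metric.closedBall (0 : Rd d) (2 * ρ)) := isCompact_closedBall _ _
  obtain ⟨S, hS⟩ := (hK.image (continuous_polyFn X.R)).isBounded.exists_norm_le
  obtain ⟨τ₁, hτ₁, h₁⟩ := hQt (1 / 8) (by norm_num) _ hK
  obtain ⟨τ₂, hτ₂, h₂⟩ := hRt 1 one_pos _ hK
  obtain ⟨τ₃, hτ₃, h₃⟩ := hcE.exists_norm_tpow_lt
    (show 0 < min r Real.pi / (2 * ρ) from div_pos (lt_min hr Real.pi_pos) (by linarith))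
  -- At scale `t` the term `R + R̃` has size `t^k`, so dividing by `t` leaves `t^(k-1)`, which
  -- vanishes in the limit because `k > 1`.
  have hlim : ∀ᶠ t in nhdsWithin (0 : ℝ) (Ioi 0), t ^ k < τ₂ ∧ t ^ (k - 1) * (|S| + 1) < 1 / 4 := by
    have e1 : Filter.Tendsto (fun t : ℝ => t ^ k) (nhdsWithin (0 : ℝ) (Ioi 0)) (nhds 0) := by
      have := (Real.continuousAt_rpow_const 0 k (Or.inr hk0.le)).tendsto
      rw [Real.zero_rpow hk0.ne'] at this
      exact this.mono_left nhdsWithin_le_nhds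
    have e2 : Filter.Tendsto (fun t : ℝ => t ^ (k - 1) * (|S| + 1)) (nhdsWithin (0 : ℝ) (Ioi 0))
        (nhds 0) := by
      have := (Real.continuousAt_rpow_const 0 (k - 1) (Or.inr (by linarith))).tendsto
      rw [Real.zero_rpow (by linarith)] at this
      simpa using (this.mono_left nhdsWithin_le_nhds).mul_const (|S| + 1)
    exact (e1.eventually (gt_mem_nhds hτ₂)).and (e2.eventually (gt_mem_nhds (by norm_num)))
  rw [eventually_nhdsWithin_iff, Metric.eventually_nhds_iff] at hlim
  obtain ⟨τ₄, hτ₄, h₄⟩ := hlim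
  refine ⟨ρ, hρ, min (min τ₁ τ₃) τ₄, lt_min (lt_min hτ₁ hτ₃) hτ₄, fun t ht0 ht => ?_⟩
  have ht1 : t < τ₁ := ht.trans_le ((min_le_left _ _).trans (min_le_left _ _))
  have ht3 : t < τ₃ := ht.trans_le ((min_le_left _ _).trans (min_le_right _ _))
  have ht4 : t < τ₄ := ht.trans_le (min_le_right _ _)
  obtain ⟨h4a, h4b⟩ := h₄ (y := t) (by simpa [abs_of_pos ht0] using ht4) ht0
  have hnorm : ∀ w : Rd d, ‖w‖ < 2 * ρ → ‖tpow t E w‖ < min r Real.pi := fun w hw => by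
    calc ‖tpow t E w‖ ≤ ‖tpow t E‖ * ‖w‖ := ContinuousLinearMap.le_opNorm _ _
      _ ≤ ‖tpow t E‖ * (2 * ρ) := by gcongr
      _ < min r Real.pi / (2 * ρ) * (2 * ρ) := by
        have := h₃ t ht0 ht3
        gcongr
      _ = min r Real.pi := by field_simp
  refine ⟨fun w hw => mem_torusBox_zero_of_norm_lt
    ((hnorm w (by linarith)).trans_le (min_le_right _ _)), fun w hw => ?_⟩
  have hwK : w ∈ Metric.closedBall (0 : Rd d) (2 * ρ) := by simpa using hw.le
  refine ⟨hrU _ ((hnorm w hw).trans_le (min_le_left _ _)), ?_, ?_⟩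
  · have e1 := h₁ 0 (by norm_num) t ht0 ht1 w hwK
    simp only [pow_zero, iteratedDeriv_zero, one_mul] at e1
    rw [hQ t ht0, mul_add, ← mul_assoc, inv_mul_cancel₀ ht0.ne', one_mul]
    have e2 : |t⁻¹ * X.Qt (tpow t E w)| ≤ 1 / 8 := by
      rw [abs_mul, abs_of_pos (inv_pos.2 ht0), inv_mul_le_iff₀ ht0, mul_comm]
      exact e1
    have := hρ' w hw
    exact (abs_add_le _ _).trans (by linarith)
  · have htk : 0 < t ^ k := Real.rpow_pos_of_pos ht0 _
    have e1 := h₂ 0 (by norm_num) (t ^ k) htk h4a w hwK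
    simp only [pow_zero, iteratedDeriv_zero, one_mul] at e1
    rw [tpow_rpow_inv_smul ht0 hk0.ne'] at e1
    have e3 := hR (t ^ k) htk w
    rw [tpow_rpow_inv_smul ht0 hk0.ne'] at e3
    rw [e3, abs_mul, abs_of_pos (inv_pos.2 ht0), inv_mul_le_iff₀ ht0]
    have e4 : |polyFn X.R w| ≤ |S| := (hS _ ⟨w, hwK, rfl⟩).trans (le_abs_self S)
    calc |t ^ k * polyFn X.R w + X.Rt (tpow t E w)|
        ≤ t ^ k * |S| + t ^ k := (abs_add_le _ _).trans (by
          rw [abs_mul, abs_of_pos htk]; gcongr)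
      _ = t * (t ^ (k - 1) * (|S| + 1)) := by rw [Real.rpow_sub_one ht0.ne']; field_simp
      _ ≤ t * (1 / 4) := by gcongr

/-- The Fejér-type inequality is applied with `D = n^{-E}(ball of radius ρ)` and the weight `g =
e^{-inα·ξ}`, which cancels the drift. The integrand divided by `φ̂(ξ₀)^n` then has real part at
least `1/2`, whence `vol(D)²/2 ≤ M (2π)^d vol D`, and `vol D` is `n^{-tr E}` times the volume of the
ball. -/
theorem GammaExpansion.exists_lower_bound {φ : Zd d → ℂ} (hφ : Summable fun x => ‖φ x‖)
    {ξ₀ : Rd d} (h0 : ‖hatFn φ ξ₀‖ = 1) (X : GammaExpansion φ ξ₀)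
    {E : Rd d →L[ℝ] Rd d} {k : ℝ} (hk : 1 < k) (hE : E ∈ ExpSet X.absQ)
    (hR : k⁻¹ • E ∈ ExpSet (polyFn X.R)) (hQt : IsStronglySubhom X.U X.Qt E 2)
    (hRt : IsStronglySubhom X.U X.Rt (k⁻¹ • E) 1) :
    ∃ c : ℝ, 0 < c ∧ ∃ N : ℕ, ∀ n : ℕ, N ≤ n → 1 ≤ n →
      ∀ M : ℝ, (∀ x, ‖convPow φ n x‖ ≤ M) → c * (n : ℝ) ^ (-endTrace E) ≤ M := by
  obtain ⟨ρ, hρ, τ, hτ, h⟩ := X.exists_scale_small hk hE hR hQt hRt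
  set D₀ : Set (Rd d) := Metric.ball 0 ρ with hD₀
  have hD₀pos : 0 < volume.real D₀ := by
    rw [Measure.real, ENNReal.toReal_pos_iff]
    exact ⟨Metric.measure_ball_pos _ _ hρ, measure_ball_lt_top⟩
  have hpi : (0 : ℝ) < (2 * Real.pi) ^ d := by positivity
  obtain ⟨N, hN⟩ := exists_nat_gt τ⁻¹
  refine ⟨volume.real D₀ / (2 * (2 * Real.pi) ^ d), by positivity, N, fun n hn hn1 M hM => ?_⟩
  have hn0 : (0 : ℝ) < n := by exact_mod_cast hn1
  set t : ℝ := (n : ℝ)⁻¹ with ht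
  have ht0 : 0 < t := inv_pos.2 hn0
  have htτ : t < τ := by
    rw [ht, inv_lt_comm₀ hn0 hτ]
    exact hN.trans_le (by exact_mod_cast hn)
  obtain ⟨hbox, hsmall⟩ := h t ht0 htτ
  set D : Set (Rd d) := tpow t E '' D₀ with hD
  have hDm : MeasurableSet D := by
    have : D = tpow t⁻¹ E ⁻¹' D₀ := by
      ext ξ
      constructor
      · rintro ⟨w, hw, rfl⟩
        rwa [mem_preimage, tpow_inv_tpow ht0]
      · intro hξ
        exact ⟨_, hξ, tpow_tpow_inv ht0 E ξ⟩
    rw [this]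
    exact (tpow t⁻¹ E).continuous.measurable Metric.isOpen_ball.measurableSet
  have hD0 : D ⊆ torusBox 0 := by
    rintro _ ⟨w, hw, rfl⟩
    exact hbox w (by simpa [hD₀] using hw)
  have hDvol : volume.real D = (n : ℝ) ^ (-endTrace E) * volume.real D₀ := by
    rw [Measure.real, hD, measure_image_tpow ht0, ENNReal.toReal_mul,
      ENNReal.toReal_ofReal (by positivity), ht, Real.inv_rpow hn0.le, Real.rpow_neg hn0.le]
    rfl
  set g : Rd d → ℂ := fun ξ => Complex.exp (((-(n * linForm X.α ξ) : ℝ) : ℂ) * Complex.I) with hg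
  have hgc : Continuous g := by
    have := continuous_linForm X.α
    fun_prop
  have hg1 : ∀ ξ, ‖g ξ‖ = 1 := fun ξ => Complex.norm_exp_ofReal_mul_I _
  have hψ := summable_norm_convPow hφ n
  have key := norm_integral_hatFn_sub_le hψ hM hDm hD0 hgc hg1 ξ₀
  set f : Rd d × Rd d → ℂ := fun p =>
    hatFn (convPow φ n) (ξ₀ + (p.1 - p.2)) * (g p.1 * (starRingEnd ℂ) (g p.2)) with hf
  have hfin : IsFiniteMeasure (volume.restrict D) :=
    isFiniteMeasure_restrict.2 ((measure_mono hD0).trans_lt (measure_torusBox_lt_top 0)).ne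
  set ν := (volume.restrict D).prod (volume.restrict D) with hν
  set z : ℂ := (hatFn φ ξ₀ ^ n)⁻¹ with hz
  have hz1 : ‖z‖ = 1 := by rw [hz, norm_inv, norm_pow, h0, one_pow, inv_one]
  have hne : hatFn φ ξ₀ ≠ 0 := fun h => by rw [h, norm_zero] at h0; exact zero_ne_one h0
  have hre : ∀ᵐ p ∂ν, 1 / 2 ≤ (z * f p).re := by
    have hmem : ∀ᵐ p ∂ν, p ∈ D ×ˢ D := by
      rw [hν, Measure.prod_restrict]
      exact ae_restrict_mem (hDm.prod hDm)
    filter_upwards [hmem] with p hp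
    obtain ⟨u, hu, hpu⟩ := hp.1
    obtain ⟨v, hv, hpv⟩ := hp.2
    have hw : ‖u - v‖ < 2 * ρ := by
      have hu' : ‖u‖ < ρ := by simpa [hD₀] using hu
      have hv' : ‖v‖ < ρ := by simpa [hD₀] using hv
      linarith [norm_sub_le u v]
    have hpw : p.1 - p.2 = tpow t E (u - v) := by rw [map_sub, hpu, hpv]
    obtain ⟨hU, hs1, hs2⟩ := hsmall _ hw
    have hgg : g p.1 * (starRingEnd ℂ) (g p.2) =
        Complex.exp (-(n * (Complex.I * (linForm X.α (p.1 - p.2) : ℝ)))) := by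
      rw [hg, ← Complex.exp_conj, ← Complex.exp_add, linForm_sub]
      congr 1
      simp only [map_mul, Complex.conj_ofReal, Complex.conj_I]
      push_cast
      ring
    have hfz : z * f p = Complex.exp (-(Complex.I *
        ((t⁻¹ * (polyFn X.Q (tpow t E (u - v)) + X.Qt (tpow t E (u - v))) : ℝ) : ℂ) +
        ((t⁻¹ * (polyFn X.R (tpow t E (u - v)) + X.Rt (tpow t E (u - v))) : ℝ) : ℂ))) := by
      simp only [hf]
      rw [hgg, hatFn_convPow hφ, add_comm ξ₀, hpw, X.hatFn_eq_exp h0 hU, mul_pow, ← Complex.exp_nat_mul,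
        hz, ← mul_assoc, ← mul_assoc, inv_mul_cancel₀ (pow_ne_zero _ hne), one_mul,
        ← Complex.exp_add]
      congr 1
      rw [ht, inv_inv]
      push_cast
      ring
    rw [hfz]
    exact half_le_re_exp hs1 hs2
  have hfc : Continuous f := by
    have h1 : Continuous fun p : Rd d × Rd d => hatFn (convPow φ n) (ξ₀ + (p.1 - p.2)) :=
      (continuous_hatFn hψ).comp (by fun_prop)
    have h2 : Continuous fun p : Rd d × Rd d => (starRingEnd ℂ) (g p.2) :=
      Complex.continuous_conj.comp (hgc.comp continuous_snd)
    exact h1.mul ((hgc.comp continuous_fst).mul h2)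
  have hfi : Integrable (fun p => z * f p) ν := by
    refine Integrable.of_bound (continuous_const.mul hfc).aestronglyMeasurable
      (∑' x, ‖convPow φ n x‖) (Filter.Eventually.of_forall fun p => ?_)
    rw [norm_mul, hz1, one_mul, hf]
    simp only [norm_mul, RCLike.norm_conj, hg1, mul_one]
    exact norm_hatFn_le_tsum hψ _
  have hlow : 1 / 2 * (volume.real D * volume.real D) ≤ ‖∫ p, f p ∂ν‖ := by
    calc 1 / 2 * (volume.real D * volume.real D) = ∫ _, (1 / 2 : ℝ) ∂ν := by
          rw [integral_const, smul_eq_mul, hν, ← univ_prod_univ, measureReal_prod_prod]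
          simp only [measureReal_restrict_apply_univ]
          ring
      _ ≤ ∫ p, (z * f p).re ∂ν := integral_mono_ae (integrable_const _) hfi.re hre
      _ = (∫ p, z * f p ∂ν).re := integral_re hfi
      _ ≤ ‖∫ p, z * f p ∂ν‖ := Complex.re_le_norm _
      _ = ‖∫ p, f p ∂ν‖ := by rw [integral_const_mul, norm_mul, hz1, one_mul]
  have hDpos : 0 < volume.real D := by rw [hDvol]; positivity
  have h3 := hlow.trans key
  have h4 : 1 / 2 * volume.real D ≤ M * (2 * Real.pi) ^ d := by
    refine le_of_mul_le_mul_right ?_ hDpos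
    linarith
  rw [div_mul_eq_mul_div, div_le_iff₀ (by positivity), mul_comm (volume.real D₀), ← hDvol]
  linarith

end Expansion

/-! ### Local contributions to the inversion integral: tools and positive type. -/

section LocalBounds

open MeasureTheory Set

variable {d : ℕ}

theorem linForm_eq_inner (y ξ : Rd d) : linForm y ξ = inner ℝ y ξ := by
  simp [linForm, PiLp.inner_apply, mul_comm]

theorem linForm_add_left (x y ξ : Rd d) : linForm (x + y) ξ = linForm x ξ + linForm y ξ := by
  simp [linForm_eq_inner, inner_add_left]

theorem linForm_smul_left (c : ℝ) (y ξ : Rd d) : linForm (c • y) ξ = c * linForm y ξ := by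
  simp [linForm_eq_inner, inner_smul_left]

theorem latChar_neg_eq (x : Zd d) (ξ : Rd d) :
    latChar (-x) ξ = Complex.exp (-(Complex.I * (linForm (latticePt x) ξ : ℝ))) := by
  rw [latChar, linForm]
  congr 1
  simp [latticePt]

theorem abs_linForm_le (y ξ : Rd d) : |linForm y ξ| ≤ ‖y‖ * ‖ξ‖ := by
  rw [linForm_eq_inner]; exact abs_real_inner_le_norm y ξ

theorem HasDerivAt.linForm {f : ℝ → Rd d} {f' : Rd d} {t : ℝ} (hf : HasDerivAt f f' t)
    (y : Rd d) : HasDerivAt (fun s => _root_.linForm y (f s)) (_root_.linForm y f') t := by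
  simp only [linForm_eq_inner]
  simpa using (hasDerivAt_const t y).inner ℝ hf

theorem hasDerivAt_inv_smul_tpow_apply {t : ℝ} (ht : 0 < t) (E : Rd d →L[ℝ] Rd d) (ξ : Rd d) :
    HasDerivAt (fun s : ℝ => s⁻¹ • E (tpow s E ξ))
      (t⁻¹ • E (t⁻¹ • E (tpow t E ξ)) + (-(t ^ 2)⁻¹) • E (tpow t E ξ)) t :=
  (hasDerivAt_inv ht.ne').smul (E.hasFDerivAt.comp_hasDerivAt t (hasDerivAt_tpow_apply ht E ξ))

theorem IsContracting.exists_forall_norm_tpow_mem {E : Rd d →L[ℝ] Rd d} (hE : IsContracting E)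
    {U : Set (Rd d)} (hU : IsOpen U) (h0 : (0 : Rd d) ∈ U) {K : Set (Rd d)} (hK : IsCompact K) :
    ∃ τ : ℝ, 0 < τ ∧ ∀ t, 0 < t → t < τ → ∀ ξ ∈ K, tpow t E ξ ∈ U := by
  obtain ⟨r, hr, hrU⟩ := exists_ball_subset_of_open hU h0
  obtain ⟨m, hm⟩ := hK.isBounded.exists_norm_le
  obtain ⟨τ, hτ, h⟩ := hE.exists_norm_tpow_lt (div_pos hr (by positivity : 0 < |m| + 1))
  refine ⟨τ, hτ, fun t ht0 ht ξ hξ => hrU _ ?_⟩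
  have hξm : ‖ξ‖ ≤ |m| + 1 := (hm ξ hξ).trans ((le_abs_self m).trans (by linarith))
  calc ‖tpow t E ξ‖ ≤ ‖tpow t E‖ * (|m| + 1) :=
        (ContinuousLinearMap.le_opNorm _ _).trans (by gcongr)
    _ < r / (|m| + 1) * (|m| + 1) := mul_lt_mul_of_pos_right (h t ht0 ht) (by positivity)
    _ = r := by field_simp

theorem contDiffAt_comp_tpow {U : Set (Rd d)} {P : Rd d → ℝ} {E : Rd d →L[ℝ] Rd d} {l : ℕ}
    (hU : IsOpen U) (hP : ContDiffOn ℝ l P U) {t : ℝ} (ht : 0 < t) {ξ : Rd d}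
    (hξ : tpow t E ξ ∈ U) : ContDiffAt ℝ l (fun s => P (tpow s E ξ)) t :=
  (hP.contDiffAt (hU.mem_nhds hξ)).comp t (contDiffAt_tpow_apply ht E ξ l)

/-- Contraction places `t^E ξ` inside `U` for small `t`, where smoothness makes the derivative
genuine; without this the bound could concern only the default value `0` of `deriv`. -/
theorem IsStronglySubhom.radial_one {U : Set (Rd d)} {P : Rd d → ℝ} {E : Rd d →L[ℝ] Rd d} {l : ℕ}
    (h : IsStronglySubhom U P E l) (hl : 1 ≤ l) {ε : ℝ} (hε : 0 < ε) {K : Set (Rd d)}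
    (hK : IsCompact K) : ∃ τ : ℝ, 0 < τ ∧ ∀ t, 0 < t → t < τ → ∀ ξ ∈ K,
      |P (tpow t E ξ)| ≤ ε * t ∧
      HasDerivAt (fun s => P (tpow s E ξ)) (deriv (fun s => P (tpow s E ξ)) t) t ∧
      |deriv (fun s => P (tpow s E ξ)) t| ≤ ε := by
  obtain ⟨hU, h0, hP, hE, h⟩ := h
  obtain ⟨τ₁, hτ₁, h₁⟩ := hE.exists_forall_norm_tpow_mem hU h0 hK
  obtain ⟨τ₂, hτ₂, h₂⟩ := h ε hε K hK
  refine ⟨min τ₁ τ₂, lt_min hτ₁ hτ₂, fun t ht0 ht ξ hξ => ⟨?_, ?_, ?_⟩⟩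
  · simpa using h₂ 0 (by omega) t ht0 (ht.trans_le (min_le_right _ _)) ξ hξ
  · have := contDiffAt_comp_tpow hU hP ht0 (h₁ t ht0 (ht.trans_le (min_le_left _ _)) ξ hξ)
    exact (this.differentiableAt (by exact_mod_cast (by omega : l ≠ 0))).hasDerivAt
  · have := h₂ 1 hl t ht0 (ht.trans_le (min_le_right _ _)) ξ hξ
    rw [pow_one, iteratedDeriv_one, abs_mul, abs_of_pos ht0, mul_comm] at this
    exact le_of_mul_le_mul_right this ht0

theorem IsStronglySubhom.radial_two {U : Set (Rd d)} {P : Rd d → ℝ} {E : Rd d →L[ℝ] Rd d}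
    (h : IsStronglySubhom U P E 2) {ε : ℝ} (hε : 0 < ε) {K : Set (Rd d)}
    (hK : IsCompact K) : ∃ τ : ℝ, 0 < τ ∧ ∀ t, 0 < t → t < τ → ∀ ξ ∈ K,
      HasDerivAt (deriv (fun s => P (tpow s E ξ))) (deriv (deriv (fun s => P (tpow s E ξ))) t) t ∧
      |deriv (deriv (fun s => P (tpow s E ξ))) t| ≤ ε / t := by
  obtain ⟨hU, h0, hP, hE, h⟩ := h
  obtain ⟨τ₁, hτ₁, h₁⟩ := hE.exists_forall_norm_tpow_mem hU h0 hK
  obtain ⟨τ₂, hτ₂, h₂⟩ := h ε hε K hK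
  refine ⟨min τ₁ τ₂, lt_min hτ₁ hτ₂, fun t ht0 ht ξ hξ => ⟨?_, ?_⟩⟩
  · have := contDiffAt_comp_tpow hU hP ht0 (h₁ t ht0 (ht.trans_le (min_le_left _ _)) ξ hξ)
    have h2 : DifferentiableAt ℝ (fderiv ℝ fun s => P (tpow s E ξ)) t :=
      (this.fderiv_right (m := 1) (by norm_num)).differentiableAt one_ne_zero
    have h3 : DifferentiableAt ℝ (deriv fun s => P (tpow s E ξ)) t :=
      h2.clm_apply (differentiableAt_const 1)
    exact h3.hasDerivAt
  · have := h₂ 2 le_rfl t ht0 (ht.trans_le (min_le_right _ _)) ξ hξ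
    rw [iteratedDeriv_succ, iteratedDeriv_one, abs_mul, abs_of_pos (pow_pos ht0 2)] at this
    rw [le_div_iff₀ ht0]
    refine le_of_mul_le_mul_right ?_ ht0
    linarith [this, (by ring : |deriv (deriv fun s => P (tpow s E ξ)) t| * t * t =
      t ^ 2 * |deriv (deriv fun s => P (tpow s E ξ)) t|)]

/-- `‖t^E‖ / (n t) → 0` uniformly in `1/n ≤ t < τ`. -/
theorem IsContracting.exists_norm_tpow_le_mul {E : Rd d →L[ℝ] Rd d} (hE : IsContracting E)
    (τ : ℝ) {ε : ℝ} (hε : 0 < ε) : ∃ N : ℕ, ∀ n : ℕ, N ≤ n → 1 ≤ n → ∀ t : ℝ, (n : ℝ)⁻¹ ≤ t → t < τ →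
      ‖tpow t E‖ ≤ ε * (n * t) := by
  obtain ⟨τ', hτ', h⟩ := hE.exists_norm_tpow_lt hε
  obtain ⟨B, hB, hB'⟩ := hE.exists_norm_tpow_le τ
  obtain ⟨N, hN⟩ := exists_nat_gt (B / (ε * τ'))
  refine ⟨N, fun n hn hn1 t hnt ht => ?_⟩
  have hn0 : (0 : ℝ) < n := by exact_mod_cast hn1
  have ht0 : 0 < t := (inv_pos.2 hn0).trans_le hnt
  -- For small `t` the norm is below `ε` and `n t ≥ 1`; otherwise the norm is merely bounded, but `n
  -- t ≥ N τ'` is large.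
  rcases lt_or_ge t τ' with h1 | h1
  · have : 1 ≤ n * t := by rwa [inv_le_iff_one_le_mul₀' hn0] at hnt
    exact (h t ht0 h1).le.trans (le_mul_of_one_le_right hε.le this)
  · refine (hB' t ht0 ht.le).trans ?_
    have h2 : B < N * (ε * τ') := by rwa [div_lt_iff₀ (by positivity)] at hN
    have h3 : (N : ℝ) ≤ n := by exact_mod_cast hn
    calc B ≤ N * (ε * τ') := h2.le
      _ ≤ n * (ε * t) := by gcongr
      _ = ε * (n * t) := by ring

/-- Around `ξ₀` there are arbitrarily small neighborhoods which contribute `O(n^{-μ})` to the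
inversion integral of `φ^{(n)}(x)`, for `x` in bounded neighborhoods of `n α` and large `n`. -/
def HasLocalBound (φ : Zd d → ℂ) (α : Rd d) (μ : ℝ) (ξ₀ : Rd d) : Prop :=
  ∀ r : ℝ, 0 < r → ∃ V : Set (Rd d), IsOpen V ∧ (0 : Rd d) ∈ V ∧ (∀ ξ ∈ V, ‖ξ‖ < r) ∧
    (∀ ξ ∈ V, ξ ≠ 0 → ‖hatFn φ (ξ + ξ₀)‖ < 1) ∧
    ∃ C : ℝ, ∀ s : ℝ, ∃ N : ℕ, ∀ n : ℕ, N ≤ n → 1 ≤ n → ∀ x : Zd d,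
      ‖latticePt x - (n : ℝ) • α‖ ≤ s →
      ‖∫ ξ in V, hatFn φ (ξ + ξ₀) ^ n * latChar (-x) ξ‖ ≤ C * (n : ℝ) ^ (-μ)

theorem norm_hatFn_le_one {φ : Zd d → ℂ} (hφ : Summable fun x => ‖φ x‖)
    (hsup : (⨆ ξ : Rd d, ‖hatFn φ ξ‖) = 1) (ξ : Rd d) : ‖hatFn φ ξ‖ ≤ 1 :=
  hsup ▸ le_ciSup (bddAbove_norm_hatFn hφ) ξ

theorem continuous_hatFn_pow_mul_latChar {φ : Zd d → ℂ} (hφ : Summable fun x => ‖φ x‖)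
    (ξ₀ : Rd d) (n : ℕ) (x : Zd d) :
    Continuous fun ξ => hatFn φ (ξ + ξ₀) ^ n * latChar (-x) ξ :=
  (((continuous_hatFn hφ).comp (by fun_prop)).pow n).mul (continuous_latChar _)

theorem norm_hatFn_pow_mul_latChar_le {φ : Zd d → ℂ} (hφ : Summable fun x => ‖φ x‖)
    (hsup : (⨆ ξ : Rd d, ‖hatFn φ ξ‖) = 1) (ξ₀ : Rd d) (n : ℕ) (x : Zd d) (ξ : Rd d) :
    ‖hatFn φ (ξ + ξ₀) ^ n * latChar (-x) ξ‖ ≤ 1 := by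
  rw [norm_mul, norm_latChar, mul_one, norm_pow]
  exact pow_le_one₀ (norm_nonneg _) (norm_hatFn_le_one hφ hsup _)

/-- Polar coordinates on `{P < δ}` for the integrand of the inversion formula. -/
theorem norm_setIntegral_le_of_radial (hd : 1 ≤ d) {φ : Zd d → ℂ} (hφ : Summable fun x => ‖φ x‖)
    (hsup : (⨆ ξ : Rd d, ‖hatFn φ ξ‖) = 1) {P : Rd d → ℝ} {E : Rd d →L[ℝ] Rd d}
    (hP : IsPosHomFn P) (hE : E ∈ ExpSet P) (hc : IsContracting E) (ξ₀ : Rd d) (n : ℕ) (x : Zd d)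
    (δ : ℝ) {C : ℝ}
    (h : ∀ ξ ∈ annulus P, ‖∫ t in Ioo 0 (δ / P ξ), t ^ (endTrace E - 1) •
      (hatFn φ (tpow t E ξ + ξ₀) ^ n * latChar (-x) (tpow t E ξ))‖ ≤ C) :
    ‖∫ ξ in {ξ | P ξ < δ}, hatFn φ (ξ + ξ₀) ^ n * latChar (-x) ξ‖ ≤
      C * volume.real (annulus P) := by
  set V : Set (Rd d) := {ξ | P ξ < δ} with hV
  have hVm : MeasurableSet V := measurableSet_lt hP.continuous.measurable measurable_const
  set f : Rd d → ℂ := fun ξ => hatFn φ (ξ + ξ₀) ^ n * latChar (-x) ξ with hf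
  have hfc : Continuous f := continuous_hatFn_pow_mul_latChar hφ ξ₀ n x
  have hfin : IsFiniteMeasure (volume.restrict V) :=
    isFiniteMeasure_restrict.2 (hP.measure_lt_top hE hc δ).ne
  have hfi : Integrable (V.indicator f) := by
    rw [integrable_indicator_iff hVm]
    exact Integrable.of_bound hfc.aestronglyMeasurable 1
      (Filter.Eventually.of_forall (norm_hatFn_pow_mul_latChar_le hφ hsup ξ₀ n x))
  rw [← integral_indicator hVm]
  refine norm_integral_le_of_norm_radial_le hd hP hE hc (hfc.stronglyMeasurable.indicator hVm) hfi
    fun ξ hξ => ?_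
  have hPξ : 0 < P ξ := one_pos.trans_le hξ.1
  refine le_of_eq_of_le ?_ (h ξ hξ)
  congr 1
  have hsub : Ioo 0 (δ / P ξ) ⊆ Ioi (0 : ℝ) := fun t ht => ht.1
  rw [← inter_eq_right.2 hsub, ← setIntegral_indicator measurableSet_Ioo]
  refine setIntegral_congr_fun measurableSet_Ioi fun t ht => ?_
  have ht0 : (0 : ℝ) < t := ht
  have hmem : tpow t E ξ ∈ V ↔ t ∈ Ioo 0 (δ / P ξ) := by
    rw [hV, Set.mem_ofPred_eq, hE t ht0, mem_Ioo, lt_div_iff₀ hPξ]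
    simp [ht0]
  by_cases hm : t ∈ Ioo 0 (δ / P ξ)
  · simp only [indicator_of_mem hm, indicator_of_mem (hmem.2 hm), hf]
  · simp only [indicator_of_notMem hm, indicator_of_notMem (fun h' => hm (hmem.1 h')), smul_zero]

theorem GammaExpansion.norm_hatFn_add {φ : Zd d → ℂ} {ξ₀ : Rd d} (X : GammaExpansion φ ξ₀)
    (h0 : ‖hatFn φ ξ₀‖ = 1) {ξ : Rd d} (hξ : ξ ∈ X.U) :
    ‖hatFn φ (ξ + ξ₀)‖ = Real.exp (-(polyFn X.R ξ + X.Rt ξ)) := by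
  rw [X.hatFn_eq_exp h0 hξ, norm_mul, h0, one_mul, Complex.norm_exp]
  congr 1
  simp

/-- On the annulus `R ≥ 1`, and `|R̃| ≤ t/2` for small `t`, so `|φ̂| ≤ e^{-t/2}` along each curve.
The radial integral is at most `∫ t^(μ-1) e^{-nt/2} dt`, of order `n^{-μ}` with `μ = tr E`. Only
moduli enter, so `x` and the drift play no role. -/
theorem GammaExpansion.IsPositive.hasLocalBound (hd : 1 ≤ d) {φ : Zd d → ℂ}
    (hφ : Summable fun x => ‖φ x‖) (hsup : (⨆ ξ : Rd d, ‖hatFn φ ξ‖) = 1) {ξ₀ : Rd d}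
    (h0 : ‖hatFn φ ξ₀‖ = 1) {X : GammaExpansion φ ξ₀} (hX : X.IsPositive) {μ : ℝ}
    (hμ : μ ≤ homOrder (polyFn X.R)) (α : Rd d) : HasLocalBound φ α μ ξ₀ := by
  intro r hr
  obtain ⟨hP, E, hE, -, ⟨-, -, -, hc, hRt⟩, -⟩ := hX
  rw [hP.homOrder_eq hE hc] at hμ
  have hK := hP.isCompact_closed_annulus hE hc
  obtain ⟨τ₁, hτ₁, h₁⟩ := hRt (1 / 2) (by norm_num) _ hK
  obtain ⟨τ₂, hτ₂, h₂⟩ := hc.exists_forall_norm_tpow_mem X.isOpen_U X.zero_mem hK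
  obtain ⟨τ₃, hτ₃, h₃⟩ := hP.exists_forall_lt_norm_lt hE hc hr
  set δ : ℝ := min (min τ₁ τ₂) τ₃ with hδ
  have hδ0 : 0 < δ := lt_min (lt_min hτ₁ hτ₂) hτ₃
  have key : ∀ σ, 1 ≤ polyFn X.R σ → polyFn X.R σ ≤ Real.exp 1 → ∀ t, 0 < t → t < δ →
      ‖hatFn φ (tpow t E σ + ξ₀)‖ ≤ Real.exp (-(t / 2)) := fun σ hσ hσ' t ht0 ht => by
    have ht1 : t < τ₁ := ht.trans_le ((min_le_left _ _).trans (min_le_left _ _))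
    have ht2 : t < τ₂ := ht.trans_le ((min_le_left _ _).trans (min_le_right _ _))
    rw [X.norm_hatFn_add h0 (h₂ t ht0 ht2 σ ⟨hσ, hσ'⟩), Real.exp_le_exp, hE t ht0]
    have e1 := (abs_le.1 (h₁ t ht0 ht1 σ ⟨hσ, hσ'⟩)).1
    nlinarith
  refine ⟨{ξ | polyFn X.R ξ < δ}, isOpen_lt hP.continuous continuous_const, ?_,
    fun ξ hξ => h₃ ξ (lt_of_lt_of_le hξ (min_le_right _ _)), fun ξ hξ hne => ?_,
    2 ^ endTrace E * Real.Gamma (endTrace E) * volume.real (annulus (polyFn X.R)),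
    fun s => ⟨0, fun n _ hn1 x _ => ?_⟩⟩
  · rw [Set.mem_ofPred_eq, ExpSet.apply_zero hE]; exact hδ0
  · have hp := hP.pos hne
    have h := key _ (hP.level_tpow_inv hE hne).ge
      ((hP.level_tpow_inv hE hne).le.trans (Real.one_le_exp zero_le_one)) _ hp hξ
    rw [tpow_tpow_inv hp] at h
    refine h.trans_lt ?_
    rw [Real.exp_lt_one_iff]; linarith
  · have hn0 : (0 : ℝ) < n := by exact_mod_cast hn1
    have hμ0 := hc.endTrace_pos hd
    have hG : 0 < Real.Gamma (endTrace E) := Real.Gamma_pos_of_pos hμ0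
    have hle : (n : ℝ) ^ (-endTrace E) ≤ (n : ℝ) ^ (-μ) :=
      Real.rpow_le_rpow_of_exponent_le (by exact_mod_cast hn1) (by linarith)
    refine (norm_setIntegral_le_of_radial hd hφ hsup hP hE hc ξ₀ n x δ
      (C := 2 ^ endTrace E * Real.Gamma (endTrace E) * (n : ℝ) ^ (-μ)) fun ξ hξ => ?_).trans_eq
        (by ring)
    have hPξ : 0 < polyFn X.R ξ := one_pos.trans_le hξ.1
    have hval := Real.integral_rpow_mul_exp_neg_mul_Ioi hμ0 (r := (n : ℝ) / 2) (by positivity)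
    have hint : IntegrableOn (fun t : ℝ => t ^ (endTrace E - 1) * Real.exp (-((n : ℝ) / 2 * t)))
        (Ioi 0) := by
      refine Integrable.of_integral_ne_zero ?_
      rw [hval]; positivity
    calc _ ≤ ∫ t in Ioo 0 (δ / polyFn X.R ξ),
          t ^ (endTrace E - 1) * Real.exp (-((n : ℝ) / 2 * t)) := by
          refine norm_integral_le_of_norm_le (hint.mono_set fun t ht => ht.1) ?_
          filter_upwards [ae_restrict_mem measurableSet_Ioo] with t ht
          have ht0 : 0 < t := ht.1
          rw [norm_smul, norm_mul, norm_latChar, mul_one, norm_pow,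
            Real.norm_of_nonneg (by positivity)]
          have hk := key ξ hξ.1 hξ.2.le t ht0 (ht.2.trans_le (div_le_self hδ0.le hξ.1))
          have : Real.exp (-((n : ℝ) / 2 * t)) = Real.exp (-(t / 2)) ^ n := by
            rw [← Real.exp_nat_mul]; congr 1; ring
          rw [this]
          gcongr
      _ ≤ ∫ t in Ioi 0, t ^ (endTrace E - 1) * Real.exp (-((n : ℝ) / 2 * t)) := by
          refine setIntegral_mono_set hint ?_
            (show Ioo 0 (δ / polyFn X.R ξ) ⊆ Ioi 0 from fun t ht => ht.1).eventuallyLE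
          filter_upwards [ae_restrict_mem measurableSet_Ioi] with t ht
          have ht0 : (0 : ℝ) < t := ht
          simp only [Pi.zero_apply]
          positivity
      _ = 2 ^ endTrace E * Real.Gamma (endTrace E) * (n : ℝ) ^ (-endTrace E) := by
          rw [hval, one_div_div, Real.div_rpow zero_le_two hn0.le, Real.rpow_neg hn0.le]
          ring
      _ ≤ _ := by gcongr

end LocalBounds

/-! ### The local bound at a point of imaginary type. -/

section ImaginaryType

open MeasureTheory Set

variable {d : ℕ}

/-- The first two derivatives of a linear form along the curve `t ↦ t^E ξ`, with bounds. -/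
theorem hasDerivAt_linForm_tpow {t : ℝ} (ht : 0 < t) (E : Rd d →L[ℝ] Rd d) (y ξ : Rd d) :
    HasDerivAt (fun s => linForm y (tpow s E ξ)) (linForm y (t⁻¹ • E (tpow t E ξ))) t ∧
    HasDerivAt (fun s : ℝ => linForm y (s⁻¹ • E (tpow s E ξ)))
      (linForm y (t⁻¹ • E (t⁻¹ • E (tpow t E ξ)) + (-(t ^ 2)⁻¹) • E (tpow t E ξ))) t ∧
    |linForm y (t⁻¹ • E (tpow t E ξ))| ≤ ‖y‖ * ‖E‖ * ‖ξ‖ * ‖tpow t E‖ / t ∧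
    |linForm y (t⁻¹ • E (t⁻¹ • E (tpow t E ξ)) + (-(t ^ 2)⁻¹) • E (tpow t E ξ))| ≤
      ‖y‖ * (‖E‖ ^ 2 + ‖E‖) * ‖ξ‖ * ‖tpow t E‖ / t ^ 2 := by
  have e1 : ‖E (tpow t E ξ)‖ ≤ ‖E‖ * (‖tpow t E‖ * ‖ξ‖) :=
    (E.le_opNorm _).trans (by gcongr; exact ContinuousLinearMap.le_opNorm _ _)
  have e2 : ‖E (E (tpow t E ξ))‖ ≤ ‖E‖ * (‖E‖ * (‖tpow t E‖ * ‖ξ‖)) :=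
    (E.le_opNorm _).trans (by gcongr)
  refine ⟨(hasDerivAt_tpow_apply ht E ξ).linForm y,
    (hasDerivAt_inv_smul_tpow_apply ht E ξ).linForm y, ?_, ?_⟩
  · refine (abs_linForm_le _ _).trans ?_
    rw [norm_smul, Real.norm_of_nonneg (inv_nonneg.2 ht.le)]
    calc ‖y‖ * (t⁻¹ * ‖E (tpow t E ξ)‖) ≤ ‖y‖ * (t⁻¹ * (‖E‖ * (‖tpow t E‖ * ‖ξ‖))) := by gcongr
      _ = _ := by field_simp
  · refine (abs_linForm_le _ _).trans ?_
    have h3 : ‖t⁻¹ • E (t⁻¹ • E (tpow t E ξ)) + (-(t ^ 2)⁻¹) • E (tpow t E ξ)‖ ≤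
        t⁻¹ * (t⁻¹ * (‖E‖ * (‖E‖ * (‖tpow t E‖ * ‖ξ‖)))) +
          (t ^ 2)⁻¹ * (‖E‖ * (‖tpow t E‖ * ‖ξ‖)) := by
      refine (norm_add_le _ _).trans ?_
      rw [map_smul, norm_smul, norm_smul, norm_smul, norm_neg,
        Real.norm_of_nonneg (inv_nonneg.2 ht.le), Real.norm_of_nonneg (by positivity)]
      gcongr
    calc _ ≤ ‖y‖ * (t⁻¹ * (t⁻¹ * (‖E‖ * (‖E‖ * (‖tpow t E‖ * ‖ξ‖)))) +
          (t ^ 2)⁻¹ * (‖E‖ * (‖tpow t E‖ * ‖ξ‖))) := by gcongr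
      _ = _ := by field_simp

/-- With `x = nα + y`, the integrand along a curve is `t^(μ-1) exp(-n(iF + G))`, where `μ = tr E`,
up to a unimodular constant, with `F = t Q(ξ) + Q̃ + (y·t^E ξ)/n` and `G = t^k R(ξ) + R̃`. On the
annulus `|Q| ≥ 1`; the other two terms of `F'` are each at most `1/4` for `1/n ≤ t < τ` and large
`n`, so `|F'| ≥ 1/2`. The oscillatory estimate with `a = 1/n` applies. -/
theorem GammaExpansion.IsImaginary.hasLocalBound (hd : 1 ≤ d) {φ : Zd d → ℂ}
    (hφ : Summable fun x => ‖φ x‖) (hsup : (⨆ ξ : Rd d, ‖hatFn φ ξ‖) = 1) {ξ₀ : Rd d}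
    (h0 : ‖hatFn φ ξ₀‖ = 1) {X : GammaExpansion φ ξ₀} (hX : X.IsImaginary) {μ : ℝ}
    (hμ : μ ≤ homOrder X.absQ) (hlt : homOrder X.absQ < 1) : HasLocalBound φ X.α μ ξ₀ := by
  intro r hr
  obtain ⟨hP, hPR, E, hE, k, hk, hER, hQt, hRt⟩ := hX
  have hc : IsContracting E := hQt.2.2.2.1
  rw [hP.homOrder_eq hE hc] at hμ hlt
  have hμ0 := hc.endTrace_pos hd
  have hk0 : 0 < k := by linarith
  have hQ : E ∈ ExpSet (polyFn X.Q) := mem_expSet_of_abs (continuous_polyFn _) hE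
  set A : Set (Rd d) := {ξ | 1 ≤ X.absQ ξ ∧ X.absQ ξ ≤ Real.exp 1} with hA
  have hK : IsCompact A := hP.isCompact_closed_annulus hE hc
  -- bounds for `R` and for the norm on the annulus
  obtain ⟨m₀, hm₀, hm₀'⟩ : ∃ m₀ : ℝ, 0 < m₀ ∧ ∀ ξ ∈ A, m₀ ≤ polyFn X.R ξ := by
    rcases A.eq_empty_or_nonempty with h | h
    · exact ⟨1, one_pos, fun ξ hξ => by rw [h] at hξ; exact absurd hξ (notMem_empty _)⟩
    · obtain ⟨ξ, hξ, hmin⟩ := hK.exists_isMinOn h hPR.continuous.continuousOn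
      refine ⟨polyFn X.R ξ, hPR.pos fun h => ?_, fun η hη => hmin hη⟩
      have := hξ.1
      rw [h, ExpSet.apply_zero hE] at this
      linarith
  obtain ⟨m₁, hm₁'⟩ := (hK.image hPR.continuous).isBounded.exists_norm_le
  have hm₁ : ∀ ξ ∈ A, polyFn X.R ξ ≤ |m₁| := fun ξ hξ =>
    ((le_abs_self _).trans (hm₁' _ ⟨ξ, hξ, rfl⟩)).trans (le_abs_self _)
  obtain ⟨m₂, hm₂'⟩ := hK.isBounded.exists_norm_le
  have hm₂ : ∀ ξ ∈ A, ‖ξ‖ ≤ |m₂| := fun ξ hξ => (hm₂' ξ hξ).trans (le_abs_self _)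
  obtain ⟨τ₁, hτ₁, h₁⟩ := hQt.radial_one (by norm_num) (show (0 : ℝ) < 1 / 4 by norm_num) hK
  obtain ⟨τ₂, hτ₂, h₂⟩ := hQt.radial_two (show (0 : ℝ) < 1 / 4 by norm_num) hK
  obtain ⟨τ₃, hτ₃, h₃⟩ := hRt.radial_one le_rfl (show (0 : ℝ) < m₀ / 2 by linarith) hK
  obtain ⟨τ₄, hτ₄, h₄⟩ := hc.exists_forall_norm_tpow_mem X.isOpen_U X.zero_mem hK
  obtain ⟨τ₅, hτ₅, h₅⟩ := hP.exists_forall_lt_norm_lt hE hc hr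
  set τ : ℝ := min (min (min τ₁ τ₂) (min τ₃ τ₄)) (min τ₅ 1) with hτ
  have hτ0 : 0 < τ := lt_min (lt_min (lt_min hτ₁ hτ₂) (lt_min hτ₃ hτ₄)) (lt_min hτ₅ one_pos)
  have hττ₁ : τ ≤ τ₁ := (min_le_left _ _).trans ((min_le_left _ _).trans (min_le_left _ _))
  have hττ₂ : τ ≤ τ₂ := (min_le_left _ _).trans ((min_le_left _ _).trans (min_le_right _ _))
  have hττ₃ : τ ≤ τ₃ := (min_le_left _ _).trans ((min_le_right _ _).trans (min_le_left _ _))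
  have hττ₄ : τ ≤ τ₄ := (min_le_left _ _).trans ((min_le_right _ _).trans (min_le_right _ _))
  have hττ₅ : τ ≤ τ₅ := (min_le_right _ _).trans (min_le_left _ _)
  have hτ1 : τ ≤ 1 := (min_le_right _ _).trans (min_le_right _ _)
  set G : Rd d → ℝ → ℝ := fun ξ t => t ^ k * polyFn X.R ξ + X.Rt (tpow t E ξ) with hG
  have hGeq : ∀ ξ t, 0 < t → polyFn X.R (tpow t E ξ) + X.Rt (tpow t E ξ) = G ξ t :=
    fun ξ t ht => by
      have e := hER (t ^ k) (Real.rpow_pos_of_pos ht _) ξ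
      rw [tpow_rpow_inv_smul ht hk0.ne'] at e
      rw [e]
  have htk : ∀ t : ℝ, 0 < t → t < τ → t ^ k < τ₃ := fun t ht0 ht => by
    refine lt_of_le_of_lt ?_ (ht.trans_le hττ₃)
    exact (Real.rpow_le_rpow_of_exponent_ge ht0 (ht.le.trans hτ1) hk.le).trans_eq (Real.rpow_one t)
  -- `R̃` is controlled in the parameter `s = t^k` of the group of `E/k`; the chain rule transfers
  -- this to `t`.
  set rt : Rd d → ℝ → ℝ := fun ξ s => X.Rt (tpow s (k⁻¹ • E) ξ) with hrt
  set G1 : Rd d → ℝ → ℝ := fun ξ t => k * t ^ (k - 1) * polyFn X.R ξ +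
    deriv (rt ξ) (t ^ k) * (k * t ^ (k - 1)) with hG1
  have hGd : ∀ ξ ∈ A, ∀ t ∈ Ioo 0 τ, HasDerivAt (G ξ) (G1 ξ t) t := fun ξ hξ t ht => by
    have hp := Real.hasDerivAt_rpow_const (p := k) (Or.inl ht.1.ne')
    have e1 := (h₃ (t ^ k) (Real.rpow_pos_of_pos ht.1 _) (htk t ht.1 ht.2) ξ hξ).2.1
    have e2 : HasDerivAt (fun s => rt ξ (s ^ k)) (deriv (rt ξ) (t ^ k) * (k * t ^ (k - 1))) t :=
      HasDerivAt.comp (h₂ := rt ξ) t e1 hp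
    refine ((hp.mul_const (polyFn X.R ξ)).add e2).congr_of_eventuallyEq ?_
    filter_upwards [lt_mem_nhds ht.1] with s hs
    simp only [hG, hrt, Pi.add_apply]
    rw [tpow_rpow_inv_smul hs hk0.ne']
  have hGlow : ∀ ξ ∈ A, ∀ t ∈ Ioo 0 τ, m₀ / 2 * t ^ k ≤ G ξ t := fun ξ hξ t ht => by
    have e1 := (h₃ (t ^ k) (Real.rpow_pos_of_pos ht.1 _) (htk t ht.1 ht.2) ξ hξ).1
    rw [tpow_rpow_inv_smul ht.1 hk0.ne'] at e1
    have e2 := (abs_le.1 e1).1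
    have e3 : t ^ k * m₀ ≤ t ^ k * polyFn X.R ξ :=
      mul_le_mul_of_nonneg_left (hm₀' ξ hξ) (Real.rpow_nonneg ht.1.le _)
    simp only [hG]
    linarith
  have hG1b : ∀ ξ ∈ A, ∀ t ∈ Ioo 0 τ, |G1 ξ t| ≤ k * (|m₁| + m₀ / 2) * t ^ (k - 1) :=
    fun ξ hξ t ht => by
      have e1 := (h₃ (t ^ k) (Real.rpow_pos_of_pos ht.1 _) (htk t ht.1 ht.2) ξ hξ).2.2
      have hpos : 0 < k * t ^ (k - 1) := mul_pos hk0 (Real.rpow_pos_of_pos ht.1 _)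
      refine (abs_add_le _ _).trans ?_
      rw [abs_mul (k * t ^ (k - 1)), abs_mul (deriv (rt ξ) (t ^ k)), abs_of_pos hpos, abs_of_nonneg (hPR.nonneg ξ)]
      calc k * t ^ (k - 1) * polyFn X.R ξ + |deriv (rt ξ) (t ^ k)| * (k * t ^ (k - 1))
          ≤ k * t ^ (k - 1) * |m₁| + m₀ / 2 * (k * t ^ (k - 1)) := by
            gcongr
            exact hm₁ ξ hξ
        _ = _ := by ring
  have hannA : annulus X.absQ ⊆ A := fun ξ hξ => ⟨hξ.1, hξ.2.le⟩
  -- Half of `τ`, so that the endpoints `δ/|Q(ξ)|` lie strictly inside the interval where the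
  -- derivative bounds hold.
  set δ : ℝ := τ / 2 with hδ
  have hδ0 : 0 < δ := by positivity
  have hδτ : δ < τ := by rw [hδ]; linarith
  -- The constant of the oscillatory estimate for `c = M = 1/2`, `c' = m₀/2` and `M' = k(|m₁| +
  -- m₀/2)`. It does not involve the radius `s`.
  set C₀ : ℝ := k * (|m₁| + m₀ / 2) / (1 / 2 * (m₀ / 2 * k)) + (1 / (1 / 2) +
    1 / 2 / ((1 / 2) ^ 2 * (1 - endTrace E))) + 2 / (1 / 2) + 1 / endTrace E with hC₀
  have hC₀0 : 0 ≤ C₀ := by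
    have : 0 < 1 - endTrace E := by linarith
    positivity
  refine ⟨{ξ | X.absQ ξ < δ}, isOpen_lt hP.continuous continuous_const, ?_,
    fun ξ hξ => h₅ ξ (lt_of_lt_of_le hξ (hδτ.le.trans hττ₅)), fun ξ hξ hne => ?_,
    C₀ * volume.real (annulus X.absQ), fun s => ?_⟩
  · rw [Set.mem_ofPred_eq, ExpSet.apply_zero hE]; exact hδ0
  · have hp := hP.pos hne
    have hl := hP.level_tpow_inv hE hne
    have hσ : tpow (X.absQ ξ)⁻¹ E ξ ∈ A := ⟨hl.ge, hl.le.trans (Real.one_le_exp zero_le_one)⟩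
    have hpτ : X.absQ ξ < τ := lt_trans hξ hδτ
    have hU := h₄ _ hp (hpτ.trans_le hττ₄) _ hσ
    have e1 := hGlow _ hσ _ ⟨hp, hpτ⟩
    have e2 := X.norm_hatFn_add h0 hU
    rw [hGeq _ _ hp] at e2
    rw [tpow_tpow_inv hp] at e2
    rw [e2, Real.exp_lt_one_iff]
    have : 0 < m₀ / 2 * X.absQ ξ ^ k := mul_pos (by linarith) (Real.rpow_pos_of_pos hp _)
    linarith
  -- Chosen so that the contribution of `y` to `F''` is at most `1/(4t)`; the summand `1` keeps the
  -- denominator positive. The radius `s` enters only through the threshold on `n`.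
  · set ε : ℝ := 1 / 4 / (|s| * (‖E‖ ^ 2 + ‖E‖) * |m₂| + 1) with hε
    have hden : 0 < |s| * (‖E‖ ^ 2 + ‖E‖) * |m₂| + 1 := by positivity
    have hden' : 0 < |s| * ‖E‖ * |m₂| + 1 := by positivity
    obtain ⟨N₁, hN₁⟩ := hc.exists_norm_tpow_le_mul τ (ε := ε) (by positivity)
    obtain ⟨N₂, hN₂⟩ := hc.exists_norm_tpow_le_mul τ
      (ε := 1 / 4 / (|s| * ‖E‖ * |m₂| + 1)) (by positivity)
    refine ⟨max N₁ N₂, fun n hn hn1 x hx => ?_⟩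
    have hn0 : (0 : ℝ) < n := by exact_mod_cast hn1
    set y : Rd d := latticePt x - (n : ℝ) • X.α with hy
    have hys : ‖y‖ ≤ |s| := hx.trans (le_abs_self s)
    have hle : (n : ℝ) ^ (-endTrace E) ≤ (n : ℝ) ^ (-μ) :=
      Real.rpow_le_rpow_of_exponent_le (by exact_mod_cast hn1) (by linarith)
    refine (norm_setIntegral_le_of_radial hd hφ hsup hP hE hc ξ₀ n x δ
      (C := C₀ * (n : ℝ) ^ (-μ)) fun ξ hξ => ?_).trans_eq (by ring)
    have hξA := hannA hξ
    set q : ℝ → ℝ := fun s => X.Qt (tpow s E ξ) with hq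
    set F : ℝ → ℝ := fun t => t * polyFn X.Q ξ + q t + (n : ℝ)⁻¹ * linForm y (tpow t E ξ) with hF
    set F1 : ℝ → ℝ := fun t => polyFn X.Q ξ + deriv q t +
      (n : ℝ)⁻¹ * linForm y (t⁻¹ • E (tpow t E ξ)) with hF1
    set F2 : ℝ → ℝ := fun t => deriv (deriv q) t + (n : ℝ)⁻¹ *
      linForm y (t⁻¹ • E (t⁻¹ • E (tpow t E ξ)) + (-(t ^ 2)⁻¹) • E (tpow t E ξ)) with hF2
    have hFd : ∀ t ∈ Ioo 0 τ, HasDerivAt F (F1 t) t := fun t ht => by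
      have e1 := (h₁ t ht.1 (ht.2.trans_le hττ₁) ξ hξA).2.1
      have e2 := (hasDerivAt_linForm_tpow ht.1 E y ξ).1.const_mul (n : ℝ)⁻¹
      have e3 := (hasDerivAt_id t).mul_const (polyFn X.Q ξ)
      rw [one_mul] at e3
      exact (e3.add e1).add e2
    have hF1d : ∀ t ∈ Ioo 0 τ, HasDerivAt F1 (F2 t) t := fun t ht => by
      have e1 := (h₂ t ht.1 (ht.2.trans_le hττ₂) ξ hξA).1
      have e2 := (hasDerivAt_linForm_tpow ht.1 E y ξ).2.1.const_mul (n : ℝ)⁻¹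
      exact (e1.const_add (polyFn X.Q ξ)).add e2
    have hE2 : |s| * ‖E‖ * |m₂| * (1 / 4 / (|s| * ‖E‖ * |m₂| + 1)) ≤ 1 / 4 := by
      rw [mul_div_assoc', div_le_iff₀ hden']; linarith
    have hE1 : |s| * (‖E‖ ^ 2 + ‖E‖) * |m₂| * ε ≤ 1 / 4 := by
      rw [hε, mul_div_assoc', div_le_iff₀ hden]; linarith
    have bF1 : ∀ t, (n : ℝ)⁻¹ ≤ t → t < τ → 1 / 2 ≤ |F1 t| := fun t hnt ht => by
      have ht0 : 0 < t := (inv_pos.2 hn0).trans_le hnt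
      have e1 := (h₁ t ht0 (ht.trans_le hττ₁) ξ hξA).2.2
      have e2 := (hasDerivAt_linForm_tpow ht0 E y ξ).2.2.1
      have e3 := hN₂ n ((le_max_right _ _).trans hn) hn1 t hnt ht
      have e4 : |(n : ℝ)⁻¹ * linForm y (t⁻¹ • E (tpow t E ξ))| ≤ 1 / 4 := by
        rw [abs_mul, abs_of_pos (inv_pos.2 hn0)]
        calc (n : ℝ)⁻¹ * |linForm y (t⁻¹ • E (tpow t E ξ))|
            ≤ (n : ℝ)⁻¹ * (|s| * ‖E‖ * |m₂| *
              (1 / 4 / (|s| * ‖E‖ * |m₂| + 1) * (n * t)) / t) := by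
              refine mul_le_mul_of_nonneg_left (e2.trans ?_) (inv_nonneg.2 hn0.le)
              gcongr
              exact hm₂ ξ hξA
          _ = |s| * ‖E‖ * |m₂| * (1 / 4 / (|s| * ‖E‖ * |m₂| + 1)) := by field_simp
          _ ≤ 1 / 4 := hE2
      have e5 : 1 ≤ |polyFn X.Q ξ| := hξ.1
      have e6 := abs_sub_abs_le_abs_sub (polyFn X.Q ξ)
        (-(deriv q t + (n : ℝ)⁻¹ * linForm y (t⁻¹ • E (tpow t E ξ))))
      rw [abs_neg, sub_neg_eq_add, ← add_assoc] at e6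
      have e7 := abs_add_le (deriv q t) ((n : ℝ)⁻¹ * linForm y (t⁻¹ • E (tpow t E ξ)))
      simp only [hF1]
      linarith
    have bF2 : ∀ t, (n : ℝ)⁻¹ ≤ t → t < τ → |F2 t| ≤ 1 / 2 / t := fun t hnt ht => by
      have ht0 : 0 < t := (inv_pos.2 hn0).trans_le hnt
      have e1 := (h₂ t ht0 (ht.trans_le hττ₂) ξ hξA).2
      have e2 := (hasDerivAt_linForm_tpow ht0 E y ξ).2.2.2
      have e3 := hN₁ n ((le_max_left _ _).trans hn) hn1 t hnt ht
      have e4 : |(n : ℝ)⁻¹ * linForm y (t⁻¹ • E (t⁻¹ • E (tpow t E ξ)) +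
          (-(t ^ 2)⁻¹) • E (tpow t E ξ))| ≤ 1 / 4 / t := by
        rw [abs_mul, abs_of_pos (inv_pos.2 hn0)]
        calc _ ≤ (n : ℝ)⁻¹ * (|s| * (‖E‖ ^ 2 + ‖E‖) * |m₂| * (ε * (n * t)) / t ^ 2) := by
              refine mul_le_mul_of_nonneg_left (e2.trans ?_) (inv_nonneg.2 hn0.le)
              gcongr
              exact hm₂ ξ hξA
          _ = |s| * (‖E‖ ^ 2 + ‖E‖) * |m₂| * ε / t := by field_simp
          _ ≤ 1 / 4 / t := by gcongr
      refine (abs_add_le _ _).trans ((add_le_add e1 e4).trans_eq ?_)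
      ring
    have hT : δ / X.absQ ξ < τ := (div_le_self hδ0.le hξ.1).trans_lt hδτ
    have key := norm_integral_Ioc_oscillatory_le (T := δ / X.absQ ξ) hμ0 hlt hk0
      (show (0 : ℝ) < 1 / 2 by norm_num)
      (show 0 < m₀ / 2 by linarith) (show (0 : ℝ) ≤ 1 / 2 by norm_num)
      (show 0 ≤ k * (|m₁| + m₀ / 2) by positivity) (inv_pos.2 hn0) hT hFd hF1d (hGd ξ hξA) bF1 bF2
      (hGlow ξ hξA) (hG1b ξ hξA)
    rw [integral_Ioc_eq_integral_Ioo, inv_inv, Real.inv_rpow hn0.le, ← Real.rpow_neg hn0.le] at key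
    have hcongr : ∫ t in Ioo 0 (δ / X.absQ ξ), t ^ (endTrace E - 1) •
        (hatFn φ (tpow t E ξ + ξ₀) ^ n * latChar (-x) (tpow t E ξ)) =
        hatFn φ ξ₀ ^ n * ∫ t in Ioo 0 (δ / X.absQ ξ), t ^ (endTrace E - 1) •
          Complex.exp (-((n : ℝ) * (Complex.I * F t + G ξ t))) := by
      rw [← integral_const_mul]
      refine setIntegral_congr_fun measurableSet_Ioo fun t ht => ?_
      have ht0 : 0 < t := ht.1
      have htτ : t < τ := ht.2.trans hT
      have hU := h₄ t ht0 (htτ.trans_le hττ₄) ξ hξA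
      have hxy : latticePt x = (n : ℝ) • X.α + y := by rw [hy]; abel
      rw [X.hatFn_eq_exp h0 hU, latChar_neg_eq, mul_pow, ← Complex.exp_nat_mul, mul_assoc,
        ← Complex.exp_add, mul_smul_comm, hGeq ξ t ht0, hQ t ht0, hxy, linForm_add_left,
        linForm_smul_left]
      congr 3
      have hnc : (n : ℂ) ≠ 0 := by exact_mod_cast hn0.ne'
      simp only [hF, hq]
      push_cast
      field_simp
      ring
    rw [hcongr, norm_mul, norm_pow, h0, one_pow, one_mul]
    exact key.trans (mul_le_mul_of_nonneg_left hle hC₀0)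

end ImaginaryType

/-! ### From local to global bounds. -/

section Global

open MeasureTheory Set

variable {d : ℕ}

/-- The hypotheses concern one representative modulo `2πℤ^d`, while a shifted box may contain
others; periodicity transports the local bounds. -/
theorem exists_mem_Ioc_periodic (φ : Zd d → ℂ) (ζ : Rd d) :
    ∃ ξ₀ : Rd d, (∀ i, ξ₀ i ∈ Ioc (-Real.pi) Real.pi) ∧
      ∀ ξ : Rd d, hatFn φ (ξ + ζ) = hatFn φ (ξ + ξ₀) := by
  have hp : (0 : ℝ) < 2 * Real.pi := Real.two_pi_pos
  set m : Fin d → ℤ := fun i => toIocDiv hp (-Real.pi) (ζ i) with hm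
  set θ : Rd d := WithLp.toLp 2 fun i => (m i : ℝ) * (2 * Real.pi) with hθ
  refine ⟨ζ - θ, fun i => ?_, fun ξ => ?_⟩
  · have h := toIocMod_mem_Ioc hp (-Real.pi) (ζ i)
    rw [← self_sub_toIocDiv_zsmul, zsmul_eq_mul] at h
    have e : -Real.pi + 2 * Real.pi = Real.pi := by ring
    rw [e] at h
    exact h
  · have h1 : ∀ x : Zd d, latChar x θ = 1 := fun x => by
      rw [latChar, Complex.exp_eq_one_iff]
      refine ⟨∑ i, x i * m i, ?_⟩
      simp only [hθ]
      push_cast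
      rw [Finset.sum_mul, Finset.mul_sum]
      exact Finset.sum_congr rfl fun i _ => by ring
    have h2 : ξ + ζ = (ξ + (ζ - θ)) + θ := by abel
    rw [hatFn_eq, hatFn_eq]
    congr 1
    funext x
    rw [h2, latChar_add_right x _ θ, h1, mul_one]

theorem HasLocalBound.congr {φ : Zd d → ℂ} {α : Rd d} {μ : ℝ} {ξ₀ ζ : Rd d}
    (h : HasLocalBound φ α μ ξ₀) (heq : ∀ ξ : Rd d, hatFn φ (ξ + ζ) = hatFn φ (ξ + ξ₀)) :
    HasLocalBound φ α μ ζ := by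
  unfold HasLocalBound at h ⊢
  simpa only [heq] using h

/-- A local bound includes a neighborhood on which `|φ̂| < 1` except at its centre. -/
theorem isDiscrete_of_hasLocalBound {φ : Zd d → ℂ} {α : Rd d} {μ : ℝ}
    (h : ∀ ζ : Rd d, ‖hatFn φ ζ‖ = 1 → HasLocalBound φ α μ ζ) :
    IsDiscrete {ζ : Rd d | ‖hatFn φ ζ‖ = 1} := by
  rw [isDiscrete_iff_forall_mem_exists_isOpen]
  intro ζ hζ
  obtain ⟨V, hV, h0, -, hlt, -⟩ := h ζ hζ 1 one_pos
  refine ⟨(fun ξ => ξ - ζ) ⁻¹' V, hV.preimage (by fun_prop), ?_⟩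
  ext ξ
  simp only [mem_inter_iff, mem_preimage, mem_ofPred_eq, mem_singleton_iff]
  constructor
  · rintro ⟨h1, h2⟩
    by_contra hne
    have := hlt _ h1 (sub_ne_zero.2 hne)
    rw [sub_add_cancel, h2] at this
    exact lt_irrefl _ this
  · rintro rfl
    exact ⟨by rwa [sub_self], hζ⟩

/-- A translate of the fundamental domain whose boundary avoids a given countable set. -/
theorem exists_generic_box {Z : Set (Rd d)} (hZ : Z.Countable) :
    ∃ a : Rd d, ∀ ζ ∈ Z, (∀ i, ζ i ∈ Icc (a i - Real.pi) (a i + Real.pi)) →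
      ∀ i, ζ i ∈ Ioo (a i - Real.pi) (a i + Real.pi) := by
  have h : ∀ i, ∃ t : ℝ, t ∉ ((fun ζ : Rd d => ζ i - Real.pi) '' Z ∪
      (fun ζ : Rd d => ζ i + Real.pi) '' Z) := fun i =>
    ((((hZ.image _).union (hZ.image _))).dense_compl ℝ).nonempty
  choose a ha using h
  refine ⟨WithLp.toLp 2 a, fun ζ hζ hb i => ?_⟩
  have h1 : ζ i - Real.pi ≠ a i := fun h' => ha i (Or.inl ⟨ζ, hζ, h'⟩)
  have h2 : ζ i + Real.pi ≠ a i := fun h' => ha i (Or.inr ⟨ζ, hζ, h'⟩)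
  have hi := hb i
  simp only [mem_Icc] at hi
  refine ⟨lt_of_le_of_ne hi.1 fun h' => h2 ?_, lt_of_le_of_ne hi.2 fun h' => h1 ?_⟩
  · change a i - Real.pi = ζ i at h'
    linarith
  · change ζ i = a i + Real.pi at h'
    linarith

theorem exists_pow_le_rpow_neg {ρ : ℝ} (h0 : 0 ≤ ρ) (h1 : ρ < 1) (μ : ℝ) :
    ∃ C : ℝ, 0 ≤ C ∧ ∀ n : ℕ, 1 ≤ n → ρ ^ n ≤ C * (n : ℝ) ^ (-μ) := by
  obtain ⟨k, hk⟩ := exists_nat_ge μ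
  obtain ⟨C, hC⟩ := (tendsto_pow_const_mul_const_pow_of_abs_lt_one k
    (by rwa [abs_of_nonneg h0])).bddAbove_range
  refine ⟨max C 0, le_max_right _ _, fun n hn => ?_⟩
  have hn0 : (0 : ℝ) < n := by exact_mod_cast hn
  have h2 : (n : ℝ) ^ k * ρ ^ n ≤ max C 0 := (hC ⟨n, rfl⟩).trans (le_max_left _ _)
  rw [Real.rpow_neg hn0.le, ← div_eq_mul_inv, le_div_iff₀ (Real.rpow_pos_of_pos hn0 _)]
  refine le_trans ?_ h2
  rw [mul_comm]
  gcongr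
  rw [← Real.rpow_natCast]
  exact Real.rpow_le_rpow_of_exponent_le (by exact_mod_cast hn) hk

theorem setIntegral_translate (φ : Zd d → ℂ) (ζ : Rd d) (V : Set (Rd d)) (n : ℕ) (x : Zd d) :
    ‖∫ ξ in (fun ξ => ξ - ζ) ⁻¹' V, hatFn φ ξ ^ n * latChar (-x) ξ‖ =
      ‖∫ ξ in V, hatFn φ (ξ + ζ) ^ n * latChar (-x) ξ‖ := by
  have hmp : MeasurePreserving (fun ξ : Rd d => ξ - ζ) volume volume :=
    measurePreserving_sub_right volume ζ
  have h := hmp.setIntegral_preimage_emb (MeasurableEquiv.subRight ζ).measurableEmbedding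
    (fun ξ => hatFn φ (ξ + ζ) ^ n * latChar (-x) (ξ + ζ)) V
  simp only [sub_add_cancel] at h
  rw [h]
  simp only [latChar_add_right, ← mul_assoc]
  rw [integral_mul_const, norm_mul, norm_latChar, mul_one]

/-- The set `|φ̂| = 1` is closed and discrete, hence finite in the closed box. For a generic box
none of its points in the closed box lie on the boundary, so they have disjoint neighborhoods inside
the box that carry the local bounds. On the compact remainder `|φ̂| ≤ ρ < 1`, and `ρ^n` beats any
power of `n`. -/
theorem exists_bound_of_hasLocalBound {φ : Zd d → ℂ} (hφ : Summable fun x => ‖φ x‖)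
    (hsup : (⨆ ξ : Rd d, ‖hatFn φ ξ‖) = 1) {α : Rd d} {μ : ℝ}
    (h : ∀ ζ : Rd d, ‖hatFn φ ζ‖ = 1 → HasLocalBound φ α μ ζ) :
    ∃ C : ℝ, ∀ s : ℝ, ∃ N : ℕ, ∀ n : ℕ, N ≤ n → 1 ≤ n → ∀ x : Zd d,
      ‖latticePt x - (n : ℝ) • α‖ ≤ s → ‖convPow φ n x‖ ≤ C * (n : ℝ) ^ (-μ) := by
  classical
  set Z : Set (Rd d) := {ζ : Rd d | ‖hatFn φ ζ‖ = 1} with hZ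
  have hZd : IsDiscrete Z := isDiscrete_of_hasLocalBound h
  have hZc : Z.Countable := by
    have := isDiscrete_iff_discreteTopology.1 hZd
    exact Set.countable_coe_iff.1 (TopologicalSpace.separableSpace_iff_countable.1 inferInstance)
  have hcont : Continuous fun ξ : Rd d => ‖hatFn φ ξ‖ := (continuous_hatFn hφ).norm
  have hZcl : IsClosed Z := isClosed_eq hcont continuous_const
  obtain ⟨a, ha⟩ := exists_generic_box hZc
  set Bc : Set (Rd d) := {ξ : Rd d | ∀ i, ξ i ∈ Icc (a i - Real.pi) (a i + Real.pi)} with hBc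
  have hBcc : IsCompact Bc := isCompact_closedBox a
  set O : Set (Rd d) := {ξ : Rd d | ∀ i, ξ i ∈ Ioo (a i - Real.pi) (a i + Real.pi)} with hO
  have hOo : IsOpen O := by
    have : O = ⋂ i, (fun ξ : Rd d => ξ i) ⁻¹' Ioo (a i - Real.pi) (a i + Real.pi) := by
      ext ξ; simp [hO]
    rw [this]
    exact isOpen_iInter_of_finite fun i => isOpen_Ioo.preimage (by fun_prop)
  have hOB : O ⊆ torusBox a := fun ξ hξ i => ⟨(hξ i).1, (hξ i).2.le⟩
  have hBB : torusBox a ⊆ Bc := fun ξ hξ i => ⟨(hξ i).1.le, (hξ i).2⟩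
  have hfin : (Bc ∩ Z).Finite := (hBcc.inter_right hZcl).finite (hZd.mono inter_subset_right)
  set F : Finset (Rd d) := hfin.toFinset with hF
  have hFm : ∀ ζ, ζ ∈ F ↔ ζ ∈ Bc ∧ ζ ∈ Z := fun ζ => by rw [hF, hfin.mem_toFinset]; rfl
  obtain ⟨U, hU, hdisj⟩ := hfin.t2_separation
  have hex : ∀ ζ : Rd d, ∃ V : Set (Rd d), ζ ∈ F → (IsOpen V ∧ (0 : Rd d) ∈ V ∧
      (∀ ξ ∈ V, ξ + ζ ∈ U ζ ∩ O) ∧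
      ∃ C : ℝ, ∀ s : ℝ, ∃ N : ℕ, ∀ n : ℕ, N ≤ n → 1 ≤ n → ∀ x : Zd d,
        ‖latticePt x - (n : ℝ) • α‖ ≤ s →
        ‖∫ ξ in V, hatFn φ (ξ + ζ) ^ n * latChar (-x) ξ‖ ≤ C * (n : ℝ) ^ (-μ)) := fun ζ => by
    by_cases hζ : ζ ∈ F
    · have hζ' := (hFm ζ).1 hζ
      have hop : IsOpen (U ζ ∩ O) := (hU ζ).2.inter hOo
      obtain ⟨r, hr, hball⟩ := Metric.isOpen_iff.1 hop ζ ⟨(hU ζ).1, ha ζ hζ'.2 hζ'.1⟩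
      obtain ⟨V, hV, h0, hVr, -, hC⟩ := h ζ hζ'.2 r hr
      refine ⟨V, fun _ => ⟨hV, h0, fun ξ hξ => hball ?_, hC⟩⟩
      rw [Metric.mem_ball, dist_eq_norm, add_sub_cancel_right]
      exact hVr ξ hξ
    · exact ⟨∅, fun h' => absurd h' hζ⟩
  choose V hV using hex
  set W : Rd d → Set (Rd d) := fun ζ => (fun ξ => ξ - ζ) ⁻¹' V ζ with hW
  have hWo : ∀ ζ ∈ F, IsOpen (W ζ) := fun ζ hζ => (hV ζ hζ).1.preimage (by fun_prop)
  have hWU : ∀ ζ ∈ F, W ζ ⊆ U ζ ∩ O := fun ζ hζ ξ hξ => by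
    have := (hV ζ hζ).2.2.1 _ hξ
    rwa [sub_add_cancel] at this
  have hCex : ∀ ζ : Rd d, ∃ C : ℝ, ζ ∈ F → ∀ s : ℝ, ∀ᶠ n : ℕ in Filter.atTop, 1 ≤ n →
      ∀ x : Zd d, ‖latticePt x - (n : ℝ) • α‖ ≤ s →
        ‖∫ ξ in W ζ, hatFn φ ξ ^ n * latChar (-x) ξ‖ ≤ C * (n : ℝ) ^ (-μ) := fun ζ => by
    by_cases hζ : ζ ∈ F
    · obtain ⟨C, hC⟩ := (hV ζ hζ).2.2.2
      refine ⟨C, fun _ s => ?_⟩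
      obtain ⟨N, hN⟩ := hC s
      filter_upwards [Filter.eventually_ge_atTop N] with n hn hn1 x hx
      rw [setIntegral_translate]
      exact hN n hn hn1 x hx
    · exact ⟨0, fun h' => absurd h' hζ⟩
  choose C hC using hCex
  set S : Set (Rd d) := ⋃ ζ ∈ F, W ζ with hS
  have hSo : IsOpen S := isOpen_biUnion hWo
  have hSB : S ⊆ torusBox a := iUnion₂_subset fun ζ hζ => (hWU ζ hζ).trans
    (inter_subset_right.trans hOB)
  -- away from `Ω(φ)`
  obtain ⟨ρ, hρ0, hρ1, hρ⟩ : ∃ ρ : ℝ, 0 ≤ ρ ∧ ρ < 1 ∧ ∀ ξ ∈ Bc \ S, ‖hatFn φ ξ‖ ≤ ρ := by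
    have hcomp : IsCompact (Bc \ S) := hBcc.diff hSo
    rcases (Bc \ S).eq_empty_or_nonempty with he | hne
    · exact ⟨0, le_rfl, one_pos, fun ξ hξ => by rw [he] at hξ; exact absurd hξ (notMem_empty _)⟩
    · obtain ⟨ξ, hξ, hmax⟩ := hcomp.exists_isMaxOn hne hcont.continuousOn
      refine ⟨‖hatFn φ ξ‖, norm_nonneg _, lt_of_le_of_ne (norm_hatFn_le_one hφ hsup ξ) fun h1 => ?_,
        fun η hη => hmax hη⟩
      have hξF : ξ ∈ F := (hFm ξ).2 ⟨hξ.1, h1⟩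
      refine hξ.2 (mem_biUnion (t := W) (by exact_mod_cast hξF) ?_)
      change ξ - ξ ∈ V ξ
      rw [sub_self]
      exact (hV ξ hξF).2.1
  obtain ⟨C₁, hC₁, hρC⟩ := exists_pow_le_rpow_neg hρ0 hρ1 μ
  have hpi : (0 : ℝ) < (2 * Real.pi) ^ d := by positivity
  refine ⟨((2 * Real.pi) ^ d)⁻¹ * (∑ ζ ∈ F, C ζ + C₁ * volume.real (torusBox a)), fun s => ?_⟩
  have hall : ∀ᶠ n : ℕ in Filter.atTop, ∀ ζ ∈ F, 1 ≤ n →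
      ∀ x : Zd d, ‖latticePt x - (n : ℝ) • α‖ ≤ s →
        ‖∫ ξ in W ζ, hatFn φ ξ ^ n * latChar (-x) ξ‖ ≤ C ζ * (n : ℝ) ^ (-μ) :=
    (Filter.eventually_all_finset F).2 fun ζ hζ => hC ζ hζ s
  obtain ⟨N, hN⟩ := Filter.eventually_atTop.1 hall
  refine ⟨N, fun n hn hn1 x hx => ?_⟩
  set f : Rd d → ℂ := fun ξ => hatFn φ ξ ^ n * latChar (-x) ξ with hf
  have hfc : Continuous f := ((continuous_hatFn hφ).pow n).mul (continuous_latChar _)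
  have hBfin := measure_torusBox_lt_top a
  have hfB : IntegrableOn f (torusBox a) :=
    (hfc.continuousOn.integrableOn_compact hBcc).mono_set hBB
  have hsplit : ∫ ξ in torusBox a, f ξ = (∫ ξ in S, f ξ) + ∫ ξ in torusBox a \ S, f ξ := by
    rw [← integral_inter_add_sdiff hSo.measurableSet hfB, inter_eq_right.2 hSB]
  have hSint : ∫ ξ in S, f ξ = ∑ ζ ∈ F, ∫ ξ in W ζ, f ξ := by
    refine integral_biUnion_finset F (fun ζ hζ => (hWo ζ hζ).measurableSet) ?_ fun ζ hζ =>
      hfB.mono_set ((hWU ζ hζ).trans (inter_subset_right.trans hOB))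
    intro ζ hζ ζ' hζ' hne
    have hζm : ζ ∈ Bc ∩ Z := (hFm ζ).1 (by exact_mod_cast hζ)
    have hζm' : ζ' ∈ Bc ∩ Z := (hFm ζ').1 (by exact_mod_cast hζ')
    exact (hdisj hζm hζm' hne).mono ((hWU ζ (by exact_mod_cast hζ)).trans inter_subset_left)
      ((hWU ζ' (by exact_mod_cast hζ')).trans inter_subset_left)
  have hrest : ‖∫ ξ in torusBox a \ S, f ξ‖ ≤ C₁ * (n : ℝ) ^ (-μ) * volume.real (torusBox a) := by
    refine (norm_setIntegral_le_of_norm_le_const (C := C₁ * (n : ℝ) ^ (-μ))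
      ((measure_mono sdiff_subset).trans_lt hBfin) fun ξ hξ => ?_).trans ?_
    · rw [hf, norm_mul, norm_latChar, mul_one, norm_pow]
      exact (pow_le_pow_left₀ (norm_nonneg _) (hρ ξ ⟨hBB hξ.1, hξ.2⟩) n).trans (hρC n hn1)
    · have := measureReal_mono (μ := volume) (sdiff_subset (s := torusBox a) (t := S)) hBfin.ne
      gcongr
  have hinv := integral_hatFn_mul_latChar (summable_norm_convPow hφ n) a x
  simp only [hatFn_convPow hφ] at hinv
  have hnorm : (2 * Real.pi) ^ d * ‖convPow φ n x‖ = ‖∫ ξ in torusBox a, f ξ‖ := by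
    rw [hf, hinv, norm_mul]
    congr 1
    rw [norm_pow, norm_mul]
    simp [abs_of_pos Real.pi_pos]
  have hmain : (2 * Real.pi) ^ d * ‖convPow φ n x‖ ≤
      (∑ ζ ∈ F, C ζ + C₁ * volume.real (torusBox a)) * (n : ℝ) ^ (-μ) := by
    rw [hnorm, hsplit, hSint]
    calc _ ≤ ∑ ζ ∈ F, ‖∫ ξ in W ζ, f ξ‖ + ‖∫ ξ in torusBox a \ S, f ξ‖ :=
          (norm_add_le _ _).trans (by gcongr; exact norm_sum_le _ _)
      _ ≤ ∑ ζ ∈ F, C ζ * (n : ℝ) ^ (-μ) + C₁ * (n : ℝ) ^ (-μ) * volume.real (torusBox a) := by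
          refine add_le_add (Finset.sum_le_sum fun ζ hζ => ?_) hrest
          exact hN n hn ζ hζ hn1 x hx
      _ = _ := by rw [← Finset.sum_mul]; ring
  rw [mul_assoc, ← div_eq_inv_mul, le_div_iff₀ hpi]
  linarith

/-- A bound that holds eventually on every ball holds on slowly growing balls for all `n`. -/
theorem exists_growing_compacts {u : ℕ → Zd d → ℝ} {α : Rd d} {μ C : ℝ}
    (hb : ∀ n, ∃ B : ℝ, ∀ x, u n x ≤ B)
    (h : ∀ s : ℝ, ∃ N : ℕ, ∀ n : ℕ, N ≤ n → 1 ≤ n → ∀ x : Zd d,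
      ‖latticePt x - (n : ℝ) • α‖ ≤ s → u n x ≤ C * (n : ℝ) ^ (-μ))
    {K : Set (Rd d)} (hK : IsCompact K) :
    ∃ C' : ℝ, 0 < C' ∧ ∃ Kn : ℕ → Set (Rd d),
      (∀ n, IsCompact (Kn n)) ∧ (∀ n, K ⊆ Kn n) ∧ Monotone Kn ∧ (⋃ n, Kn n) = univ ∧
      ∀ n : ℕ, 1 ≤ n → ∀ x : Zd d, latticePt x ∈ (fun y => (n : ℝ) • α + y) '' Kn n →
        u n x ≤ C' * (n : ℝ) ^ (-μ) := by
  choose N hN using fun m : ℕ => h m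
  choose B hB using hb
  obtain ⟨r, hr⟩ := hK.isBounded.exists_norm_le
  obtain ⟨r₀, hr₀⟩ := exists_nat_ge r
  set T : ℕ → ℕ := fun m => ∑ j ∈ Finset.range (m + 1), (N j + 1) with hT
  have hTN : ∀ m, N m ≤ T m := fun m => by
    have : N m + 1 ≤ T m := Finset.single_le_sum (f := fun j => N j + 1) (fun _ _ => Nat.zero_le _)
      (Finset.mem_range.2 (Nat.lt_succ_self m))
    omega
  -- The largest radius `m ≤ n` whose threshold `T m` has been passed by `n`; monotone and
  -- unbounded.
  set g : ℕ → ℕ := fun n => Nat.findGreatest (fun m => T m ≤ n) n with hg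
  have hgm : Monotone g := fun a b hab =>
    Nat.findGreatest_mono (fun m hm => le_trans hm hab) hab
  have hgT : ∀ m, m ≤ g (T m + m) := fun m =>
    Nat.le_findGreatest (by omega) (by omega)
  have hball : ∀ (n : ℕ) (x : Zd d), latticePt x ∈ (fun y => (n : ℝ) • α + y) ''
      Metric.closedBall (0 : Rd d) ((max r₀ (g n) : ℕ) : ℝ) →
      ‖latticePt x - (n : ℝ) • α‖ ≤ ((max r₀ (g n) : ℕ) : ℝ) := by
    rintro n x ⟨y, hy, hxy⟩
    rw [← hxy, add_sub_cancel_left]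
    simpa using hy
  -- The sum absorbs the finitely many `n` below the threshold of the fixed radius `r₀`.
  set C' : ℝ := |C| + 1 + ∑ n ∈ Finset.range (N r₀), |B n| * (n : ℝ) ^ μ with hC'
  have hsum0 : 0 ≤ ∑ n ∈ Finset.range (N r₀), |B n| * (n : ℝ) ^ μ :=
    Finset.sum_nonneg fun n _ => by positivity
  refine ⟨C', by positivity, fun n => Metric.closedBall 0 ((max r₀ (g n) : ℕ) : ℝ),
    fun n => isCompact_closedBall _ _, fun n ξ hξ => ?_, fun a b hab => ?_, ?_,
    fun n hn1 x hx => ?_⟩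
  · rw [mem_closedBall_zero_iff]
    refine ((hr ξ hξ).trans hr₀).trans ?_
    exact_mod_cast le_max_left _ _
  · refine Metric.closedBall_subset_closedBall ?_
    exact_mod_cast max_le_max le_rfl (hgm hab)
  · refine eq_univ_of_forall fun ξ => ?_
    obtain ⟨m, hm⟩ := exists_nat_ge ‖ξ‖
    refine mem_iUnion.2 ⟨T m + m, ?_⟩
    rw [mem_closedBall_zero_iff]
    refine hm.trans ?_
    exact_mod_cast (hgT m).trans (le_max_right _ _)
  · have hn0 : (0 : ℝ) < n := by exact_mod_cast hn1
    have hpow : 0 < (n : ℝ) ^ (-μ) := Real.rpow_pos_of_pos hn0 _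
    have hx' := hball n x hx
    have hCC' : C * (n : ℝ) ^ (-μ) ≤ C' * (n : ℝ) ^ (-μ) := by
      gcongr
      linarith [le_abs_self C]
    -- If no radius qualifies, `findGreatest` returns `0`, which falls into the first case; in the
    -- second `g n ≠ 0`, so its threshold really has been passed.
    rcases le_or_gt (g n) r₀ with hle | hle
    · rw [max_eq_left hle] at hx'
      rcases lt_or_ge n (N r₀) with hlt | hge
      · have h1 : |B n| * (n : ℝ) ^ μ ≤ C' := by
          have := Finset.single_le_sum (f := fun n : ℕ => |B n| * (n : ℝ) ^ μ)
            (fun i _ => by positivity) (Finset.mem_range.2 hlt)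
          linarith [abs_nonneg C]
        calc u n x ≤ |B n| := (hB n x).trans (le_abs_self _)
          _ = |B n| * (n : ℝ) ^ μ * (n : ℝ) ^ (-μ) := by
            rw [mul_assoc, ← Real.rpow_add hn0, add_neg_cancel, Real.rpow_zero, mul_one]
          _ ≤ C' * (n : ℝ) ^ (-μ) := by gcongr
      · exact (hN r₀ n hge hn1 x hx').trans hCC'
    · rw [max_eq_right hle.le] at hx'
      have hspec : T (g n) ≤ n := Nat.findGreatest_of_ne_zero (P := fun m => T m ≤ n) (n := n) rfl
        ((Nat.zero_le r₀).trans_lt hle).ne'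
      exact (hN (g n) n ((hTN _).trans hspec) hn1 x hx').trans hCC'

/-- A lower bound valid for large `n` extends to all `n ≥ 1` by positivity. -/
theorem exists_pos_le_of_eventually {f : ℕ → ℝ} (hf : ∀ n, 1 ≤ n → 0 < f n) (N : ℕ)
    (h : ∃ c : ℝ, 0 < c ∧ ∀ n, N ≤ n → 1 ≤ n → c ≤ f n) :
    ∃ c : ℝ, 0 < c ∧ ∀ n, 1 ≤ n → c ≤ f n := by
  induction N with
  | zero =>
    obtain ⟨c, hc, h⟩ := h
    exact ⟨c, hc, fun n hn => h n (Nat.zero_le n) hn⟩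
  | succ N ih =>
    obtain ⟨c, hc, h⟩ := h
    apply ih
    rcases Nat.eq_zero_or_pos N with rfl | hN
    · exact ⟨c, hc, fun n _ hn => h n (by omega) hn⟩
    · refine ⟨min c (f N), lt_min hc (hf N hN), fun n hn hn1 => ?_⟩
      rcases hn.eq_or_lt with rfl | hlt
      · exact min_le_right _ _
      · exact (min_le_left _ _).trans (h n hlt hn1)

theorem GammaExpansion.IsImaginary.homOrder_pos (hd : 1 ≤ d) {φ : Zd d → ℂ} {ξ₀ : Rd d}
    {X : GammaExpansion φ ξ₀} (hX : X.IsImaginary) : 0 < homOrder X.absQ := by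
  obtain ⟨hP, -, E, hE, k, -, -, hQt, -⟩ := hX
  rw [hP.homOrder_eq hE hQt.2.2.2.1]
  exact hQt.2.2.2.1.endTrace_pos hd

theorem GammaExpansion.IsPositive.homOrder_pos (hd : 1 ≤ d) {φ : Zd d → ℂ} {ξ₀ : Rd d}
    {X : GammaExpansion φ ξ₀} (hX : X.IsPositive) : 0 < homOrder (polyFn X.R) := by
  obtain ⟨hP, E, hE, -, hRt, -⟩ := hX
  rw [hP.homOrder_eq hE hRt.2.2.2.1]
  exact hRt.2.2.2.1.endTrace_pos hd

/-- Bounds the orders from below, so that `sInf` in `phiOrder` is a genuine infimum. -/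
theorem pointOrder_nonneg (hd : 1 ≤ d) (φ : Zd d → ℂ) (ξ : Rd d) : 0 ≤ pointOrder φ ξ := by
  unfold pointOrder
  split_ifs with h1 h2
  · exact (h1.choose_spec.homOrder_pos hd).le
  · exact (h2.choose_spec.homOrder_pos hd).le
  · exact le_rfl

theorem phiOrder_le_pointOrder (hd : 1 ≤ d) {φ : Zd d → ℂ} {ξ : Rd d} (hξ : ξ ∈ OmegaSet φ) :
    phiOrder φ ≤ pointOrder φ ξ :=
  csInf_le ⟨0, by rintro _ ⟨η, -, rfl⟩; exact pointOrder_nonneg hd φ η⟩ ⟨ξ, hξ, rfl⟩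

theorem iSup_norm_convPow_pos {φ : Zd d → ℂ} (hφ : Summable fun x => ‖φ x‖) {ξ₀ : Rd d}
    (h0 : ‖hatFn φ ξ₀‖ = 1) (n : ℕ) : 0 < ⨆ x : Zd d, ‖convPow φ n x‖ := by
  have hs := summable_norm_convPow hφ n
  by_contra hneg
  have hz : ∀ x, convPow φ n x = 0 := fun x => by
    have h1 : ‖convPow φ n x‖ ≤ ⨆ x : Zd d, ‖convPow φ n x‖ := le_ciSup (bddAbove_norm hs) x
    exact norm_le_zero_iff.1 (h1.trans (not_lt.1 hneg))
  have h2 := hatFn_convPow hφ n ξ₀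
  rw [hatFn_eq] at h2
  simp only [hz, zero_mul, tsum_zero] at h2
  have h3 : ‖hatFn φ ξ₀ ^ n‖ = 1 := by rw [norm_pow, h0, one_pow]
  rw [← h2, norm_zero] at h3
  exact zero_ne_one h3

end Global

/-! ### The main theorem. -/

theorem theorem4p1 {d : ℕ} (hd : 1 ≤ d) (φ : Zd d → ℂ) (hφ : MemSd φ)
    (hsup : (⨆ ξ : Rd d, ‖hatFn φ ξ‖) = 1)
    (htype : ∀ ξ ∈ OmegaSet φ, IsPosHomType φ ξ ∨ IsImagHomType φ ξ)
    (hne : (OmegaImag φ).Nonempty)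
    (hlt : ∀ ξ ∈ OmegaImag φ, pointOrder φ ξ < 1)
    (hdom : ∃ ξ ∈ OmegaImag φ, pointOrder φ ξ = phiOrder φ)
    (α : Rd d) (hα : ∀ ξ ∈ OmegaImag φ, drift φ ξ = α) :
    (∀ K : Set (Rd d), IsCompact K →
      ∃ C' : ℝ, 0 < C' ∧ ∃ Kn : ℕ → Set (Rd d),
        (∀ n, IsCompact (Kn n)) ∧ (∀ n, K ⊆ Kn n) ∧ Monotone Kn ∧ (⋃ n, Kn n) = Set.univ ∧
        ∀ n : ℕ, 1 ≤ n → ∀ x : Zd d, latticePt x ∈ (fun y => (n : ℝ) • α + y) '' Kn n →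
          ‖convPow φ n x‖ ≤ C' * (n : ℝ) ^ (-phiOrder φ)) ∧
    ∃ C : ℝ, 0 < C ∧ ∀ n : ℕ, 1 ≤ n →
      C * (n : ℝ) ^ (-phiOrder φ) ≤ ⨆ x : Zd d, ‖convPow φ n x‖ := by
  have hs := hφ.summable_norm
  constructor
  · have hloc : ∀ ζ : Rd d, ‖hatFn φ ζ‖ = 1 → HasLocalBound φ α (phiOrder φ) ζ := fun ζ hζ => by
      obtain ⟨ξ₀, hbox, hper⟩ := exists_mem_Ioc_periodic φ ζ
      have h0 : ‖hatFn φ ξ₀‖ = 1 := by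
        have := hper 0
        rw [zero_add, zero_add] at this
        rw [← this, hζ]
      have hΩ : ξ₀ ∈ OmegaSet φ := ⟨hbox, h0⟩
      refine HasLocalBound.congr ?_ hper
      have hle := phiOrder_le_pointOrder hd hΩ
      -- The imaginary type is tested first, as in `drift` and `pointOrder`, so that the chosen
      -- expansion is the one defining the drift and the order.
      by_cases hi : IsImagHomType φ ξ₀
      · have hord : pointOrder φ ξ₀ = homOrder hi.choose.absQ := by
          unfold pointOrder; rw [dif_pos hi]
        have hdr : drift φ ξ₀ = hi.choose.α := by unfold drift; rw [dif_pos hi]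
        rw [← hα ξ₀ ⟨hΩ, hi⟩, hdr]
        refine hi.choose_spec.hasLocalBound hd hs hsup h0 (hord ▸ hle) ?_
        rw [← hord]
        exact hlt ξ₀ ⟨hΩ, hi⟩
      · have hp := (htype ξ₀ hΩ).resolve_right hi
        have hord : pointOrder φ ξ₀ = homOrder (polyFn hp.choose.R) := by
          unfold pointOrder; rw [dif_neg hi, dif_pos hp]
        exact hp.choose_spec.hasLocalBound hd hs hsup h0 (hord ▸ hle) α
    obtain ⟨C, hC⟩ := exists_bound_of_hasLocalBound hs hsup hloc
    exact fun K hK => exists_growing_compacts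
      (fun n => ⟨_, norm_le_tsum_norm (summable_norm_convPow hs n)⟩) hC hK
  · obtain ⟨ξ₀, ⟨hΩ, hi⟩, hξ₀⟩ := hdom
    have hord : pointOrder φ ξ₀ = homOrder hi.choose.absQ := by
      unfold pointOrder; rw [dif_pos hi]
    obtain ⟨hP, -, E, hE, k, hk, hER, hQt, hRt⟩ := hi.choose_spec
    rw [hP.homOrder_eq hE hQt.2.2.2.1, hξ₀] at hord
    obtain ⟨c, hc, N, hN⟩ := hi.choose.exists_lower_bound hs hΩ.2 hk hE hER hQt hRt
    rw [← hord] at hN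
    have hpow : ∀ n : ℕ, 1 ≤ n → 0 < (n : ℝ) ^ (-phiOrder φ) := fun n hn =>
      Real.rpow_pos_of_pos (by exact_mod_cast hn) _
    -- For the finitely many small `n` the supremum is positive, because `φ^{(n)} = 0` would
    -- contradict `|φ̂(ξ₀)^n| = 1`.
    obtain ⟨C, hC, h⟩ := exists_pos_le_of_eventually
      (f := fun n : ℕ => (⨆ x : Zd d, ‖convPow φ n x‖) / (n : ℝ) ^ (-phiOrder φ))
      (fun n hn => div_pos (iSup_norm_convPow_pos hs hΩ.2 n) (hpow n hn)) N
      ⟨c, hc, fun n hn hn1 => (le_div_iff₀ (hpow n hn1)).2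
        (hN n hn hn1 _ fun x => le_ciSup (bddAbove_norm (summable_norm_convPow hs n)) x)⟩
    exact ⟨C, hC, fun n hn => (le_div_iff₀ (hpow n hn)).1 (h n hn)⟩
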